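/- Let $\widehat{\mathfrak{sl}_2}=\mathfrak{sl}_2\otimes\mathbb C[t,t^{-1}]\oplus\mathbb C c$ be the affine Lie algebra over $\mathbb C$ (without derivation), with $c$ central, $x(n)=x\otimes t^n$ and $$[x(n),y(m)]=[x,y](n+m)+n\,(x,y)\,\delta_{n+m,0}\,c ,\qquad (x,y)=\operatorname{tr}(xy),$$ and let $e,f,h$ be the standard generators of $\mathfrak{sl}_2$. For $\lambda,\mu\in\mathbb C$ let $V(\lambda,\mu,-2)=U(\widehat{\mathfrak{sl}_2})/J$, where $J$ is the left ideal generated by $e(i),\,h(i),\,f(i+1)$ $(i>0)$, $e(0)-\lambda$, $f(1)-\mu$ and $c+2$; let $w$ be the image of $1$. For $n\in\mathbb Z$ let $T(n)$ be the operator on $V(\lambda,\mu,-2)$ given by $$T(n)=\tfrac12\sum_{k\in\mathbb Z}\Big({:}e(k)f(n-k){:}+{:}f(k)e(n-k){:}+\tfrac12\,{:}h(k)h(n-k){:}\Big),$$ where ${:}x(k)y(m){:}$ is $x(k)y(m)$ if $k<0$ and $y(m)x(k)$ if $k\ge 0$ (on every vector only finitely many terms of the sum are nonzero). For a formal Laurent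 series $c(z)=\sum_{n\le 0}c_nz^{-n-2}\in\mathbb C((z))$ put $$V(\lambda,\mu,-2,c(z))=V(\lambda,\mu,-2)\big/\big\langle (T(n)-c_n)w \;:\; n\le 0\big\rangle .$$ Let $\lambda,\lambda'\in\mathbb C\setminus\{0\}$, $\mu,\mu'\in\mathbb C$, and let $c(z)=\sum_{n\le 0}c_nz^{-n-2}$, $c'(z)=\sum_{n\le 0}c'_nz^{-n-2}$ in $\mathbb C((z))$ be arbitrary. Then: (a) $V(\lambda,\mu,-2,c(z))$ is a simple $\widehat{\mathfrak{sl}_2}$-module. (b) Every simple quotient of $V(\lambda,\mu,-2)$ is of the form $V(\lambda,\mu,-2,d(z))$ for some $d(z)=\sum_{n\le 0}d_nz^{-n-2}\in\mathbb C((z))$; that is, if $N\subset V(\lambda,\mu,-2)$ is a submodule with simple quotient, then $N=\langle (T(n)-d_n)w : n\le 0\rangle$ for some such $d(z)$. (c) $V(\lambda,\mu,-2,c(z))\cong V(\lambda',\mu',-2,c'(z))$ as $\widehat{\mathfrak{sl}_2}$-modules if and only if $\lambda=\lambda'$, $\mu=\mu'$ and $c(z)=c'(z)$. -/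

import Mathlib

noncomputable section

open scoped TensorProduct

namespace AffineSl2

open LieAlgebra LieModule.Cohomology

attribute [local instance 100] LieRing.ofAssociativeRing

/-! ### The Lie algebra `sl₂` and its invariant form -/

/-- The Lie algebra `sl₂(ℂ)` of traceless `2 × 2` matrices. -/
abbrev Sl2 : Type := SpecialLinear.sl (Fin 2) ℂ

/-- The matrix unit `E₀₁`. -/
def e : Sl2 := SpecialLinear.single 0 1 (by decide) 1

/-- The matrix unit `E₁₀`. -/
def f : Sl2 := SpecialLinear.single 1 0 (by decide) 1

/-- The diagonal matrix `E₀₀ - E₁₁`. -/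
def h : Sl2 := SpecialLinear.singleSubSingle 0 1 1

/-- The normalized invariant form `(x, y) = tr (x y)` on `sl₂`: `(e, f) = 1`, `(h, h) = 2`. -/
def form : LinearMap.BilinForm ℂ Sl2 :=
  LinearMap.mk₂ ℂ (fun x y => Matrix.trace (x.1 * y.1))
    (fun x y z => by simp [add_mul])
    (fun c x y => by simp)
    (fun x y z => by simp [mul_add])
    (fun c x y => by simp)

theorem form_apply (x y : Sl2) : form x y = Matrix.trace (x.1 * y.1) := rfl

theorem form_isSymm : form.IsSymm :=
  ⟨fun x y => by simp only [form_apply]; exact Matrix.trace_mul_comm _ _⟩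

theorem form_lieInvariant : form.lieInvariant Sl2 := by
  intro x y z
  simp only [form_apply, SpecialLinear.sl_bracket, sub_mul, mul_sub, Matrix.trace_sub]
  have h1 : (x.1 * y.1 * z.1).trace = (y.1 * (z.1 * x.1)).trace := by
    rw [Matrix.mul_assoc, Matrix.trace_mul_comm, Matrix.mul_assoc]
  rw [h1, Matrix.mul_assoc]
  ring

/-! ### The affine Lie algebra `sl₂ ⊗ ℂ[t, t⁻¹] ⊕ ℂ c` -/

/-- The loop algebra `sl₂ ⊗ ℂ[t, t⁻¹]`. -/
abbrev Loop : Type := loopAlgebra ℂ ℤ Sl2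

theorem neg_form_isSymm : (-form).IsSymm :=
  ⟨fun x y => by simpa using form_isSymm.eq x y⟩

theorem neg_form_lieInvariant : (-form).lieInvariant Sl2 :=
  fun x y z => by
    rw [LinearMap.neg_apply, LinearMap.neg_apply, LinearMap.neg_apply, LinearMap.neg_apply,
      form_lieInvariant x y z]

/-- The 2-cocycle `(x ⊗ tⁿ, y ⊗ tᵐ) ↦ n (x, y) δ_{n+m,0}` of the loop algebra. The form is negated
because `twoCocycleOfBilinear` sends a form `Φ` to `(x ⊗ tⁿ, y ⊗ tᵐ) ↦ m Φ(x, y) δ_{n+m,0}`. -/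
def cocycle : twoCocycle ℂ Loop (TrivialLieModule ℂ Loop ℂ) :=
  LoopAlgebra.twoCocycleOfBilinear ℂ ℤ Sl2 (-form) neg_form_lieInvariant neg_form_isSymm

/-- The affine Lie algebra `sl₂ ⊗ ℂ[t, t⁻¹] ⊕ ℂ c`, without the derivation `d`. -/
abbrev Affine : Type := ofTwoCocycle cocycle

/-- The element `x(n) = x ⊗ tⁿ`. -/
def mode (x : Sl2) (n : ℤ) : Affine :=
  ofProd cocycle (AddMonoidAlgebra.single n 1 ⊗ₜ[ℂ] x, 0)

/-- The canonical central element `c`. -/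
def central : Affine :=
  ofProd cocycle (0, (TrivialLieModule.equiv ℂ Loop ℂ).symm 1)

/-- The defining bracket `[x(n), y(m)] = [x, y](n + m) + n (x, y) δ_{n+m,0} c`. -/
theorem mode_bracket (x y : Sl2) (n m : ℤ) :
    ⁅mode x n, mode y m⁆ =
      mode ⁅x, y⁆ (n + m) + (if n + m = 0 then (n : ℂ) * form x y else 0) • central := by
  refine (bracket_ofTwoCocycle _ _).trans ?_
  have hc : ∀ r : ℂ, r • central =
      ofProd cocycle (0, (TrivialLieModule.equiv ℂ Loop ℂ).symm r) := by
    intro r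
    rw [central, ← of_smul, Prod.smul_mk, smul_zero, ← map_smul, smul_eq_mul, mul_one]
  rw [hc, mode, mode, mode, ← of_add]
  refine Equiv.congr_arg ?_
  simp only [Equiv.symm_apply_apply, lie_zero, add_zero, sub_zero, Prod.mk_add_mk, zero_add]
  refine Prod.ext ?_ ?_
  · rw [LieAlgebra.ExtendScalars.bracket_tmul, AddMonoidAlgebra.single_mul_single, one_mul]
  · change LoopAlgebra.twoCochainOfBilinear ℂ ℤ Sl2 (-form) neg_form_isSymm _ _ = _
    rw [LoopAlgebra.twoCochainOfBilinear_apply_apply]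
    congr 1
    have hr : LoopAlgebra.residuePairing ℂ ℤ Sl2 (-form)
        (AddMonoidAlgebra.single n 1 ⊗ₜ[ℂ] x) (AddMonoidAlgebra.single m 1 ⊗ₜ[ℂ] y) =
        m • (-form) (Finsupp.single n x (-m)) y := by
      rw [LoopAlgebra.residuePairing_apply_apply, LoopAlgebra.toFinsupp_single_tmul,
        LoopAlgebra.toFinsupp_single_tmul, Finsupp.sum_single_index (by simp)]
    rw [hr]
    split_ifs with hnm
    · obtain rfl : n = -m := by omega
      simp
    · rw [Finsupp.single_eq_of_ne (by omega)]
      simp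

/-- `c` is central. -/
theorem central_bracket (z : Affine) : ⁅central, z⁆ = 0 := by
  refine (bracket_ofTwoCocycle _ _).trans ?_
  rw [← of_zero]
  refine Equiv.congr_arg ?_
  simp only [central, Equiv.symm_apply_apply, zero_lie, map_zero, LinearMap.zero_apply, zero_add,
    trivial_lie_zero, sub_zero]
  rfl

/-- The universal enveloping algebra; its left modules are the modules of the Lie algebra. -/
abbrev U : Type := UniversalEnvelopingAlgebra ℂ Affine

/-- `x(n)` as an element of the universal enveloping algebra. -/
def um (x : Sl2) (n : ℤ) : U := UniversalEnvelopingAlgebra.ι ℂ (mode x n)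

/-- `c` as an element of the universal enveloping algebra. -/
def uc : U := UniversalEnvelopingAlgebra.ι ℂ central

/-! ### The universal Whittaker module -/

/-- The left ideal `J(lam, mu, kappa)` of the universal enveloping algebra generated by
`e(i), h(i), f(i + 1)` for `i > 0` and `e(0) - lam`, `f(1) - mu`, `c - kappa`. -/
def whittakerIdeal (lam mu kappa : ℂ) : Ideal U :=
  Ideal.span ({u | ∃ i : ℤ, 0 < i ∧ (u = um f (i + 1) ∨ u = um e i ∨ u = um h i)} ∪
    {um f 1 - algebraMap ℂ U mu, um e 0 - algebraMap ℂ U lam, uc - algebraMap ℂ U kappa})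

/-- The universal Whittaker module of level `kappa`. -/
abbrev Whittaker (lam mu kappa : ℂ) : Type := U ⧸ whittakerIdeal lam mu kappa

/-- The canonical generator, the image of `1`. -/
def whittakerVector (lam mu kappa : ℂ) : Whittaker lam mu kappa :=
  Submodule.Quotient.mk 1

/-! ### The modes `T(n)` -/

/-- The normally ordered product of `x(k)` and `y(m)`. -/
def normalOrdered (x y : Sl2) (k m : ℤ) : U :=
  if k < 0 then um x k * um y m else um y m * um x k

/-- The `k`-th summand of `T(n)`. -/
def tTerm (n k : ℤ) : U :=
  (1 / 2 : ℂ) • (normalOrdered e f k (n - k) + normalOrdered f e k (n - k) +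
    (1 / 2 : ℂ) • normalOrdered h h k (n - k))

/-- The mode `T(n)` of the field
`T(z) = ∑ T(n) z^(-n-2) = ½ (:e(z) f(z): + :f(z) e(z): + ½ :h(z) h(z):)`, acting on a vector of a
restricted module. Only finitely many summands are nonzero, see `finite_support_tTerm`. -/
def tMode {M : Type*} [AddCommGroup M] [Module U M] (n : ℤ) (v : M) : M :=
  ∑ᶠ k : ℤ, tTerm n k • v

/-- A module is restricted if every vector is killed by `x(n)` for all large `n`. -/
def IsRestricted (M : Type*) [AddCommGroup M] [Module U M] : Prop :=
  ∀ (v : M) (x : Sl2), ∃ N : ℤ, ∀ n : ℤ, N ≤ n → um x n • v = 0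

/-- On a restricted module the sum defining `T(n)` is finite. -/
theorem finite_support_tTerm {M : Type*} [AddCommGroup M] [Module U M] (hM : IsRestricted M)
    (n : ℤ) (v : M) : (Function.support fun k : ℤ => tTerm n k • v).Finite := by
  obtain ⟨A, hA⟩ := hM v e
  obtain ⟨B, hB⟩ := hM v f
  obtain ⟨C, hC⟩ := hM v h
  have hs : ∀ (u : U), u • v = 0 → ∀ c : ℂ, (c • u) • v = 0 := by
    intro u hu c
    rw [Algebra.smul_def, mul_smul, hu, smul_zero]
  have hno : ∀ (x y : Sl2) (D k : ℤ), (∀ i, D ≤ i → um x i • v = 0) →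
      (∀ i, D ≤ i → um y i • v = 0) → (k < 0 → D ≤ n - k) → (0 ≤ k → D ≤ k) →
      normalOrdered x y k (n - k) • v = 0 := by
    intro x y D k hx hy h1 h2
    rw [normalOrdered]
    split_ifs with hk
    · rw [mul_smul, hy _ (h1 hk), smul_zero]
    · rw [mul_smul, hx _ (h2 (by omega)), smul_zero]
  set D := max (max 0 n) (max A (max B C)) with hD
  refine (Set.finite_Icc (n - D) D).subset fun k hk => ?_
  by_contra hk'
  apply hk
  rw [Set.mem_Icc] at hk'
  have hk1 : k < 0 → D ≤ n - k := by omega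
  have hk2 : 0 ≤ k → D ≤ k := by omega
  refine hs _ ?_ _
  rw [add_smul, add_smul,
    hno e f D k (fun i hi => hA i (by omega)) (fun i hi => hB i (by omega)) hk1 hk2,
    hno f e D k (fun i hi => hB i (by omega)) (fun i hi => hA i (by omega)) hk1 hk2,
    hs _ (hno h h D k (fun i hi => hC i (by omega)) (fun i hi => hC i (by omega)) hk1 hk2),
    add_zero, add_zero]

theorem um_mul_um (x y : Sl2) (n m : ℤ) :
    um x n * um y m = um y m * um x n + um ⁅x, y⁆ (n + m) +
      (if n + m = 0 then (n : ℂ) * form x y else 0) • uc := by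
  have h1 := LieHom.map_lie (UniversalEnvelopingAlgebra.ι ℂ) (mode x n) (mode y m)
  rw [mode_bracket, map_add, map_smul, LieRing.of_associative_ring_bracket, eq_sub_iff_add_eq] at h1
  rw [um, um, um, uc, ← h1]
  abel

theorem mem_span_modes (z : Affine) :
    z ∈ Submodule.span ℂ ({central} ∪ {u | ∃ x n, u = mode x n}) := by
  set S : Submodule ℂ Affine := Submodule.span ℂ ({central} ∪ {u | ∃ x n, u = mode x n}) with hS
  obtain ⟨l, r⟩ := z
  have hr : ofProd cocycle (0, r) ∈ S := by
    have : ofProd cocycle (0, r) = (TrivialLieModule.equiv ℂ Loop ℂ r) • central := by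
      rw [central, ← of_smul, Prod.smul_mk, smul_zero, ← map_smul, smul_eq_mul, mul_one,
        LinearEquiv.symm_apply_apply]
    rw [this]
    exact S.smul_mem _ (Submodule.subset_span (Or.inl rfl))
  have hl : ofProd cocycle (l, 0) ∈ S := by
    induction l using TensorProduct.induction_on with
    | zero =>
      rw [show ((0 : Loop), (0 : TrivialLieModule ℂ Loop ℂ)) = 0 from rfl, of_zero]
      exact S.zero_mem
    | add a b ha hb =>
      have : (a + b, (0 : TrivialLieModule ℂ Loop ℂ)) = (a, 0) + (b, 0) := by simp
      rw [this, of_add]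
      exact S.add_mem ha hb
    | tmul p x =>
      induction p using AddMonoidAlgebra.induction_linear with
      | zero =>
        rw [TensorProduct.zero_tmul,
          show ((0 : Loop), (0 : TrivialLieModule ℂ Loop ℂ)) = 0 from rfl, of_zero]
        exact S.zero_mem
      | add a b ha hb =>
        have : ((a + b) ⊗ₜ[ℂ] x, (0 : TrivialLieModule ℂ Loop ℂ)) =
            (a ⊗ₜ[ℂ] x, 0) + (b ⊗ₜ[ℂ] x, 0) := by simp [TensorProduct.add_tmul]
        rw [this, of_add]
        exact S.add_mem ha hb
      | single n a =>
        have : ofProd cocycle (AddMonoidAlgebra.single n a ⊗ₜ[ℂ] x, 0) = a • mode x n := by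
          rw [mode, ← of_smul, Prod.smul_mk, smul_zero, TensorProduct.smul_tmul',
            AddMonoidAlgebra.smul_single, smul_eq_mul, mul_one]
        rw [this]
        exact S.smul_mem _ (Submodule.subset_span (Or.inr ⟨x, n, rfl⟩))
  have : (⟨(l, r)⟩ : Affine) = ofProd cocycle (l, 0) + ofProd cocycle (0, r) := by
    rw [← of_add, Prod.mk_add_mk, add_zero, zero_add]
    rfl
  rw [this]
  exact S.add_mem hl hr

theorem uc_commute (u : U) : uc * u = u * uc := by
  obtain ⟨t, rfl⟩ : ∃ t, UniversalEnvelopingAlgebra.mkAlgHom ℂ Affine t = u :=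
    RingCon.mkₐ_surjective _ u
  induction t using TensorAlgebra.induction with
  | algebraMap r => rw [AlgHom.commutes]; exact (Algebra.commutes r uc).symm
  | ι z =>
    have h1 := LieHom.map_lie (UniversalEnvelopingAlgebra.ι ℂ) central z
    rw [central_bracket, map_zero, LieRing.of_associative_ring_bracket, eq_comm, sub_eq_zero] at h1
    exact h1
  | mul a b ha hb => rw [map_mul, ← mul_assoc, ha, mul_assoc, hb, mul_assoc]
  | add a b ha hb => rw [map_add, mul_add, ha, hb, add_mul]

/-- The vectors killed by `x(n)` for all `x` and all large `n` form a submodule. -/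
theorem restricted_smul {M : Type*} [AddCommGroup M] [Module U M] (u : U) (v : M)
    (hv : ∀ x : Sl2, ∃ N : ℤ, ∀ n : ℤ, N ≤ n → um x n • v = 0) :
    ∀ x : Sl2, ∃ N : ℤ, ∀ n : ℤ, N ≤ n → um x n • u • v = 0 := by
  obtain ⟨t, rfl⟩ : ∃ t, UniversalEnvelopingAlgebra.mkAlgHom ℂ Affine t = u :=
    RingCon.mkₐ_surjective _ u
  have hs : ∀ (r : ℂ) (v : M), (∀ x : Sl2, ∃ N : ℤ, ∀ n : ℤ, N ≤ n → um x n • v = 0) →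
      ∀ x : Sl2, ∃ N : ℤ, ∀ n : ℤ, N ≤ n → um x n • algebraMap ℂ U r • v = 0 := by
    intro r v hv x
    obtain ⟨N, hN⟩ := hv x
    refine ⟨N, fun n hn => ?_⟩
    rw [← mul_smul, ← Algebra.commutes, mul_smul, hN n hn, smul_zero]
  have ha : ∀ v w : M, (∀ x : Sl2, ∃ N : ℤ, ∀ n : ℤ, N ≤ n → um x n • v = 0) →
      (∀ x : Sl2, ∃ N : ℤ, ∀ n : ℤ, N ≤ n → um x n • w = 0) →
      ∀ x : Sl2, ∃ N : ℤ, ∀ n : ℤ, N ≤ n → um x n • (v + w) = 0 := by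
    intro v w hv hw x
    obtain ⟨A, hA⟩ := hv x
    obtain ⟨B, hB⟩ := hw x
    refine ⟨max A B, fun n hn => ?_⟩
    rw [smul_add, hA n (by omega), hB n (by omega), add_zero]
  induction t using TensorAlgebra.induction generalizing v with
  | algebraMap r => rw [AlgHom.commutes]; exact hs r v hv
  | add a b hxa hxb =>
    rw [map_add, add_smul]
    exact ha _ _ (hxa v hv) (hxb v hv)
  | mul a b hxa hxb =>
    rw [map_mul, mul_smul]
    exact hxa _ (hxb v hv)
  | ι z =>
    change ∀ x : Sl2, ∃ N : ℤ, ∀ n : ℤ, N ≤ n →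
      um x n • UniversalEnvelopingAlgebra.ι ℂ z • v = 0
    induction mem_span_modes z using Submodule.span_induction with
    | zero => intro x; exact ⟨0, fun n _ => by rw [map_zero, zero_smul, smul_zero]⟩
    | add a b _ _ hxa hxb => rw [map_add, add_smul]; exact ha _ _ hxa hxb
    | smul r a _ hxa =>
      rw [map_smul, Algebra.smul_def, mul_smul]
      exact hs r _ hxa
    | mem a hmem =>
      rcases hmem with rfl | ⟨y, m, rfl⟩
      · intro x
        obtain ⟨N, hN⟩ := hv x
        refine ⟨N, fun n hn => ?_⟩
        change um x n • uc • v = 0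
        rw [← mul_smul, ← uc_commute, mul_smul, hN n hn, smul_zero]
      · intro x
        obtain ⟨A, hA⟩ := hv x
        obtain ⟨B, hB⟩ := hv ⁅x, y⁆
        refine ⟨max A (max (B - m) (1 - m)), fun n hn => ?_⟩
        change um x n • um y m • v = 0
        rw [← mul_smul, um_mul_um, if_neg (by omega), zero_smul, add_zero, add_smul, mul_smul,
          hA n (by omega), hB (n + m) (by omega), smul_zero, add_zero]

theorem span_efh (x : Sl2) : x = x.1 0 1 • e + x.1 1 0 • f + x.1 0 0 • h := by
  have hx : x.1 1 1 = - x.1 0 0 := by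
    have h1 : Matrix.trace x.1 = 0 := x.2
    rw [Matrix.trace_fin_two] at h1
    linear_combination h1
  apply Subtype.ext
  ext i j
  fin_cases i <;> fin_cases j <;> simp [e, f, h, hx]

theorem um_eq (x : Sl2) (n : ℤ) :
    um x n = x.1 0 1 • um e n + x.1 1 0 • um f n + x.1 0 0 • um h n := by
  have hm : mode x n = x.1 0 1 • mode e n + x.1 1 0 • mode f n + x.1 0 0 • mode h n := by
    conv_lhs => rw [span_efh x]
    simp only [mode, ← of_smul, ← of_add, TensorProduct.tmul_add, TensorProduct.tmul_smul,
      Prod.smul_mk, smul_zero, Prod.mk_add_mk, add_zero]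
  simp only [um, hm, map_add, map_smul]

/-- The universal Whittaker module is restricted. -/
theorem whittaker_isRestricted (lam mu kappa : ℂ) : IsRestricted (Whittaker lam mu kappa) := by
  intro v
  obtain ⟨u, rfl⟩ := Submodule.Quotient.mk_surjective _ v
  have hu : (Submodule.Quotient.mk u : Whittaker lam mu kappa) =
      u • whittakerVector lam mu kappa := by
    rw [whittakerVector, ← Submodule.Quotient.mk_smul, smul_eq_mul, mul_one]
  rw [hu]
  refine restricted_smul u _ fun x => ⟨2, fun n hn => ?_⟩
  have key : ∀ y : U, y ∈ whittakerIdeal lam mu kappa → y • whittakerVector lam mu kappa = 0 := by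
    intro y hy
    rw [whittakerVector, ← Submodule.Quotient.mk_smul, smul_eq_mul, mul_one]
    exact (Submodule.Quotient.mk_eq_zero _).2 hy
  refine key _ ?_
  have hc : ∀ (r : ℂ) (y : U), y ∈ whittakerIdeal lam mu kappa →
      r • y ∈ whittakerIdeal lam mu kappa := by
    intro r y hy
    rw [Algebra.smul_def]
    exact Ideal.mul_mem_left _ _ hy
  rw [um_eq]
  refine Ideal.add_mem _ (Ideal.add_mem _ (hc _ _ ?_) (hc _ _ ?_)) (hc _ _ ?_)
  · exact Ideal.subset_span (Or.inl ⟨n, by omega, Or.inr (Or.inl rfl)⟩)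
  · exact Ideal.subset_span (Or.inl ⟨n - 1, by omega, Or.inl (by rw [sub_add_cancel])⟩)
  · exact Ideal.subset_span (Or.inl ⟨n, by omega, Or.inr (Or.inr rfl)⟩)

/-! ### The quotient at the critical level -/

/-- For a Laurent series `c(z) = ∑_{n ≤ 0} c_n z^(-n-2)`, the submodule of the universal Whittaker
module of level `-2` generated by the vectors `(T(n) - c_n) w`, `n ≤ 0`. -/
def criticalSubmodule (lam mu : ℂ) (c : LaurentSeries ℂ) : Submodule U (Whittaker lam mu (-2)) :=
  Submodule.span U {v | ∃ n : ℤ, n ≤ 0 ∧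
    v = tMode n (whittakerVector lam mu (-2)) -
      algebraMap ℂ U (c.coeff (-n - 2)) • whittakerVector lam mu (-2)}

/-- The quotient of the universal Whittaker module of level `-2` by the submodule generated by
the vectors `(T(n) - c_n) w`, `n ≤ 0`. -/
abbrev CriticalWhittaker (lam mu : ℂ) (c : LaurentSeries ℂ) : Type :=
  Whittaker lam mu (-2) ⧸ criticalSubmodule lam mu c

end AffineSl2

end

/-! At level `-2` the Sugawara modes `T(n)` commute with the whole affine algebra
(`AffineSl2.smul_tMode`), so prescribing them as scalars is a meaningful quotient. On a Whittaker
vector `w`, `T(n) w` equals `λ f(n) w` plus terms built from `e(k) f(j) w` with `k < 0`, `j > n` and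
from `h h w`, `h w`. As `λ ≠ 0`, the equation `T(n) w = c_n w` can be solved for `f(n) w`. The
quotient is therefore an image of the Fock space, the polynomial ring in `y_j = h(-j)`, `j ≥ 0`, and
`x_i = e(-i)`, `i > 0`, which is the module induced from a Whittaker character of the Borel part
(`Fock.exists_lift`). Every nonzero subspace of it stable under `e(n)`, `n ≥ 0`, and `h(n)`, `n >
0`, contains `1` (`Fock.IsLowering.one_mem`), so the quotient is simple once it is nonzero.

Nonvanishing is the main work: the Fock space must itself carry a suitable action of the `f(n)`.
With generating series `x`, `y` in `z`, put `u = y + 2zx'/x` and `f·1 = x⁻¹(c - z(u²/4 + u/2 -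
zu'/2))`, where the constant term of `c` is `λμ`. This series satisfies the relations of `f` with
the nonnegative modes, and the universal property, applied to pairs `((f(n) b)ₙ, b)`, extends it to
operators `F n`. The vectors `[F m, F n] 1` span a lowering subspace, on which the vacuum projection
vanishes because the vacuum coefficient of `F m (F n 1)` has a closed form symmetric in `m` and `n`
(`Fock.theta_fvec`). A nonzero lowering subspace contains `1`, so this one is zero, and the `F n`
commute. The same argument applied to the vectors `(T(n) - c_n) 1` shows that they vanish.

For (b), Schur's lemma in countable dimension makes each `T(n)` a scalar on a simple quotient, and
maximality from (a) gives equality. For (c), `e(0) - λ` and `f(1) - μ` are locally nilpotent, so `λ`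
and `μ` are invariants of the module; the `c_n` are invariants because `T(n)` is central. -/

noncomputable section

open MvPolynomial

/-! ### Representations of the affinization of the Borel subalgebra at the critical level -/

/-- Operators `E n`, `H n` satisfying the relations of `e(n)`, `h(n)` at level `-2`. -/
structure BorelRep (Q : Type*) [AddCommGroup Q] [Module ℂ Q] where
  E : ℤ → Q →ₗ[ℂ] Q
  H : ℤ → Q →ₗ[ℂ] Q
  EE : ∀ m n v, E m (E n v) = E n (E m v)
  HE : ∀ m n v, H m (E n v) = E n (H m v) + (2 : ℂ) • E (m + n) v
  HH : ∀ m n v, H m (H n v) = H n (H m v) + (if m + n = 0 then (-4 * m : ℂ) else 0) • v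

/-- A Whittaker vector for the nonnegative modes. -/
structure BorelRep.IsWhittaker {Q : Type*} [AddCommGroup Q] [Module ℂ Q] (R : BorelRep Q)
    (lam : ℂ) (q : Q) : Prop where
  E_pos : ∀ n, 0 < n → R.E n q = 0
  E_zero : R.E 0 q = lam • q
  H_pos : ∀ n, 0 < n → R.H n q = 0

/-! ### The Fock space -/

/-- Polynomials in `y_j = X (inl j)` and `x_(i+1) = X (inr i)`. -/
abbrev Fock : Type := MvPolynomial (ℕ ⊕ ℕ) ℂ

namespace Fock

/-- The variable `y_j`, on which `h(-j)` acts by multiplication. -/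
def y (j : ℕ) : Fock := X (Sum.inl j)

/-- The coefficients of `e(z)` on the vacuum. -/
def x (lam : ℂ) (k : ℤ) : Fock :=
  if k < 0 then 0 else if k = 0 then C lam else X (Sum.inr (k - 1).toNat)

theorem x_neg (lam : ℂ) {k : ℤ} (hk : k < 0) : x lam k = 0 := by simp [x, hk]

theorem x_zero (lam : ℂ) : x lam 0 = C lam := by simp [x]

theorem x_succ (lam : ℂ) (i : ℕ) : x lam (i + 1) = X (Sum.inr i) := by
  have h1 : ¬ ((i : ℤ) + 1 < 0) := by omega
  have h2 : ¬ ((i : ℤ) + 1 = 0) := by omega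
  simp [x, h1, h2]

/-- The translation `y_j ↦ y_j - 2 X^j`. -/
def shift : Fock →ₐ[ℂ] Polynomial Fock :=
  aeval (Sum.elim (fun j => Polynomial.C (y j) - 2 * Polynomial.X ^ j)
    (fun i => Polynomial.C (X (Sum.inr i))))

theorem shift_y (j : ℕ) : shift (y j) = Polynomial.C (y j) - 2 * Polynomial.X ^ j := by
  simp [shift, y]

theorem shift_inr (i : ℕ) : shift (X (Sum.inr i)) = Polynomial.C (X (Sum.inr i)) := by
  simp [shift]

theorem shift_x (lam : ℂ) (k : ℤ) : shift (x lam k) = Polynomial.C (x lam k) := by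
  rw [x]
  split_ifs
  · simp
  · rw [← MvPolynomial.algebraMap_eq, AlgHom.commutes]; rfl
  · exact shift_inr _

/-- The `Fock`-linear map `X^k ↦ x_(k - n)`. -/
def contract (lam : ℂ) (n : ℤ) : Polynomial Fock →ₗ[Fock] Fock :=
  Polynomial.lsum fun k => LinearMap.mulLeft Fock (x lam (k - n))

theorem contract_apply (lam : ℂ) (n : ℤ) (p : Polynomial Fock) :
    contract lam n p = p.sum fun k a => x lam (k - n) * a := rfl

theorem contract_monomial (lam : ℂ) (n : ℤ) (k : ℕ) (a : Fock) :
    contract lam n (Polynomial.monomial k a) = x lam (k - n) * a := by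
  simp [contract_apply, Polynomial.sum_monomial_index]

theorem contract_C (lam : ℂ) (n : ℤ) (a : Fock) :
    contract lam n (Polynomial.C a) = x lam (-n) * a := by
  rw [← Polynomial.monomial_zero_left, contract_monomial]; simp

theorem contract_C_mul (lam : ℂ) (n : ℤ) (a : Fock) (p : Polynomial Fock) :
    contract lam n (Polynomial.C a * p) = a * contract lam n p := by
  rw [← Polynomial.smul_eq_C_mul, map_smul, smul_eq_mul]

theorem contract_X_pow_mul (lam : ℂ) (n : ℤ) (j : ℕ) (p : Polynomial Fock) :
    contract lam n (Polynomial.X ^ j * p) = contract lam (n - j) p := by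
  induction p using Polynomial.induction_on' with
  | add p q hp hq => simp [mul_add, hp, hq]
  | monomial k a =>
    rw [Polynomial.X_pow_mul_monomial, contract_monomial, contract_monomial]
    congr 2; push_cast; ring

/-- The action of `e(n)`. -/
def E (lam : ℂ) (n : ℤ) : Fock →ₗ[ℂ] Fock :=
  (contract lam n).restrictScalars ℂ ∘ₗ shift.toLinearMap

theorem E_apply (lam : ℂ) (n : ℤ) (p : Fock) : E lam n p = contract lam n (shift p) := rfl

/-- This is `e(n) h(-j) = h(-j) e(n) - 2 e(n-j)`, the relation that dictates `shift` and `contract`: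
the power of `X` records how far the mode has been lowered. -/
theorem E_y_mul (lam : ℂ) (n : ℤ) (j : ℕ) (p : Fock) :
    E lam n (y j * p) = y j * E lam n p - (2 : ℂ) • E lam (n - j) p := by
  rw [E_apply, map_mul, shift_y, sub_mul, map_sub, contract_C_mul, mul_assoc,
    show (2 : Polynomial Fock) = Polynomial.C 2 from rfl, contract_C_mul, contract_X_pow_mul,
    E_apply, E_apply, MvPolynomial.smul_eq_C_mul]
  rfl

theorem E_x_mul (lam : ℂ) (n k : ℤ) (p : Fock) :
    E lam n (x lam k * p) = x lam k * E lam n p := by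
  rw [E_apply, map_mul, shift_x, contract_C_mul, E_apply]

theorem E_one (lam : ℂ) (n : ℤ) : E lam n 1 = x lam (-n) := by
  rw [E_apply, map_one, ← Polynomial.C_1, contract_C, mul_one]

/-- The derivation `h(m)`, `m > 0`. -/
def D (lam : ℂ) (m : ℕ) : Derivation ℂ Fock Fock :=
  mkDerivation ℂ (Sum.elim (fun j => if j = m then C (-4 * (m : ℂ)) else 0)
    (fun i => 2 * x lam (i + 1 - m)))

theorem D_y (lam : ℂ) (m j : ℕ) : D lam m (y j) = if j = m then C (-4 * (m : ℂ)) else 0 := by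
  simp [D, y, mkDerivation_X]

theorem D_x (lam : ℂ) {m : ℕ} (hm : 0 < m) (k : ℤ) : D lam m (x lam k) = 2 * x lam (k - m) := by
  rcases lt_trichotomy k 0 with hk | rfl | hk
  · rw [x_neg lam hk, x_neg lam (by omega)]; simp
  · rw [x_zero, x_neg lam (by omega), ← MvPolynomial.algebraMap_eq, Derivation.map_algebraMap]
    simp
  · obtain ⟨i, rfl⟩ : ∃ i : ℕ, k = i + 1 := ⟨(k - 1).toNat, by omega⟩
    rw [x_succ, D, mkDerivation_X]; simp

/-- The action of `h(n)`. -/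
def H (lam : ℂ) (n : ℤ) : Fock →ₗ[ℂ] Fock :=
  if 0 < n then (D lam n.toNat).toLinearMap else LinearMap.mulLeft ℂ (y (-n).toNat)

theorem H_pos (lam : ℂ) {m : ℕ} (hm : 0 < m) (p : Fock) : H lam m p = D lam m p := by
  simp [H, hm]

theorem H_nonpos (lam : ℂ) (j : ℕ) (p : Fock) : H lam (-j) p = y j * p := by
  rw [H, if_neg (by omega), neg_neg, Int.toNat_natCast]; rfl

theorem derivation_ext_x (lam : ℂ) {D₁ D₂ : Derivation ℂ Fock Fock}
    (h1 : ∀ j, D₁ (y j) = D₂ (y j)) (h2 : ∀ k, D₁ (x lam k) = D₂ (x lam k)) : D₁ = D₂ := by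
  refine MvPolynomial.derivation_ext fun i => ?_
  rcases i with j | i
  · exact h1 j
  · have := h2 (i + 1)
    rwa [x_succ] at this

theorem D_comm (lam : ℂ) {m n : ℕ} (hm : 0 < m) (hn : 0 < n) (p : Fock) :
    D lam m (D lam n p) = D lam n (D lam m p) := by
  have h2 : ∀ (k : ℕ) (a : Fock), D lam k (2 * a) = 2 * D lam k a := by
    intro k a; rw [two_mul, map_add, two_mul]
  have : ⁅D lam m, D lam n⁆ = 0 := by
    refine derivation_ext_x lam (fun j => ?_) fun k => ?_
    · rw [Derivation.commutator_apply, D_y, D_y, apply_ite (D lam m), apply_ite (D lam n)]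
      simp [← MvPolynomial.algebraMap_eq]
    · rw [Derivation.commutator_apply, D_x lam hm, D_x lam hn, h2, h2, D_x lam hm, D_x lam hn, sub_right_comm]
      simp
  have h3 := congrArg (fun d => d p) this
  simpa [Derivation.commutator_apply, sub_eq_zero] using h3

/-- Coefficientwise application of a derivation. -/
def mapD (d : Derivation ℂ Fock Fock) (p : Polynomial Fock) : Polynomial Fock :=
  p.sum fun k a => Polynomial.monomial k (d a)

theorem coeff_mapD (d : Derivation ℂ Fock Fock) (p : Polynomial Fock) (k : ℕ) :
    (mapD d p).coeff k = d (p.coeff k) := by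
  rw [mapD, Polynomial.sum, Polynomial.finsetSum_coeff]
  simp only [Polynomial.coeff_monomial]
  rw [Finset.sum_ite_eq' p.support k]
  split_ifs with hk
  · rfl
  · rw [Polynomial.notMem_support_iff.1 hk, map_zero]

theorem mapD_add (d : Derivation ℂ Fock Fock) (p q : Polynomial Fock) :
    mapD d (p + q) = mapD d p + mapD d q := by
  ext1 k; simp [coeff_mapD]

theorem mapD_mul (d : Derivation ℂ Fock Fock) (p q : Polynomial Fock) :
    mapD d (p * q) = mapD d p * q + p * mapD d q := by
  ext1 k
  simp only [coeff_mapD, Polynomial.coeff_mul, Polynomial.coeff_add, map_sum, Derivation.leibniz,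
    smul_eq_mul, ← Finset.sum_add_distrib]
  exact Finset.sum_congr rfl fun a _ => by ring

/-- Both sides obey the same Leibniz rule along `shift`, so generators suffice; there the
translation term `2 X^j` has constant coefficients and is killed by the derivation. -/
theorem shift_D (lam : ℂ) {m : ℕ} (hm : 0 < m) (p : Fock) :
    shift (D lam m p) = mapD (D lam m) (shift p) := by
  have hC : ∀ a, mapD (D lam m) (Polynomial.C a) = Polynomial.C (D lam m a) := by
    intro a; ext1 k; rw [coeff_mapD, Polynomial.coeff_C, Polynomial.coeff_C]; split_ifs <;> simp
  have hsC : ∀ r : ℂ, shift (C r) = Polynomial.C (C r) := by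
    intro r; rw [← MvPolynomial.algebraMap_eq, AlgHom.commutes]; rfl
  induction p using MvPolynomial.induction_on with
  | C r => rw [hsC, hC, ← MvPolynomial.algebraMap_eq]; simp
  | add p q hp hq => rw [map_add, map_add, map_add, mapD_add, hp, hq]
  | mul_X p i hp =>
    rw [Derivation.leibniz, map_add, smul_eq_mul, smul_eq_mul, map_mul, map_mul, map_mul, mapD_mul,
      hp]
    have key : shift (D lam m (X i)) = mapD (D lam m) (shift (X i)) := by
      rcases i with j | i
      · change shift (D lam m (y j)) = mapD (D lam m) (shift (y j))
        rw [D_y, shift_y]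
        ext1 k
        rw [coeff_mapD, Polynomial.coeff_sub, map_sub]
        have h0 : D lam m ((2 * Polynomial.X ^ j : Polynomial Fock).coeff k) = 0 := by
          rw [show (2 : Polynomial Fock) = Polynomial.C (algebraMap ℂ Fock 2) by simp [map_ofNat],
            Polynomial.coeff_C_mul, Polynomial.coeff_X_pow]
          split_ifs <;> simp
        rw [h0, sub_zero, Polynomial.coeff_C, apply_ite (D lam m), map_zero, D_y, apply_ite shift,
          map_zero, hsC]
        split_ifs <;> simp [Polynomial.coeff_C, *]
      · have := shift_x lam (i + 1)
        rw [x_succ] at this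
        rw [this, hC, ← x_succ lam, D_x lam hm, map_mul, shift_x, map_ofNat, map_mul, map_ofNat]
    rw [key]; ring

/-- The derivation also hits the factors `x_(k-n)` introduced by the contraction; it turns them into
`2 x_(k-n-m)`, a contraction with index raised by `m`. -/
theorem D_contract (lam : ℂ) {m : ℕ} (hm : 0 < m) (n : ℤ) (p : Polynomial Fock) :
    D lam m (contract lam n p) =
      contract lam n (mapD (D lam m) p) + 2 * contract lam (m + n) p := by
  induction p using Polynomial.induction_on' with
  | add p q hp hq => rw [map_add, map_add, hp, hq, mapD_add, map_add, map_add]; ring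
  | monomial k a =>
    have : mapD (D lam m) (Polynomial.monomial k a) = Polynomial.monomial k (D lam m a) := by
      ext1 l; rw [coeff_mapD, Polynomial.coeff_monomial, Polynomial.coeff_monomial]
      split_ifs <;> simp
    rw [this, contract_monomial, contract_monomial, contract_monomial, Derivation.leibniz, D_x lam hm,
      smul_eq_mul, smul_eq_mul, show (k : ℤ) - n - m = k - (m + n) by ring]
    ring

theorem D_E (lam : ℂ) {m : ℕ} (hm : 0 < m) (n : ℤ) (p : Fock) :
    D lam m (E lam n p) = E lam n (D lam m p) + (2 : ℂ) • E lam (m + n) p := by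
  rw [E_apply, E_apply, E_apply, D_contract lam hm, shift_D lam hm, MvPolynomial.smul_eq_C_mul]
  rfl

theorem neg_or_pos (n : ℤ) : (∃ m : ℕ, 0 < m ∧ n = m) ∨ ∃ j : ℕ, n = -j := by
  rcases lt_or_ge 0 n with hn | hn
  · exact Or.inl ⟨n.toNat, by omega, by omega⟩
  · exact Or.inr ⟨(-n).toNat, by omega⟩

theorem H_E (lam : ℂ) (m n : ℤ) (p : Fock) :
    H lam m (E lam n p) = E lam n (H lam m p) + (2 : ℂ) • E lam (m + n) p := by
  rcases neg_or_pos m with ⟨m, hm, rfl⟩ | ⟨j, rfl⟩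
  · rw [H_pos lam hm, H_pos lam hm, D_E lam hm]
  · rw [H_nonpos, H_nonpos, E_y_mul, show -(j : ℤ) + n = n - j by ring]; abel

theorem H_H (lam : ℂ) (m n : ℤ) (p : Fock) :
    H lam m (H lam n p) =
      H lam n (H lam m p) + (if m + n = 0 then (-4 * m : ℂ) else 0) • p := by
  rcases neg_or_pos m with ⟨m, hm, rfl⟩ | ⟨j, rfl⟩ <;>
    rcases neg_or_pos n with ⟨n, hn, rfl⟩ | ⟨k, rfl⟩
  · rw [if_neg (by omega)]
    simp only [H_pos lam hm, H_pos lam hn, zero_smul, add_zero]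
    exact D_comm lam hm hn p
  · simp only [H_pos lam hm, H_nonpos, Derivation.leibniz, D_y, smul_eq_mul,
      MvPolynomial.smul_eq_C_mul]
    by_cases hk : k = m
    · subst hk; simp; ring
    · rw [if_neg hk, if_neg (by omega)]; simp
  · simp only [H_pos lam hn, H_nonpos, Derivation.leibniz, D_y, smul_eq_mul,
      MvPolynomial.smul_eq_C_mul]
    by_cases hk : j = n
    · subst hk; simp; ring
    · rw [if_neg hk, if_neg (by omega)]; simp
  · simp only [H_nonpos]
    by_cases hk : -(j : ℤ) + -k = 0
    · obtain ⟨rfl, rfl⟩ : j = 0 ∧ k = 0 := by omega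
      simp
    · rw [if_neg hk, zero_smul, add_zero]; ring

theorem E_E (lam : ℂ) (m n : ℤ) (p : Fock) : E lam m (E lam n p) = E lam n (E lam m p) := by
  induction p using MvPolynomial.induction_on generalizing m n with
  | C r =>
    have h1 : ∀ k, E lam k (C r) = r • x lam (-k) := by
      intro k
      rw [← mul_one (C r : Fock), ← MvPolynomial.smul_eq_C_mul, map_smul, E_one]
    have h2 : ∀ k l, E lam k (x lam l) = x lam l * x lam (-k) := by
      intro k l; rw [← mul_one (x lam l), E_x_mul, E_one, mul_one]
    rw [h1, h1, map_smul, map_smul, h2, h2, mul_comm]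
  | add p q hp hq => rw [map_add, map_add, map_add, map_add, hp, hq]
  | mul_X p i hp =>
    rw [mul_comm]
    rcases i with j | i
    · change E lam m (E lam n (y j * p)) = E lam n (E lam m (y j * p))
      simp only [E_y_mul, map_sub, map_smul]
      rw [hp m n, hp (m - j) n, hp m (n - j)]
      abel
    · rw [← x_succ lam, E_x_mul, E_x_mul, E_x_mul, E_x_mul, hp]

/-- The Fock space as a representation of the Borel part. -/
def rep (lam : ℂ) : BorelRep Fock where
  E := E lam
  H := H lam
  EE := E_E lam
  HE := H_E lam
  HH := H_H lam

theorem rep_isWhittaker (lam : ℂ) : (rep lam).IsWhittaker lam 1 where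
  E_pos n hn := by
    change E lam n 1 = 0
    rw [E_one, x_neg lam (by omega)]
  E_zero := by
    change E lam 0 1 = _
    rw [E_one, neg_zero, x_zero, MvPolynomial.smul_eq_C_mul, mul_one]
  H_pos n hn := by
    obtain ⟨m, rfl⟩ : ∃ m : ℕ, n = m := ⟨n.toNat, by omega⟩
    change H lam m 1 = 0
    rw [H_pos lam (by omega), Derivation.map_one_eq_zero]

end Fock
end

/-! ### Factorization and universal property of the Fock space. -/

noncomputable section

open MvPolynomial
open scoped IsMulCommutative in

/-- Evaluation of polynomials at commuting elements of a noncommutative algebra. -/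
theorem exists_algHom_of_commute {σ A : Type*} [Ring A] [Algebra ℂ A] (a : σ → A)
    (ha : ∀ i j, a i * a j = a j * a i) :
    ∃ φ : MvPolynomial σ ℂ →ₐ[ℂ] A, ∀ i, φ (X i) = a i := by
  have hc : ∀ u ∈ Set.range a, ∀ v ∈ Set.range a, u * v = v * u := by
    rintro _ ⟨i, rfl⟩ _ ⟨j, rfl⟩
    exact ha i j
  have := Algebra.isMulCommutative_adjoin ℂ hc
  refine ⟨(Algebra.adjoin ℂ (Set.range a)).val.comp
    (aeval fun i => ⟨a i, Algebra.subset_adjoin ⟨i, rfl⟩⟩), fun i => ?_⟩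
  simp

namespace Fock

open TensorProduct

/-- The factorization of the Fock space into polynomials in the `y_j` and in the `x_i`. -/
abbrev split : MvPolynomial ℕ ℂ ⊗[ℂ] MvPolynomial ℕ ℂ ≃ₐ[ℂ] Fock := tensorEquivSum ℂ ℕ ℕ ℂ

theorem split_mul_y (j : ℕ) (a b : MvPolynomial ℕ ℂ) :
    split ((X j * a) ⊗ₜ b) = y j * split (a ⊗ₜ b) := by
  rw [y, ← tensorEquivSum_X_tmul_one (R := ℂ) (σ := ℕ) (ι := ℕ) (S := ℂ), ← map_mul,
    Algebra.TensorProduct.tmul_mul_tmul, one_mul]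

theorem split_mul_x (lam : ℂ) (i : ℕ) (b : MvPolynomial ℕ ℂ) :
    split (1 ⊗ₜ (X i * b)) = x lam (i + 1) * split (1 ⊗ₜ b) := by
  rw [x_succ, ← tensorEquivSum_one_tmul_X (R := ℂ) (σ := ℕ) (ι := ℕ) (S := ℂ), ← map_mul,
    Algebra.TensorProduct.tmul_mul_tmul, one_mul]

/-- Induction by the factorization into a polynomial in the `y_j` and one in the `x_i`. -/
theorem mem_of_split {K : Submodule ℂ Fock} (h1 : ∀ b, split (1 ⊗ₜ b) ∈ K)
    (h2 : ∀ j, ∀ p ∈ K, y j * p ∈ K) (p : Fock) : p ∈ K := by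
  obtain ⟨t, rfl⟩ := split.surjective p
  induction t using TensorProduct.induction_on with
  | zero => rw [map_zero]; exact K.zero_mem
  | add s t hs ht => rw [map_add]; exact K.add_mem hs ht
  | tmul a b =>
    induction a using MvPolynomial.induction_on with
    | C r =>
      have : (C r : MvPolynomial ℕ ℂ) ⊗ₜ[ℂ] b = r • (1 ⊗ₜ[ℂ] b) := by
        rw [TensorProduct.smul_tmul', MvPolynomial.smul_eq_C_mul, mul_one]
      rw [this, map_smul]
      exact K.smul_mem _ (h1 b)
    | add p q hp hq => rw [TensorProduct.add_tmul, map_add]; exact K.add_mem hp hq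
    | mul_X p j hp => rw [mul_comm, split_mul_y]; exact h2 _ _ hp

/-- Without `y`-variables the translation does nothing, so `e(n)` is multiplication, for every sign
of `n`. -/
theorem E_neg_split (lam : ℂ) (n : ℤ) (b : MvPolynomial ℕ ℂ) :
    E lam n (split (1 ⊗ₜ b)) = x lam (-n) * split (1 ⊗ₜ b) := by
  induction b using MvPolynomial.induction_on with
  | C r =>
    rw [tensorEquivSum_one_tmul_C, Algebra.algebraMap_self, RingHom.id_apply, ← mul_one (C r),
      ← MvPolynomial.smul_eq_C_mul, map_smul, E_one, mul_smul_comm, mul_one]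
  | add p q hp hq => simp only [TensorProduct.tmul_add, map_add, hp, hq, mul_add]
  | mul_X p i hp => rw [mul_comm p, split_mul_x lam, E_x_mul, hp]; ring

/-- The Fock space is generated by the vacuum. -/
theorem eq_top_of_stable (lam : ℂ) {K : Submodule ℂ Fock} (h1 : 1 ∈ K)
    (hE : ∀ i : ℕ, ∀ p ∈ K, E lam (-(i + 1)) p ∈ K)
    (hH : ∀ j : ℕ, ∀ p ∈ K, H lam (-j) p ∈ K) (p : Fock) : p ∈ K := by
  refine mem_of_split (fun b => ?_) (fun j p hp => ?_) p
  · induction b using MvPolynomial.induction_on with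
    | C r =>
      rw [tensorEquivSum_one_tmul_C, Algebra.algebraMap_self, RingHom.id_apply, ← mul_one (C r),
        ← MvPolynomial.smul_eq_C_mul]
      exact K.smul_mem _ h1
    | add p q hp hq => rw [TensorProduct.tmul_add, map_add]; exact K.add_mem hp hq
    | mul_X p i hp =>
      rw [mul_comm, split_mul_x lam, ← neg_neg ((i : ℤ) + 1), ← E_neg_split]
      exact hE i _ hp
  · rw [← H_nonpos lam]
    exact hH j _ hp

/-- The universal property of the Fock space. -/
theorem exists_lift {Q : Type*} [AddCommGroup Q] [Module ℂ Q] (R : BorelRep Q) (lam : ℂ) (q : Q)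
    (hq : R.IsWhittaker lam q) :
    ∃ Φ : Fock →ₗ[ℂ] Q, Φ 1 = q ∧ (∀ n p, Φ (E lam n p) = R.E n (Φ p)) ∧
      ∀ n p, Φ (H lam n p) = R.H n (Φ p) := by
  obtain ⟨φ, hφ⟩ := exists_algHom_of_commute (A := Module.End ℂ Q) (fun j : ℕ => R.H (-j))
    (fun i j => by
      ext v
      change R.H _ (R.H _ v) = R.H _ (R.H _ v)
      rw [R.HH]
      by_cases h0 : -(i : ℤ) + -j = 0
      · obtain ⟨rfl, rfl⟩ : i = 0 ∧ j = 0 := by omega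
        simp
      · rw [if_neg h0, zero_smul, add_zero])
  obtain ⟨ψ, hψ⟩ := exists_algHom_of_commute (A := Module.End ℂ Q) (fun i : ℕ => R.E (-(i + 1)))
    (fun i j => by
      ext v
      exact R.EE _ _ v)
  -- All `h(-j)` stand to the left of all `e(-i-1)`, so that multiplication by `y j` corresponds to
  -- `h(-j)` by construction.
  let B : MvPolynomial ℕ ℂ →ₗ[ℂ] MvPolynomial ℕ ℂ →ₗ[ℂ] Q :=
    LinearMap.mk₂ ℂ (fun a b => φ a (ψ b q)) (by intros; simp) (by intros; simp) (by intros; simp)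
      (by intros; simp)
  let Φ : Fock →ₗ[ℂ] Q := TensorProduct.lift B ∘ₗ split.symm.toLinearMap
  have hΦ : ∀ a b, Φ (split (a ⊗ₜ b)) = φ a (ψ b q) := by
    intro a b
    change TensorProduct.lift B (split.symm (split (a ⊗ₜ b))) = _
    rw [AlgEquiv.symm_apply_apply, TensorProduct.lift.tmul]
    rfl
  have h1 : Φ 1 = q := by
    rw [← map_one split, Algebra.TensorProduct.one_def, hΦ]; simp
  have hy : ∀ j p, Φ (y j * p) = R.H (-j) (Φ p) := by
    intro j p
    obtain ⟨t, rfl⟩ := split.surjective p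
    induction t using TensorProduct.induction_on with
    | zero => simp
    | add s t hs ht => simp only [map_add, mul_add, hs, ht]
    | tmul a b => rw [← split_mul_y, hΦ, hΦ, map_mul, hφ]; rfl
  -- For `n ≥ 0`, `e(n)` commutes past all `e(-i-1)` down to `q`, where the Whittaker condition
  -- gives the scalar `x lam (-n)`; for `n < 0` it is one more variable.
  have hE0 : ∀ n b, R.E n (ψ b q) = Φ (x lam (-n) * split (1 ⊗ₜ b)) := by
    intro n b
    rcases lt_or_ge n 0 with hn | hn
    · obtain ⟨i, rfl⟩ : ∃ i : ℕ, n = -(i + 1) := ⟨(-n - 1).toNat, by omega⟩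
      rw [neg_neg, ← split_mul_x, hΦ, map_mul, hψ, map_one]
      rfl
    · have hc : ∀ b, R.E n (ψ b q) = ψ b (R.E n q) := by
        intro b
        induction b using MvPolynomial.induction_on with
        | C r => rw [← MvPolynomial.algebraMap_eq, AlgHom.commutes]; simp
        | add p q hp hq => simp [hp, hq]
        | mul_X p i hp =>
          rw [mul_comm, map_mul, hψ]
          change R.E n (R.E _ _) = R.E _ _
          rw [R.EE, hp]
      rw [hc]
      rcases hn.eq_or_lt with rfl | hn
      · rw [hq.E_zero, neg_zero, x_zero, ← MvPolynomial.smul_eq_C_mul, map_smul, map_smul, hΦ,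
          map_one]
        rfl
      · rw [hq.E_pos n hn, x_neg lam (by omega), zero_mul, map_zero, map_zero]
  have hE : ∀ p n, Φ (E lam n p) = R.E n (Φ p) := by
    intro p
    -- The condition quantifies over all modes at once, since passing `y j` replaces `n` by `n - j`.
    let K : Submodule ℂ Fock :=
      { carrier := {p | ∀ n, Φ (E lam n p) = R.E n (Φ p)}
        add_mem' := fun ha hb n => by simp only [map_add, ha n, hb n]
        zero_mem' := fun n => by simp
        smul_mem' := fun r a ha n => by simp only [map_smul, ha n] }
    refine mem_of_split (K := K) (fun b n => ?_) (fun j p hp n => ?_) p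
    · rw [E_neg_split, hΦ, ← hE0, map_one]
      rfl
    · have h2 := R.HE (-j) n (Φ p)
      rw [E_y_mul, map_sub, map_smul, hy, hy, hp n, hp (n - j), h2,
        show -(j : ℤ) + n = n - j by ring]
      abel
  refine ⟨Φ, h1, fun n p => hE p n, fun n p => ?_⟩
  rcases neg_or_pos n with ⟨n, hn, rfl⟩ | ⟨j, rfl⟩
  -- For positive modes the relation holds at the vacuum and is inherited by the images of the
  -- creation operators, which generate.
  · let K : Submodule ℂ Fock :=
      { carrier := {p | Φ (H lam n p) = R.H n (Φ p)}
        add_mem' := fun ha hb => by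
          simp only [Set.mem_ofPred_eq, map_add] at ha hb ⊢; rw [ha, hb]
        zero_mem' := by simp
        smul_mem' := fun r a ha => by
          simp only [Set.mem_ofPred_eq, map_smul] at ha ⊢; rw [ha] }
    refine eq_top_of_stable lam (K := K) ?_ (fun i p hp => ?_) (fun j p hp => ?_) p
    · change Φ (H lam n 1) = R.H n (Φ 1)
      rw [h1, hq.H_pos _ (by omega), H_pos lam hn, Derivation.map_one_eq_zero, map_zero]
    · change Φ (H lam n p) = R.H n (Φ p) at hp
      change Φ (H lam n (E lam _ p)) = R.H n (Φ (E lam _ p))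
      rw [H_E, map_add, map_smul, hE, hE, hE, hp, R.HE]
    · change Φ (H lam n p) = R.H n (Φ p) at hp
      change Φ (H lam n (H lam _ p)) = R.H n (Φ (H lam _ p))
      rw [H_H lam n, map_add, map_smul, H_nonpos, H_nonpos, hy, hy, hp, R.HH n]
  · rw [H_nonpos, hy]

/-! ### Lowering operators -/

/-- A subspace stable under the nonnegative modes. -/
structure IsLowering (lam : ℂ) (K : Submodule ℂ Fock) : Prop where
  E_mem : ∀ n, 0 ≤ n → ∀ p ∈ K, E lam n p ∈ K
  H_mem : ∀ n, 0 < n → ∀ p ∈ K, H lam n p ∈ K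

/-- Polynomials all of whose monomials have weight less than `d`. -/
def filtration (w : ℕ ⊕ ℕ → ℕ) (d : ℕ) : Submodule ℂ Fock where
  carrier := {p | ∀ s, d ≤ Finsupp.weight w s → coeff s p = 0}
  add_mem' ha hb s hs := by rw [coeff_add, ha s hs, hb s hs, add_zero]
  zero_mem' s _ := coeff_zero s
  smul_mem' r a ha s hs := by rw [coeff_smul, ha s hs, smul_zero]

theorem filtration_mono (w : ℕ ⊕ ℕ → ℕ) {c d : ℕ} (hcd : c ≤ d) {p : Fock}
    (hp : p ∈ filtration w c) : p ∈ filtration w d :=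
  fun s hs => hp s (hcd.trans hs)

theorem eq_zero_of_mem_filtration_zero {w : ℕ ⊕ ℕ → ℕ} {p : Fock} (hp : p ∈ filtration w 0) :
    p = 0 := by
  ext s
  rw [hp s (Nat.zero_le _), coeff_zero]

theorem exists_mem_filtration (w : ℕ ⊕ ℕ → ℕ) (p : Fock) : ∃ d, p ∈ filtration w (d + 1) := by
  refine ⟨p.support.sup (Finsupp.weight w), fun s hs => ?_⟩
  by_contra h0
  have := Finset.le_sup (f := Finsupp.weight w) (mem_support_iff.2 h0)
  omega

theorem monomial_mem_filtration (w : ℕ ⊕ ℕ → ℕ) (s : ℕ ⊕ ℕ →₀ ℕ) :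
    monomial s 1 ∈ filtration w (Finsupp.weight w s + 1) := by
  intro t ht
  rw [coeff_monomial, if_neg]
  rintro rfl
  omega

theorem X_mul_mem_filtration {w : ℕ ⊕ ℕ → ℕ} {d : ℕ} {p : Fock} (i : ℕ ⊕ ℕ)
    (hp : p ∈ filtration w d) : X i * p ∈ filtration w (d + w i) := by
  intro s hs
  rw [coeff_X_mul']
  split_ifs with hi
  · rw [Finsupp.mem_support_iff] at hi
    refine hp _ ?_
    have := Finsupp.weight_sub_single_add (w := w) hi
    omega
  · rfl

theorem pderiv_mem_filtration {w : ℕ ⊕ ℕ → ℕ} {d c : ℕ} {p : Fock} (i : ℕ ⊕ ℕ) (hw : c ≤ d + w i)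
    (hp : p ∈ filtration w c) : pderiv i p ∈ filtration w d := by
  intro s hs
  rw [coeff_pderiv, hp, zero_mul]
  rw [map_add, Finsupp.weight_single]
  simp
  omega

theorem mem_of_monomial_mem {w : ℕ ⊕ ℕ → ℕ} {d : ℕ} {K : Submodule ℂ Fock}
    (hK : ∀ s, Finsupp.weight w s < d → monomial s 1 ∈ K) {p : Fock} (hp : p ∈ filtration w d) :
    p ∈ K := by
  rw [← support_sum_monomial_coeff p]
  refine K.sum_mem fun s hs => ?_
  rw [← mul_one (coeff s p), ← smul_eq_mul, ← smul_monomial]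
  refine K.smul_mem _ (hK s ?_)
  by_contra h0
  exact mem_support_iff.1 hs (hp s (by omega))

/-- A monomial of positive weight contains a variable of weight one; differentiating by it
multiplies the coefficient by a nonzero integer, so nothing is lost in characteristic zero. -/
theorem mem_filtration_of_pderiv {w : ℕ ⊕ ℕ → ℕ} {d : ℕ} {p : Fock} (hw : ∀ i, w i ≤ 1)
    (hp : ∀ i, w i = 1 → pderiv i p ∈ filtration w d) : p ∈ filtration w (d + 1) := by
  intro s hs
  obtain ⟨i, hi, hi'⟩ : ∃ i, s i ≠ 0 ∧ w i = 1 := by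
    by_contra! h0
    have : Finsupp.weight w s = 0 := by
      rw [Finsupp.weight_apply]
      refine Finset.sum_eq_zero fun i hi => ?_
      have := h0 i (Finsupp.mem_support_iff.1 hi)
      have := hw i
      change s i • w i = 0
      rw [show w i = 0 by omega, smul_zero]
    omega
  have h1 := Finsupp.weight_sub_single_add (w := w) hi
  have h2 := hp i hi' (s - Finsupp.single i 1) (by omega)
  rw [coeff_pderiv, Finsupp.sub_add_single_one_cancel hi, mul_eq_zero] at h2
  refine h2.resolve_right ?_
  exact Nat.cast_add_one_ne_zero _

/-- The weight counting the variables `y_j`. -/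
def yWeight : ℕ ⊕ ℕ → ℕ := Sum.elim (fun _ => 1) fun _ => 0

theorem coeff_shift_y_mul (j k : ℕ) (p : Fock) : (shift (y j * p)).coeff k =
    y j * (shift p).coeff k - 2 * (if j ≤ k then (shift p).coeff (k - j) else 0) := by
  rw [map_mul, shift_y, sub_mul, Polynomial.coeff_sub, Polynomial.coeff_C_mul, mul_assoc,
    show (2 : Polynomial Fock) = Polynomial.C 2 from rfl, Polynomial.coeff_C_mul,
    Polynomial.coeff_X_pow_mul']

/-- First-order Taylor expansion: replacing each `y_k` by `y_k - 2 X^k` changes a polynomial by `-2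
∂/∂y_k` in the coefficient of `X^k`, up to terms with at least two fewer `y`'s. In weight zero the
truncated subtraction still gives the zero filtration step, and both expressions vanish. -/
theorem shift_monomial_mem (s : ℕ ⊕ ℕ →₀ ℕ) (k : ℕ) :
    (shift (monomial s 1) - Polynomial.C (monomial s 1)).coeff k ∈
        filtration yWeight (Finsupp.weight yWeight s) ∧
      (shift (monomial s 1) - Polynomial.C (monomial s 1)).coeff k +
        2 * pderiv (Sum.inl k) (monomial s 1) ∈
        filtration yWeight (Finsupp.weight yWeight s - 1) := by
  induction hn : s.degree generalizing s k with
  | zero =>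
    rw [Finsupp.degree_eq_zero_iff] at hn
    subst hn
    rw [show (monomial 0 (1 : ℂ) : Fock) = 1 from rfl, map_one, Polynomial.C_1, sub_self]
    simp
  | succ n ih =>
    obtain ⟨i, hi⟩ : ∃ i, s i ≠ 0 := by
      by_contra! h0
      have : s = 0 := Finsupp.ext h0
      simp [this] at hn
    set t := s - Finsupp.single i 1 with ht
    have hst : s = t + Finsupp.single i 1 := (Finsupp.sub_add_single_one_cancel hi).symm
    have htn : t.degree = n := by
      rw [hst, map_add, Finsupp.degree_single] at hn
      omega
    have hm : (monomial s 1 : Fock) = X i * monomial t 1 := by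
      rw [X, monomial_mul, hst, add_comm, one_mul]
    have hw : Finsupp.weight yWeight s = Finsupp.weight yWeight t + yWeight i := by
      rw [hst, map_add, Finsupp.weight_single, one_smul]
    rw [hm, hw]
    have hmt := monomial_mem_filtration yWeight t
    set p : Fock := monomial t 1 with hp
    have two_mem : ∀ {d : ℕ} {q : Fock}, q ∈ filtration yWeight d → 2 * q ∈ filtration yWeight d :=
      fun {d q} hq => by rw [two_mul]; exact add_mem hq hq
    rcases i with j | i
    · have hj : yWeight (Sum.inl j) = 1 := rfl
      have hcoeff : (shift (X (Sum.inl j) * p) - Polynomial.C (X (Sum.inl j) * p)).coeff k =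
          y j * (shift p - Polynomial.C p).coeff k -
            2 * (if j ≤ k then (shift p).coeff (k - j) else 0) := by
        rw [Polynomial.coeff_sub]
        change (shift (y j * p)).coeff k - (Polynomial.C (y j * p)).coeff k = _
        rw [coeff_shift_y_mul, Polynomial.C_mul, Polynomial.coeff_C_mul, Polynomial.coeff_sub]
        ring
      have hS : ∀ l, (shift p).coeff l ∈ filtration yWeight (Finsupp.weight yWeight t + 1) := by
        intro l
        have h1 := (ih t l htn).1
        rw [Polynomial.coeff_sub] at h1
        have h2 : (Polynomial.C p).coeff l ∈
            filtration yWeight (Finsupp.weight yWeight t + 1) := by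
          rw [Polynomial.coeff_C]
          split_ifs
          · exact hmt
          · exact zero_mem _
        have := add_mem (filtration_mono _ (Nat.le_succ _) h1) h2
        rwa [sub_add_cancel] at this
      rw [hcoeff, hj]
      constructor
      · refine sub_mem (X_mul_mem_filtration (Sum.inl j) (ih t k htn).1) (two_mem ?_)
        split_ifs
        · exact hS _
        · exact zero_mem _
      · rw [Nat.add_sub_cancel, pderiv_mul]
        have h1 := (ih t k htn).2
        have e1 : y j * (shift p - Polynomial.C p).coeff k -
            2 * (if j ≤ k then (shift p).coeff (k - j) else 0) +
            2 * (pderiv (Sum.inl k) (X (Sum.inl j)) * p + X (Sum.inl j) * pderiv (Sum.inl k) p) =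
            X (Sum.inl j) * ((shift p - Polynomial.C p).coeff k + 2 * pderiv (Sum.inl k) p) -
            2 * (if j ≤ k then (shift p - Polynomial.C p).coeff (k - j) else 0) := by
          have e2 : (pderiv (Sum.inl k) (X (Sum.inl j)) : Fock) = if j = k then 1 else 0 := by
            rw [pderiv_X, Pi.single_apply]
            simp
          rw [e2]
          rcases lt_trichotomy j k with hjk | rfl | hjk
          · rw [if_pos hjk.le, if_pos hjk.le, if_neg hjk.ne, Polynomial.coeff_sub,
              Polynomial.coeff_sub, Polynomial.coeff_C_of_ne_zero (n := k - j) (by omega), y]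
            ring
          · rw [if_pos le_rfl, if_pos le_rfl, if_pos rfl, Polynomial.coeff_sub,
              Polynomial.coeff_sub, Nat.sub_self, Polynomial.coeff_C_zero, y]
            ring
          · rw [if_neg (by omega), if_neg (by omega), if_neg (by omega), y]
            ring
        rw [e1]
        refine sub_mem ?_ (two_mem ?_)
        · rcases Nat.eq_zero_or_pos (Finsupp.weight yWeight t) with h0 | h0
          · rw [h0] at h1 ⊢
            rw [eq_zero_of_mem_filtration_zero h1, mul_zero]
            exact zero_mem _
          · have := X_mul_mem_filtration (Sum.inl j) h1
            rwa [hj, Nat.sub_add_cancel h0] at this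
        · split_ifs
          · exact (ih t _ htn).1
          · exact zero_mem _
    · have hj : yWeight (Sum.inr i) = 0 := rfl
      have hcoeff : (shift (X (Sum.inr i) * p) - Polynomial.C (X (Sum.inr i) * p)).coeff k =
          X (Sum.inr i) * (shift p - Polynomial.C p).coeff k := by
        rw [map_mul, shift_inr, Polynomial.C_mul, ← mul_sub, Polynomial.coeff_C_mul]
      rw [hcoeff, hj, add_zero, pderiv_mul, pderiv_X_of_ne (by simp), zero_mul, zero_add]
      refine ⟨X_mul_mem_filtration (Sum.inr i) (ih t k htn).1, ?_⟩
      have := X_mul_mem_filtration (Sum.inr i) (ih t k htn).2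
      rw [hj, add_zero, mul_add] at this
      rwa [mul_left_comm]

theorem shift_mem {d : ℕ} {p : Fock} (hp : p ∈ filtration yWeight (d + 1)) (k : ℕ) :
    (shift p - Polynomial.C p).coeff k ∈ filtration yWeight d := by
  let A : Fock →ₗ[ℂ] Fock := (Polynomial.lcoeff Fock k).restrictScalars ℂ ∘ₗ
    (shift.toLinearMap - (Polynomial.CAlgHom (R := ℂ) (A := Fock)).toLinearMap)
  refine mem_of_monomial_mem (K := (filtration yWeight d).comap A) (fun s hs => ?_) hp
  exact filtration_mono _ (by omega) (shift_monomial_mem s k).1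

theorem shift_add_pderiv_mem {d : ℕ} {p : Fock} (hp : p ∈ filtration yWeight (d + 2)) (k : ℕ) :
    (shift p - Polynomial.C p).coeff k + 2 * pderiv (Sum.inl k) p ∈ filtration yWeight d := by
  let A : Fock →ₗ[ℂ] Fock := (Polynomial.lcoeff Fock k).restrictScalars ℂ ∘ₗ
    (shift.toLinearMap - (Polynomial.CAlgHom (R := ℂ) (A := Fock)).toLinearMap) +
    LinearMap.mulLeft ℂ 2 ∘ₗ (pderiv (Sum.inl k)).toLinearMap
  refine mem_of_monomial_mem (K := (filtration yWeight d).comap A) (fun s hs => ?_) hp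
  exact filtration_mono _ (by omega) (shift_monomial_mem s k).2

/-- Below the top degree the index of `x` is negative, so only the leading coefficient survives,
with factor `x_0 = lam`. -/
theorem contract_natDegree (lam : ℂ) (q : Polynomial Fock) :
    contract lam q.natDegree q = C lam * q.leadingCoeff := by
  rw [contract_apply, Polynomial.sum]
  rcases eq_or_ne q 0 with rfl | hq
  · simp
  rw [Finset.sum_eq_single q.natDegree]
  · rw [sub_self, x_zero]; rfl
  · intro k hk hne
    have := Polynomial.le_natDegree_of_mem_supp k hk
    rw [x_neg lam (by omega), zero_mul]
  · intro h0
    exact absurd (Polynomial.natDegree_mem_support_of_nonzero hq) h0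

/-- Descent on the `y`-degree. If `N` is the `X`-degree of `shift p - p`, then `e(N)` isolates `lam`
times its leading coefficient, which has smaller `y`-degree than `p`. -/
theorem exists_y_free {lam : ℂ} (hlam : lam ≠ 0) {K : Submodule ℂ Fock} (hK : IsLowering lam K)
    {p : Fock} (hp : p ∈ K) (h0 : p ≠ 0) : ∃ q ∈ K, q ≠ 0 ∧ q ∈ filtration yWeight 1 := by
  obtain ⟨d, hd⟩ := exists_mem_filtration yWeight p
  induction d generalizing p with
  | zero => exact ⟨p, hp, h0, hd⟩
  | succ d ih =>
    by_cases hd' : p ∈ filtration yWeight (d + 1)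
    · exact ih hp h0 hd'
    -- Otherwise every `∂p/∂y_j` would have too low a degree, and `p` would already lie in the
    -- previous filtration step.
    have hq : shift p - Polynomial.C p ≠ 0 := by
      intro hq
      apply hd'
      refine mem_filtration_of_pderiv (fun i => ?_) fun i hi => ?_
      · rcases i with j | i <;> simp [yWeight]
      · rcases i with j | i
        · have := shift_add_pderiv_mem hd j
          rw [hq, Polynomial.coeff_zero, zero_add, two_mul, ← two_smul ℂ] at this
          exact ((filtration yWeight d).smul_mem_iff two_ne_zero).1 this
        · simp [yWeight] at hi
    set q := shift p - Polynomial.C p with hqdef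
    have h1 : E lam q.natDegree p - x lam (-q.natDegree) * p = C lam * q.leadingCoeff := by
      rw [← contract_natDegree, hqdef, map_sub, contract_C, E_apply]
    have h2 : C lam * q.leadingCoeff ∈ K := by
      rw [← h1]
      refine K.sub_mem (hK.E_mem _ (by omega) _ hp) ?_
      -- The correction factor `x lam (-N)` is the scalar `lam` for `N = 0` and zero otherwise.
      rcases Nat.eq_zero_or_pos q.natDegree with h3 | h3
      · rw [h3, Nat.cast_zero, neg_zero, x_zero, ← MvPolynomial.smul_eq_C_mul]
        exact K.smul_mem _ hp
      · rw [x_neg lam (by omega), zero_mul]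
        exact K.zero_mem
    rw [← MvPolynomial.smul_eq_C_mul, K.smul_mem_iff hlam] at h2
    exact ih h2 (Polynomial.leadingCoeff_ne_zero.2 hq) (shift_mem hd _)

/-- A nonzero subspace stable under the nonnegative modes contains the vacuum. -/
theorem IsLowering.one_mem {lam : ℂ} (hlam : lam ≠ 0) {K : Submodule ℂ Fock}
    (hK : IsLowering lam K) (h0 : K ≠ ⊥) : 1 ∈ K := by
  obtain ⟨p, hp, hp0⟩ := K.ne_bot_iff.1 h0
  obtain ⟨p, hp, hp0, hy⟩ := exists_y_free hlam hK hp hp0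
  obtain ⟨d, hd⟩ := exists_mem_filtration (fun _ => 1) p
  induction d generalizing p with
  | zero =>
    have h1 : p = coeff 0 p • 1 := by
      ext s
      rw [coeff_smul, coeff_one, smul_eq_mul, mul_ite, mul_one, mul_zero]
      split_ifs with hs
      · rw [hs]
      · refine hd s (Nat.one_le_iff_ne_zero.2 fun h2 => hs ?_)
        have : Finsupp.degree s = 0 := by rw [← h2, Finsupp.degree_eq_weight_one]
        exact ((Finsupp.degree_eq_zero_iff s).1 this).symm
    rw [h1] at hp hp0
    have h2 : coeff 0 p ≠ 0 := fun h2 => hp0 (by rw [h2, zero_smul])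
    exact (K.smul_mem_iff h2).1 hp
  | succ d ih =>
    have hvars : ∀ j, Sum.inl j ∉ p.vars := by
      intro j hj
      rw [mem_vars_iff_mem_support] at hj
      obtain ⟨s, hs, hjs⟩ := hj
      refine mem_support_iff.1 hs (hy s ?_)
      have := Finsupp.weight_sub_single_add (w := yWeight) (Finsupp.mem_support_iff.1 hjs)
      rw [← this]
      exact Nat.le_add_left _ _
    rcases p.vars.eq_empty_or_nonempty with hv | hv
    · refine ih p hp hp0 hy fun s hs => ?_
      by_contra hs0
      have : s = 0 := by
        by_contra hs1
        obtain ⟨i, hi⟩ := Finsupp.ne_iff.1 hs1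
        have : i ∈ p.vars :=
          (mem_vars_iff_mem_support i).2 ⟨s, mem_support_iff.2 hs0, Finsupp.mem_support_iff.2 hi⟩
        simp [hv] at this
      simp [this] at hs
    · obtain ⟨i, hi, hmax⟩ := p.vars.exists_max_image (Sum.elim (fun _ => 0) id) hv
      rcases i with j | N
      · exact absurd hi (hvars j)
      -- The highest variable in `p` is `x_(N+1)`. The mode `h(N+1)` sends `x_k` to `2 x_(k-N-1)`,
      -- which is `2 lam` for `k = N + 1` and zero for smaller `k`.
      have h1 : D lam (N + 1) p = ((2 * lam) • pderiv (Sum.inr N) : Derivation ℂ Fock Fock) p := by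
        refine derivation_eq_of_forall_mem_vars fun i hi => ?_
        rcases i with j | i
        · exact absurd hi (hvars j)
        · have h2 : i ≤ N := hmax _ hi
          rw [← x_succ lam, D_x lam (Nat.succ_pos N), x_succ, Derivation.smul_apply, pderiv_X,
            Pi.single_apply]
          rcases h2.lt_or_eq with h3 | rfl
          · rw [x_neg lam (by push_cast; omega), if_neg (by simp; omega), mul_zero, smul_zero]
          · rw [if_pos rfl, show ((i : ℤ) + 1 - (i + 1 : ℕ)) = 0 by push_cast; ring, x_zero,
              MvPolynomial.smul_eq_C_mul, C_mul, mul_one]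
            rfl
      have h2 : pderiv (Sum.inr N) p ∈ K := by
        have := hK.H_mem (N + 1 : ℕ) (by omega) p hp
        rw [H_pos lam (Nat.succ_pos N), h1, Derivation.smul_apply, K.smul_mem_iff] at this
        · exact this
        · exact mul_ne_zero two_ne_zero hlam
      refine ih _ h2 ?_ (pderiv_mem_filtration _ (Nat.le_add_right _ _) hy)
        (pderiv_mem_filtration _ le_rfl hd)
      rw [mem_vars_iff_mem_support] at hi
      obtain ⟨s, hs, hNs⟩ := hi
      intro h3
      have h4 := congrArg (coeff (s - Finsupp.single (Sum.inr N) 1)) h3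
      rw [coeff_pderiv, Finsupp.sub_add_single_one_cancel (Finsupp.mem_support_iff.1 hNs),
        coeff_zero, mul_eq_zero] at h4
      rcases h4 with h4 | h4
      · exact mem_support_iff.1 hs h4
      · exact Nat.cast_add_one_ne_zero _ h4

end Fock
end

noncomputable section

open MvPolynomial

/-! ### Coefficientwise maps on power series -/

namespace PowerSeries

/-- Coefficientwise application of an additive map. -/
def mapAdd {A B : Type*} [Semiring A] [Semiring B] (g : A →+ B) : A⟦X⟧ →+ B⟦X⟧ where
  toFun a := mk fun n => g (coeff n a)
  map_zero' := by ext n; simp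
  map_add' a b := by ext n; simp

theorem coeff_mapAdd {A B : Type*} [Semiring A] [Semiring B] (g : A →+ B) (a : A⟦X⟧) (n : ℕ) :
    coeff n (mapAdd g a) = g (coeff n a) := by
  simp [mapAdd]

theorem derivative_map {A B : Type*} [CommSemiring A] [CommSemiring B] (g : A →+* B) (a : A⟦X⟧) :
    derivative B (map g a) = map g (derivative A a) := by
  ext n; simp [coeff_derivative]

theorem derivative_mul {A : Type*} [CommSemiring A] (a b : A⟦X⟧) :
    derivative A (a * b) = a * derivative A b + b * derivative A a := by
  rw [Derivation.leibniz, smul_eq_mul, smul_eq_mul]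

theorem derivative_sub {A : Type*} [CommRing A] (a b : A⟦X⟧) :
    derivative A (a - b) = derivative A a - derivative A b := map_sub _ _ _

theorem derivative_two_mul {A : Type*} [CommSemiring A] (a : A⟦X⟧) :
    derivative A (2 * a) = 2 * derivative A a := by rw [two_mul, map_add, two_mul]

/-- The series `1 / (1 - r X)`. -/
def geom {A : Type*} [CommRing A] (r : A) : A⟦X⟧ := mk fun n => r ^ n

theorem geom_mul {A : Type*} [CommRing A] (r : A) : geom r * (1 - C r * X) = 1 := by
  ext1 n
  rw [show (geom r * (1 - C r * X) : A⟦X⟧) = geom r - C r * (geom r * X) by ring, map_sub, coeff_C_mul]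
  rcases n with _ | n
  · simp [geom]
  · rw [coeff_succ_mul_X, coeff_one, if_neg (by omega), geom, coeff_mk, coeff_mk]
    ring

theorem X_mul_derivative_geom {A : Type*} [CommRing A] (r : A) :
    X * derivative A (geom r) = geom r ^ 2 - geom r := by
  have h1 := congrArg (derivative A) (geom_mul r)
  rw [derivative_mul, derivative_sub, derivative_mul, derivative_X, derivative_C,
    derivative_one] at h1
  have h2 := geom_mul r
  linear_combination (X * geom r) * h1 + (-geom r - X * derivative A (geom r)) * h2

theorem X_mul_derivative_X_pow {A : Type*} [CommRing A] (m : ℕ) :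
    (X : A⟦X⟧) * derivative A ((X : A⟦X⟧) ^ m) = (m : A⟦X⟧) * (X : A⟦X⟧) ^ m := by
  rcases m with _ | m
  · simp
  · rw [derivative_pow, derivative_X, Nat.add_sub_cancel]; ring

end PowerSeries

/-! ### The series of the vectors `f(n) w` and its relations with the nonnegative modes. -/

namespace Fock

open PowerSeries (mapAdd coeff_mapAdd derivative)

/-- The generating series of the `x_i`. -/
def xs (lam : ℂ) : PowerSeries Fock := .mk fun i => x lam i

/-- The generating series of the `y_j`. -/
def ys : PowerSeries Fock := .mk y

theorem isUnit_xs {lam : ℂ} (hlam : lam ≠ 0) : ∃ xi, xs lam * xi = 1 := by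
  rw [← isUnit_iff_exists_inv, PowerSeries.isUnit_iff_constantCoeff]
  have : PowerSeries.constantCoeff (xs lam) = C lam := by
    rw [← PowerSeries.coeff_zero_eq_constantCoeff_apply, xs, PowerSeries.coeff_mk, Nat.cast_zero,
      x_zero]
  rw [this]
  exact (isUnit_iff_ne_zero.2 hlam).map C

/-- The series `y + 2 z x' / x`. -/
def us (lam : ℂ) (xi : PowerSeries Fock) : PowerSeries Fock :=
  ys + 2 * (.X * derivative _ (xs lam)) * xi

/-- The generating series `∑ f(1 - k) z^k` of the vectors `f(n) w`. -/
def fs (lam : ℂ) (xi cs : PowerSeries Fock) : PowerSeries Fock :=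
  xi * (cs - .X * (.C (C (1 / 4)) * us lam xi ^ 2 + .C (C (1 / 2)) * us lam xi -
    .C (C (1 / 2)) * (.X * derivative _ (us lam xi))))

/-- Coefficientwise application of a derivation. -/
abbrev dps (d : Derivation ℂ Fock Fock) : PowerSeries Fock →+ PowerSeries Fock :=
  mapAdd d.toLinearMap.toAddMonoidHom

theorem coeff_dps (d : Derivation ℂ Fock Fock) (a : PowerSeries Fock) (n : ℕ) :
    PowerSeries.coeff n (dps d a) = d (PowerSeries.coeff n a) := coeff_mapAdd _ _ _

theorem dps_mul (d : Derivation ℂ Fock Fock) (a b : PowerSeries Fock) :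
    dps d (a * b) = dps d a * b + a * dps d b := by
  ext1 n
  simp only [coeff_dps, PowerSeries.coeff_mul, map_add, map_sum, Derivation.leibniz, smul_eq_mul,
    ← Finset.sum_add_distrib]
  exact Finset.sum_congr rfl fun _ _ => by ring

theorem dps_map (d : Derivation ℂ Fock Fock) (a : PowerSeries ℂ) :
    dps d (a.map (algebraMap ℂ Fock)) = 0 := by
  ext1 n
  rw [coeff_dps, PowerSeries.coeff_map, Derivation.map_algebraMap, map_zero]

theorem dps_X (d : Derivation ℂ Fock Fock) : dps d PowerSeries.X = 0 := by
  simpa using dps_map d PowerSeries.X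

theorem dps_C (d : Derivation ℂ Fock Fock) (r : ℂ) : dps d (.C (C r)) = 0 := by
  simpa [MvPolynomial.algebraMap_eq] using dps_map d (PowerSeries.C r)

theorem dps_ofNat (d : Derivation ℂ Fock Fock) (a : PowerSeries Fock) :
    dps d (2 * a) = 2 * dps d a := by rw [two_mul, map_add, two_mul]

theorem dps_derivative (d : Derivation ℂ Fock Fock) (a : PowerSeries Fock) :
    dps d (derivative _ a) = derivative _ (dps d a) := by
  ext1 n
  rw [coeff_dps, PowerSeries.coeff_derivative, PowerSeries.coeff_derivative, coeff_dps,
    Derivation.leibniz, smul_eq_mul, smul_eq_mul]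
  have : d ((n : Fock) + 1) = 0 := by simp
  rw [this]; ring

theorem dps_xs (lam : ℂ) {m : ℕ} (hm : 0 < m) : dps (D lam m) (xs lam) = 2 * .X ^ m * xs lam := by
  ext1 n
  rw [coeff_dps, mul_assoc, show (2 : PowerSeries Fock) = PowerSeries.C 2 from rfl,
    PowerSeries.coeff_C_mul, PowerSeries.coeff_X_pow_mul', xs, PowerSeries.coeff_mk, D_x lam hm]
  split_ifs with h1
  · rw [PowerSeries.coeff_mk, Nat.cast_sub h1]
  · rw [x_neg lam (by omega)]

theorem dps_ys (lam : ℂ) (m : ℕ) : dps (D lam m) ys = -4 * m * .X ^ m := by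
  ext1 n
  have : (-4 * m * .X ^ m : PowerSeries Fock) = PowerSeries.C (C (-4 * (m : ℂ))) * .X ^ m := by
    simp only [map_mul, map_neg, map_ofNat, map_natCast]
  rw [coeff_dps, ys, PowerSeries.coeff_mk, D_y, this, PowerSeries.coeff_C_mul,
    PowerSeries.coeff_X_pow]
  split_ifs <;> simp

/-- The combination `us` is invariant: `ys` contributes `-4m z^m`, and the logarithmic derivative of
`xs`, which is scaled by `2 z^m`, contributes `4m z^m`. Only the factor `xi` is moved. -/
theorem dps_fs {lam : ℂ} {xi : PowerSeries Fock} (hxi : xs lam * xi = 1) (c : PowerSeries ℂ)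
    {m : ℕ} (hm : 0 < m) : dps (D lam m) (fs lam xi (c.map (algebraMap ℂ Fock))) =
      -2 * .X ^ m * fs lam xi (c.map (algebraMap ℂ Fock)) := by
  have h1 : dps (D lam m) xi = -2 * .X ^ m * xi := by
    have h2 := dps_mul (D lam m) (xs lam) xi
    have h3 := dps_map (D lam m) 1
    rw [map_one] at h3
    rw [hxi, h3, dps_xs lam hm] at h2
    linear_combination (-xi) * h2 + (-dps (D lam m) xi - 2 * .X ^ m * xi) * hxi
  have hd : derivative Fock (2 * PowerSeries.X ^ m * xs lam) =
      2 * derivative Fock (PowerSeries.X ^ m * xs lam) := by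
    rw [mul_assoc, PowerSeries.derivative_two_mul]
  have h4 : dps (D lam m) (us lam xi) = 0 := by
    rw [us, map_add, dps_mul, dps_ofNat, dps_mul, dps_X, dps_derivative, dps_xs lam hm, h1, dps_ys,
      hd, PowerSeries.derivative_mul]
    have h5 := PowerSeries.X_mul_derivative_X_pow (A := Fock) m
    linear_combination 4 * (xs lam * xi) * h5 + 4 * (m * .X ^ m) * hxi
  have h6 : dps (D lam m) (us lam xi ^ 2) = 0 := by rw [sq, dps_mul, h4]; ring
  rw [fs, dps_mul, map_sub, dps_map, dps_mul, dps_X, map_sub, map_add, dps_mul, dps_mul, dps_mul,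
    dps_mul, dps_derivative, h4, h6, h1, dps_C, dps_C, dps_X, map_zero]
  ring

/-- Embedding of the constant polynomials. -/
abbrev emb : PowerSeries Fock →+* PowerSeries (Polynomial Fock) := PowerSeries.map Polynomial.C

/-- Coefficientwise translation. -/
abbrev shiftPS : PowerSeries Fock →+* PowerSeries (Polynomial Fock) :=
  PowerSeries.map shift.toRingHom

theorem shift_C (r : ℂ) : shift (C r) = Polynomial.C (C r) := by
  rw [← MvPolynomial.algebraMap_eq, AlgHom.commutes]; rfl

theorem shiftPS_map (c : PowerSeries ℂ) :
    shiftPS (c.map (algebraMap ℂ Fock)) = emb (c.map (algebraMap ℂ Fock)) := by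
  ext1 n
  rw [PowerSeries.coeff_map, PowerSeries.coeff_map, PowerSeries.coeff_map]
  exact shift_C _

theorem shiftPS_xs (lam : ℂ) : shiftPS (xs lam) = emb (xs lam) := by
  ext1 n
  rw [PowerSeries.coeff_map, PowerSeries.coeff_map, xs, PowerSeries.coeff_mk]
  exact shift_x lam n

theorem shiftPS_ys : shiftPS ys = emb ys - 2 * PowerSeries.geom Polynomial.X := by
  ext1 n
  rw [map_sub, show (2 : PowerSeries (Polynomial Fock)) = PowerSeries.C 2 from rfl,
    PowerSeries.coeff_C_mul, PowerSeries.coeff_map, PowerSeries.coeff_map, ys, PowerSeries.geom,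
    PowerSeries.coeff_mk, PowerSeries.coeff_mk]
  exact shift_y n

theorem shiftPS_xi {lam : ℂ} {xi : PowerSeries Fock} (hxi : xs lam * xi = 1) :
    shiftPS xi = emb xi := by
  have h1 := congrArg shiftPS hxi
  have h2 := congrArg emb hxi
  rw [map_mul, map_one, shiftPS_xs] at h1
  rw [map_mul, map_one] at h2
  linear_combination emb xi * h1 - shiftPS xi * h2

theorem shiftPS_us {lam : ℂ} {xi : PowerSeries Fock} (hxi : xs lam * xi = 1) :
    shiftPS (us lam xi) = emb (us lam xi) - 2 * PowerSeries.geom Polynomial.X := by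
  rw [us]
  simp only [map_add, map_mul, map_ofNat, shiftPS_ys, shiftPS_xi hxi, PowerSeries.map_X,
    ← PowerSeries.derivative_map, shiftPS_xs]
  ring

/-- Translation changes only `u`, into `u - 2g` with `g = 1/(1 - Xz)`; the differential term is
eliminated by `z g' = g² - g`. -/
theorem shiftPS_fs {lam : ℂ} {xi : PowerSeries Fock} (hxi : xs lam * xi = 1) (c : PowerSeries ℂ) :
    shiftPS (fs lam xi (c.map (algebraMap ℂ Fock))) =
      emb (fs lam xi (c.map (algebraMap ℂ Fock))) +
        emb xi * (.X * (emb (us lam xi + 2) * PowerSeries.geom Polynomial.X -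
          2 * PowerSeries.geom Polynomial.X ^ 2)) := by
  have hr : ∀ r : ℂ, shiftPS (.C (C r)) = emb (.C (C r)) := by
    intro r
    rw [PowerSeries.map_C, PowerSeries.map_C]
    exact congrArg _ (shift_C r)
  have h4 : emb (.C (C (1 / 4))) * 4 = 1 := by
    rw [← map_ofNat emb, ← map_mul, ← map_ofNat PowerSeries.C, ← map_mul, ← map_ofNat C, ← map_mul]
    norm_num
  have h2 : emb (.C (C (1 / 2))) * 2 = 1 := by
    rw [← map_ofNat emb, ← map_mul, ← map_ofNat PowerSeries.C, ← map_mul, ← map_ofNat C, ← map_mul]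
    norm_num
  have hg := PowerSeries.X_mul_derivative_geom (Polynomial.X : Polynomial Fock)
  have hd : shiftPS (derivative _ (us lam xi)) =
      emb (derivative _ (us lam xi)) -
        2 * derivative _ (PowerSeries.geom (Polynomial.X : Polynomial Fock)) := by
    rw [← PowerSeries.derivative_map, shiftPS_us hxi, PowerSeries.derivative_sub,
      PowerSeries.derivative_map, PowerSeries.derivative_two_mul]
  rw [fs]
  rw [map_mul, map_sub, map_mul, map_sub, map_add, map_mul, map_mul, map_mul, map_mul, map_pow,
    shiftPS_xi hxi, PowerSeries.map_X, shiftPS_map, hr, hr, hd, shiftPS_us hxi]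
  rw [map_mul emb, map_sub emb, map_mul emb, map_sub emb, map_add emb, map_mul emb, map_mul emb,
    map_mul emb, map_mul emb, map_pow emb, map_add emb, PowerSeries.map_X, map_ofNat emb]
  generalize emb (us lam xi) = u at *
  generalize emb (derivative Fock (us lam xi)) = u' at *
  generalize emb (.C (C (1 / 4))) = a at *
  generalize emb (.C (C (1 / 2))) = b at *
  generalize emb xi = v at *
  generalize emb (c.map (algebraMap ℂ Fock)) = w at *
  generalize PowerSeries.geom (Polynomial.X : Polynomial Fock) = g at *
  generalize derivative (Polynomial Fock) g = g' at *
  linear_combination (v * .X * (u * g - g ^ 2)) * h4 + (v * .X * (g - .X * g')) * h2 - v * .X * hg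

/-- Coefficientwise contraction. -/
abbrev contractPS (lam : ℂ) (m : ℤ) : PowerSeries (Polynomial Fock) →+ PowerSeries Fock :=
  mapAdd (contract lam m).toAddMonoidHom

theorem coeff_contractPS (lam : ℂ) (m : ℤ) (a : PowerSeries (Polynomial Fock)) (n : ℕ) :
    PowerSeries.coeff n (contractPS lam m a) = contract lam m (PowerSeries.coeff n a) :=
  coeff_mapAdd _ _ _

theorem contractPS_emb_mul (lam : ℂ) (m : ℤ) (a : PowerSeries Fock)
    (b : PowerSeries (Polynomial Fock)) :
    contractPS lam m (emb a * b) = a * contractPS lam m b := by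
  ext1 n
  rw [coeff_contractPS, PowerSeries.coeff_mul, PowerSeries.coeff_mul, map_sum]
  refine Finset.sum_congr rfl fun k _ => ?_
  rw [PowerSeries.coeff_map, coeff_contractPS]
  exact contract_C_mul lam m _ _

theorem contractPS_emb (lam : ℂ) (m : ℤ) (a : PowerSeries Fock) :
    contractPS lam m (emb a) = .C (x lam (-m)) * a := by
  ext1 n
  rw [coeff_contractPS, PowerSeries.coeff_map, PowerSeries.coeff_C_mul]
  exact contract_C lam m _

theorem contract_X_pow (lam : ℂ) (m : ℤ) (k : ℕ) :
    contract lam m (Polynomial.X ^ k) = x lam (k - m) := by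
  rw [Polynomial.X_pow_eq_monomial, contract_monomial, mul_one]

theorem contractPS_geom (lam : ℂ) (m : ℕ) :
    contractPS lam m (PowerSeries.geom Polynomial.X) = .X ^ m * xs lam := by
  ext1 n
  rw [coeff_contractPS, PowerSeries.geom, PowerSeries.coeff_mk, contract_X_pow,
    PowerSeries.coeff_X_pow_mul', xs]
  split_ifs with h1
  · rw [PowerSeries.coeff_mk, Nat.cast_sub h1]
  · rw [x_neg lam (by omega)]

theorem coeff_geom_sq {A : Type*} [CommRing A] (r : A) (n : ℕ) :
    PowerSeries.coeff n (PowerSeries.geom r ^ 2) = (n + 1) * r ^ n := by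
  rw [sub_eq_iff_eq_add.1 (PowerSeries.X_mul_derivative_geom r).symm, map_add]
  rcases n with _ | n
  · simp [PowerSeries.geom]
  · rw [mul_comm, PowerSeries.coeff_succ_mul_X, PowerSeries.coeff_derivative, PowerSeries.geom,
      PowerSeries.coeff_mk]
    push_cast; ring

theorem contractPS_geom_sq (lam : ℂ) (m : ℕ) :
    contractPS lam m (PowerSeries.geom Polynomial.X ^ 2) =
      .X ^ m * ((m + 1) * xs lam + .X * derivative _ (xs lam)) := by
  ext1 n
  rw [coeff_contractPS, coeff_geom_sq, PowerSeries.coeff_X_pow_mul',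
    show ((n : Polynomial Fock) + 1) = Polynomial.C ((n : Fock) + 1) by simp, contract_C_mul,
    contract_X_pow]
  split_ifs with h1
  · obtain ⟨k, rfl⟩ := Nat.exists_eq_add_of_le h1
    rw [Nat.add_sub_cancel_left, map_add,
      show ((m : PowerSeries Fock) + 1) = PowerSeries.C ((m : Fock) + 1) by simp,
      PowerSeries.coeff_C_mul, show ((m + k : ℕ) : ℤ) - m = k by push_cast; ring]
    have : PowerSeries.coeff k (.X * derivative _ (xs lam)) = k * x lam k := by
      rcases k with _ | k
      · simp
      · rw [mul_comm, PowerSeries.coeff_succ_mul_X, PowerSeries.coeff_derivative, xs,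
          PowerSeries.coeff_mk]
        push_cast; ring
    rw [this, xs, PowerSeries.coeff_mk]
    push_cast; ring
  · rw [x_neg lam (by omega), mul_zero]

theorem contractPS_X_mul (lam : ℂ) (m : ℤ) (a : PowerSeries (Polynomial Fock)) :
    contractPS lam m (.X * a) = .X * contractPS lam m a := by
  rw [← contractPS_emb_mul, PowerSeries.map_X]

/-- Contraction turns `g` into `z^m x` and `g²` into `z^m ((m+1) x + z x')`. The `z x'/x` inside
`us` cancels, leaving the series of `h(m+n) 1` and the central term `-2m`: this is where the level
enters. -/
theorem contractPS_shift_fs {lam : ℂ} {xi : PowerSeries Fock} (hxi : xs lam * xi = 1)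
    (c : PowerSeries ℂ) (m : ℕ) :
    contractPS lam m (shiftPS (fs lam xi (c.map (algebraMap ℂ Fock)))) =
      .C (x lam (-m)) * fs lam xi (c.map (algebraMap ℂ Fock)) +
        .X ^ (m + 1) * (ys - 2 * m) := by
  have h2 : ∀ a : PowerSeries (Polynomial Fock),
      contractPS lam m (2 * a) = 2 * contractPS lam m a := by
    intro a; rw [two_mul, map_add, two_mul]
  rw [shiftPS_fs hxi, map_add, contractPS_emb, contractPS_emb_mul, contractPS_X_mul, map_sub,
    contractPS_emb_mul, h2, contractPS_geom, contractPS_geom_sq, us]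
  linear_combination (.X ^ (m + 1) * (ys + 2 * (.X * derivative _ (xs lam)) * xi - 2 * m)) * hxi

/-- The vectors `f(n) w`. -/
def fvec (lam : ℂ) (xi : PowerSeries Fock) (c : PowerSeries ℂ) (n : ℤ) : Fock :=
  if n ≤ 1 then PowerSeries.coeff (1 - n).toNat (fs lam xi (c.map (algebraMap ℂ Fock))) else 0

theorem fvec_eq (lam : ℂ) (xi : PowerSeries Fock) (c : PowerSeries ℂ) (b : ℕ) :
    fvec lam xi c (1 - b) = PowerSeries.coeff b (fs lam xi (c.map (algebraMap ℂ Fock))) := by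
  rw [fvec, if_pos (by omega), show (1 - (1 - (b : ℤ))).toNat = b by omega]

theorem fvec_of_lt (lam : ℂ) (xi : PowerSeries Fock) (c : PowerSeries ℂ) {n : ℤ} (hn : 1 < n) :
    fvec lam xi c n = 0 := if_neg (by omega)

theorem H_fvec {lam : ℂ} {xi : PowerSeries Fock} (hxi : xs lam * xi = 1) (c : PowerSeries ℂ)
    {m : ℤ} (hm : 0 < m) (n : ℤ) :
    H lam m (fvec lam xi c n) + (2 : ℂ) • fvec lam xi c (m + n) = 0 := by
  obtain ⟨m, rfl⟩ : ∃ k : ℕ, m = k := ⟨m.toNat, by omega⟩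
  rcases lt_or_ge 1 n with hn | hn
  · rw [fvec_of_lt _ _ _ hn, fvec_of_lt _ _ _ (by omega), map_zero, smul_zero, add_zero]
  obtain ⟨b, rfl⟩ : ∃ b : ℕ, n = 1 - b := ⟨(1 - n).toNat, by omega⟩
  have h1 := congrArg (PowerSeries.coeff b) (dps_fs hxi c (by omega : 0 < m))
  rw [coeff_dps, mul_assoc, show (-2 : PowerSeries Fock) = PowerSeries.C (-2) by
    rw [map_neg, map_ofNat], PowerSeries.coeff_C_mul, PowerSeries.coeff_X_pow_mul'] at h1
  rw [fvec_eq, H_pos lam (by omega), h1, MvPolynomial.smul_eq_C_mul, map_ofNat]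
  split_ifs with h2
  · rw [show (m : ℤ) + (1 - b) = 1 - (b - m : ℕ) by omega, fvec_eq]; ring
  · rw [fvec_of_lt _ _ _ (by omega)]; ring

/-- The relation `[e(m), f(n)] = h(m+n) + m δ c` tested on the vacuum. Together with `H_fvec` it
makes `(fvec, 1)` a Whittaker vector of `pairRep`. -/
theorem E_fvec {lam : ℂ} {xi : PowerSeries Fock} (hxi : xs lam * xi = 1) (c : PowerSeries ℂ)
    {m : ℤ} (hm : 0 ≤ m) (n : ℤ) :
    E lam m (fvec lam xi c n) = x lam (-m) * fvec lam xi c n + H lam (m + n) 1 -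
      (if m + n = 0 then 2 * (m : ℂ) else 0) • 1 := by
  obtain ⟨m, rfl⟩ : ∃ k : ℕ, m = k := ⟨m.toNat, by omega⟩
  have hH : ∀ k : ℤ, 0 < k → H lam k 1 = 0 := (rep_isWhittaker lam).H_pos
  rcases lt_or_ge 1 n with hn | hn
  · rw [fvec_of_lt _ _ _ hn, map_zero, hH _ (by omega), if_neg (by omega)]
    simp
  obtain ⟨b, rfl⟩ : ∃ b : ℕ, n = 1 - b := ⟨(1 - n).toNat, by omega⟩
  have h1 := congrArg (PowerSeries.coeff b) (contractPS_shift_fs hxi c m)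
  rw [coeff_contractPS, PowerSeries.coeff_map, map_add, PowerSeries.coeff_C_mul,
    PowerSeries.coeff_X_pow_mul', show (2 * m : PowerSeries Fock) = PowerSeries.C (2 * (m : Fock)) by
      simp only [map_mul, map_ofNat, map_natCast]] at h1
  rw [fvec_eq, E_apply]
  refine h1.trans ?_
  rw [add_sub_assoc]
  congr 1
  split_ifs with h2 h3 h3
  · obtain rfl : b = m + 1 := by omega
    rw [map_sub, ys, PowerSeries.coeff_mk, Nat.sub_self, PowerSeries.coeff_zero_C, h3]
    have := H_nonpos lam 0 1
    rw [Nat.cast_zero, neg_zero] at this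
    rw [this, MvPolynomial.smul_eq_C_mul]
    simp only [map_mul, map_ofNat, map_natCast, Int.cast_natCast, mul_one]
  · rw [map_sub, ys, PowerSeries.coeff_mk, PowerSeries.coeff_C, if_neg (by omega),
      show (m : ℤ) + (1 - b) = -((b - (m + 1) : ℕ) : ℤ) by omega, H_nonpos]
    simp
  · omega
  · rw [hH _ (by omega)]; simp

end Fock
end

noncomputable section

open MvPolynomial

namespace Fock

open PowerSeries (mapAdd coeff_mapAdd derivative)

/-! ### Matrix coefficients of `f(m)` -/

/-- The projection to the vacuum. -/
def vac : Fock →ₐ[ℂ] ℂ := aeval 0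

theorem vac_y (j : ℕ) : vac (y j) = 0 := by simp [vac, y]

theorem vac_X (i : ℕ ⊕ ℕ) : vac (X i) = 0 := by simp [vac]

theorem vac_C (r : ℂ) : vac (C r) = r := by simp [vac]

theorem vac_x (lam : ℂ) (k : ℤ) : vac (x lam k) = if k = 0 then lam else 0 := by
  rw [x]
  split_ifs with h1 h2 h2
  · omega
  · exact map_zero _
  · exact vac_C _
  · exact vac_X _

theorem vac_H (lam : ℂ) (j : ℕ) (p : Fock) : vac (H lam (-j) p) = 0 := by
  rw [H_nonpos, map_mul, vac_y, zero_mul]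

theorem vac_E (lam : ℂ) {n : ℤ} (hn : n < 0) (p : Fock) : vac (E lam n p) = 0 := by
  rw [E_apply, contract_apply, Polynomial.sum, map_sum]
  refine Finset.sum_eq_zero fun k _ => ?_
  rw [map_mul, vac_x, if_neg (by omega), zero_mul]

/-- The coefficients of the prescribed eigenvalue of `T(z)`. -/
def eig (c : PowerSeries ℂ) (n : ℤ) : ℂ := if n ≤ 1 then PowerSeries.coeff (1 - n).toNat c else 0

theorem eig_eq (c : PowerSeries ℂ) (b : ℕ) : eig c (1 - b) = PowerSeries.coeff b c := by
  rw [eig, if_pos (by omega), show (1 - (1 - (b : ℤ))).toNat = b by omega]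

theorem eig_of_lt (c : PowerSeries ℂ) {n : ℤ} (hn : 1 < n) : eig c n = 0 := if_neg (by omega)

/-- The vacuum projection sends `xs` to the constant `lam` and `us` to zero, so only `c / lam`
remains of `fs`. -/
theorem vac_fvec {lam : ℂ} (hlam : lam ≠ 0) {xi : PowerSeries Fock} (hxi : xs lam * xi = 1)
    (c : PowerSeries ℂ) (n : ℤ) : vac (fvec lam xi c n) = lam⁻¹ * eig c n := by
  rcases lt_or_ge 1 n with hn | hn
  · rw [fvec_of_lt _ _ _ hn, eig_of_lt _ hn, map_zero, mul_zero]
  obtain ⟨b, rfl⟩ : ∃ b : ℕ, n = 1 - b := ⟨(1 - n).toNat, by omega⟩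
  rw [fvec_eq, eig_eq]
  let v : PowerSeries Fock →+* PowerSeries ℂ := PowerSeries.map vac.toRingHom
  have hx : v (xs lam) = .C lam := by
    ext1 k
    rw [PowerSeries.coeff_map, xs, PowerSeries.coeff_mk, PowerSeries.coeff_C]
    refine (vac_x lam k).trans ?_
    simp only [Nat.cast_eq_zero]
  have hy : v ys = 0 := by
    ext1 k
    rw [PowerSeries.coeff_map, ys, PowerSeries.coeff_mk, map_zero]
    exact vac_y k
  have hi : .C lam * v xi = 1 := by rw [← hx, ← map_mul, hxi, map_one]
  have hu : v (us lam xi) = 0 := by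
    rw [us, map_add, map_mul, map_mul, map_mul, ← PowerSeries.derivative_map, hx, hy,
      PowerSeries.derivative_C]
    ring
  have hc : v (c.map (algebraMap ℂ Fock)) = c := by
    ext1 k
    rw [PowerSeries.coeff_map, PowerSeries.coeff_map]
    exact vac_C _
  have h1 : .C lam * v (fs lam xi (c.map (algebraMap ℂ Fock))) = c := by
    rw [fs, map_mul, map_sub, map_mul, map_sub, map_add, map_mul, map_mul, map_mul, map_mul,
      map_pow, ← PowerSeries.derivative_map, hu, hc, map_zero]
    linear_combination c * hi
  have h2 := congrArg (PowerSeries.coeff b) h1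
  rw [PowerSeries.coeff_C_mul, PowerSeries.coeff_map] at h2
  rw [← h2, inv_mul_cancel_left₀ hlam]
  rfl

/-- The target of the specialization computing the matrix coefficients. -/
abbrev Aux : Type := PowerSeries (Polynomial ℂ)

/-- The variable `r` of `Aux`. -/
abbrev rv : Aux := .C Polynomial.X

/-- The inverse of `1 - s`, where `s` is the variable of the power series. -/
abbrev tv : Aux := PowerSeries.geom 1

theorem tv_eq : tv = 1 + .X * tv := by
  have := PowerSeries.geom_mul (1 : Polynomial ℂ)
  rw [map_one, one_mul] at this
  linear_combination this

/-- Constants in `Aux`. -/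
abbrev cv : ℂ →+* Aux := (PowerSeries.C (R := Polynomial ℂ)).comp Polynomial.C

/-- The specialization computing the matrix coefficients. -/
def spec (lam : ℂ) : Fock →+* Aux :=
  eval₂Hom cv (Sum.elim (fun j => 2 * rv ^ j) fun i => cv lam * rv ^ (i + 1) * .X * tv ^ (i + 1))

theorem spec_y (lam : ℂ) (j : ℕ) : spec lam (y j) = 2 * rv ^ j := by
  simp [spec, y]

theorem spec_C (lam : ℂ) (r : ℂ) : spec lam (C r) = cv r := by
  simp [spec]

theorem spec_x (lam : ℂ) (i : ℕ) :
    spec lam (x lam (i + 1)) = cv lam * rv ^ (i + 1) * .X * tv ^ (i + 1) := by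
  rw [x_succ]; simp [spec]

/-- The functional `X^k ↦ g (m - k)`. -/
def pair (g : ℤ → ℂ) (m : ℤ) : Polynomial ℂ →ₗ[ℂ] ℂ :=
  Polynomial.lsum fun k => LinearMap.mulLeft ℂ (g (m - k))

theorem pair_monomial (g : ℤ → ℂ) (m : ℤ) (k : ℕ) (a : ℂ) :
    pair g m (Polynomial.monomial k a) = g (m - k) * a := by
  simp [pair, Polynomial.sum_monomial_index]

theorem pair_C (g : ℤ → ℂ) (m : ℤ) (a : ℂ) : pair g m (Polynomial.C a) = g m * a := by
  rw [← Polynomial.monomial_zero_left, pair_monomial, Nat.cast_zero, sub_zero]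

theorem pair_C_mul (g : ℤ → ℂ) (m : ℤ) (a : ℂ) (p : Polynomial ℂ) :
    pair g m (Polynomial.C a * p) = a * pair g m p := by
  rw [← Polynomial.smul_eq_C_mul, map_smul, smul_eq_mul]

theorem pair_X_pow_mul (g : ℤ → ℂ) (m : ℤ) (j : ℕ) (p : Polynomial ℂ) :
    pair g m (Polynomial.X ^ j * p) = pair g (m - j) p := by
  induction p using Polynomial.induction_on' with
  | add p q hp hq => simp [mul_add, hp, hq]
  | monomial k a =>
    rw [Polynomial.X_pow_mul_monomial, pair_monomial, pair_monomial]
    congr 2; push_cast; ring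

/-- The indicator of `0`. -/
abbrev delta (n : ℤ) : ℂ := if n = 0 then 1 else 0

/-- The matrix coefficient functional `p ↦ vac (f(m) p)` in closed form. -/
def theta (lam : ℂ) (c : PowerSeries ℂ) (m : ℤ) : Fock →+ ℂ where
  toFun p := lam⁻¹ * pair (eig c) m (PowerSeries.coeff 0 (spec lam p)) -
    2 * lam⁻¹ * pair delta m (PowerSeries.coeff 2 (spec lam p))
  map_zero' := by simp
  map_add' p q := by simp only [map_add]; ring

theorem theta_apply (lam : ℂ) (c : PowerSeries ℂ) (m : ℤ) (p : Fock) : theta lam c m p =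
    lam⁻¹ * pair (eig c) m (PowerSeries.coeff 0 (spec lam p)) -
      2 * lam⁻¹ * pair delta m (PowerSeries.coeff 2 (spec lam p)) := rfl

theorem theta_C_mul (lam : ℂ) (c : PowerSeries ℂ) (m : ℤ) (r : ℂ) (p : Fock) :
    theta lam c m (C r * p) = r * theta lam c m p := by
  rw [theta_apply, theta_apply, map_mul, spec_C, RingHom.comp_apply, PowerSeries.coeff_C_mul,
    PowerSeries.coeff_C_mul, pair_C_mul, pair_C_mul]
  ring

/-- This mirrors `f(m) h(-j) = h(-j) f(m) + 2 f(m-j)`, whose first term has no vacuum component. It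
explains the value `2 r^j` of `spec` on `y_j`: a power of `r` lowers the mode. -/
theorem theta_y_mul (lam : ℂ) (c : PowerSeries ℂ) (m : ℤ) (j : ℕ) (p : Fock) :
    theta lam c m (y j * p) = 2 * theta lam c (m - j) p := by
  have h2 : (2 * rv ^ j : Aux) = .C (Polynomial.C 2 * Polynomial.X ^ j) := by
    rw [map_mul, map_pow]; rfl
  rw [theta_apply, theta_apply, map_mul, spec_y, h2, PowerSeries.coeff_C_mul,
    PowerSeries.coeff_C_mul, mul_assoc (Polynomial.C 2), mul_assoc (Polynomial.C 2), pair_C_mul,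
    pair_C_mul, pair_X_pow_mul, pair_X_pow_mul]
  ring

open TensorProduct

theorem coeff_zero_mul (a b : Aux) : PowerSeries.coeff 0 (a * b) =
    PowerSeries.coeff 0 a * PowerSeries.coeff 0 b := by simp

theorem coeff_tv (k : ℕ) : PowerSeries.coeff k tv = 1 := by
  simp [PowerSeries.geom]

theorem coeff_zero_tv_pow (k : ℕ) : PowerSeries.coeff 0 (tv ^ k) = 1 := by
  rw [PowerSeries.coeff_zero_eq_constantCoeff_apply, map_pow,
    ← PowerSeries.coeff_zero_eq_constantCoeff_apply, coeff_tv, one_pow]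

theorem coeff_one_tv_pow (k : ℕ) : PowerSeries.coeff 1 (tv ^ k) = (k : Polynomial ℂ) := by
  rw [PowerSeries.coeff_one_pow, coeff_tv, ← PowerSeries.coeff_zero_eq_constantCoeff_apply,
    coeff_tv, one_pow, mul_one, mul_one]

theorem spec_split_zero (lam : ℂ) (b : MvPolynomial ℕ ℂ) :
    PowerSeries.coeff 0 (spec lam (split (1 ⊗ₜ b))) = Polynomial.C (vac (split (1 ⊗ₜ b))) := by
  induction b using MvPolynomial.induction_on with
  | C r =>
    rw [tensorEquivSum_one_tmul_C, Algebra.algebraMap_self, RingHom.id_apply, spec_C, vac_C]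
    simp
  | add p q hp hq => simp only [TensorProduct.tmul_add, map_add, hp, hq]
  | mul_X p i hp =>
    rw [mul_comm, split_mul_x lam, map_mul vac, map_mul (spec lam), coeff_zero_mul, spec_x, vac_x,
      if_neg (by omega), zero_mul]
    simp

/-- For `n > 0` a constant term in `h(n) p` can only come from the linear term in `x_n`, through
`x_n ↦ 2 x_0 = 2 lam`. The coefficient of `s` in `spec` collects exactly the part linear in the
`x`'s. -/
theorem spec_split_one (lam : ℂ) (b : MvPolynomial ℕ ℂ) (n : ℤ) :
    vac (H lam n (split (1 ⊗ₜ b))) =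
      2 * pair delta n (PowerSeries.coeff 1 (spec lam (split (1 ⊗ₜ b)))) := by
  induction b using MvPolynomial.induction_on with
  | C r =>
    rw [tensorEquivSum_one_tmul_C, Algebra.algebraMap_self, RingHom.id_apply, spec_C]
    rcases neg_or_pos n with ⟨n, hn, rfl⟩ | ⟨j, rfl⟩
    · rw [H_pos lam hn, ← MvPolynomial.algebraMap_eq, Derivation.map_algebraMap]
      simp
    · rw [vac_H]
      simp
  | add p q hp hq => simp only [TensorProduct.tmul_add, map_add, hp, hq, mul_add]
  | mul_X p i hp =>
    have h1 : PowerSeries.coeff 1 (spec lam (split (1 ⊗ₜ[ℂ] (X i * p)))) =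
        Polynomial.X ^ (i + 1) * Polynomial.C (lam * vac (split (1 ⊗ₜ p))) := by
      rw [split_mul_x lam, map_mul, spec_x,
        show cv lam * rv ^ (i + 1) * PowerSeries.X * tv ^ (i + 1) * spec lam (split (1 ⊗ₜ[ℂ] p)) =
          .C (Polynomial.X ^ (i + 1) * Polynomial.C lam) *
            (PowerSeries.X * (tv ^ (i + 1) * spec lam (split (1 ⊗ₜ[ℂ] p)))) by
          rw [map_mul, map_pow, RingHom.comp_apply]; ring,
        PowerSeries.coeff_C_mul, mul_comm PowerSeries.X, show (1 : ℕ) = 0 + 1 from rfl,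
        PowerSeries.coeff_succ_mul_X, coeff_zero_mul, coeff_zero_tv_pow, spec_split_zero, one_mul,
        mul_assoc, map_mul]
    rw [mul_comm p, h1, pair_X_pow_mul, pair_C]
    rcases neg_or_pos n with ⟨n, hn, rfl⟩ | ⟨j, rfl⟩
    · rw [H_pos lam hn, split_mul_x lam, Derivation.leibniz, D_x lam hn, smul_eq_mul, smul_eq_mul,
        map_add, map_mul, map_mul, map_mul, map_ofNat, vac_x, vac_x, if_neg (by omega), delta]
      by_cases hni : (i : ℤ) + 1 - n = 0
      · rw [if_pos hni, if_pos (by push_cast; omega)]; ring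
      · rw [if_neg hni, if_neg (by push_cast; omega)]; ring
    · rw [vac_H, delta, if_neg (by push_cast; omega)]
      ring

/-- The right-hand side is the vacuum part of the commutator of `f(m)` with `e(-i-1)`. Since `tv ^
(i+1) = 1 + (i+1) s + ...`, the coefficient of `s²` records both the quadratic part in the `x`'s and
`i + 1` times the linear part, the latter accounting for the central term. -/
theorem theta_x_mul {lam : ℂ} (hlam : lam ≠ 0) (c : PowerSeries ℂ) (m : ℤ) (i : ℕ)
    (b : MvPolynomial ℕ ℂ) : theta lam c m (split (1 ⊗ₜ (X i * b))) =
      -vac (H lam (m - (i + 1)) (split (1 ⊗ₜ b))) -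
        2 * (i + 1) * delta (m - (i + 1)) * vac (split (1 ⊗ₜ b)) := by
  set p := split (1 ⊗ₜ[ℂ] b) with hp
  have h1 : spec lam (split (1 ⊗ₜ[ℂ] (X i * b))) =
      .C (Polynomial.X ^ (i + 1) * Polynomial.C lam) *
            (PowerSeries.X * (tv ^ (i + 1) * spec lam p)) := by
    rw [split_mul_x lam, map_mul, spec_x, map_mul, map_pow, RingHom.comp_apply]; ring
  have h2 : PowerSeries.coeff 2 (spec lam (split (1 ⊗ₜ[ℂ] (X i * b)))) =
      Polynomial.X ^ (i + 1) * (Polynomial.C lam * (PowerSeries.coeff 1 (spec lam p) +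
        Polynomial.C ((i + 1) * vac p))) := by
    rw [h1, PowerSeries.coeff_C_mul, mul_comm PowerSeries.X, show (2 : ℕ) = 1 + 1 from rfl,
      PowerSeries.coeff_succ_mul_X, PowerSeries.coeff_mul, Finset.Nat.antidiagonal_succ]
    rw [Finset.sum_cons, Finset.Nat.antidiagonal_zero, Finset.map_singleton, Finset.sum_singleton]
    change _ * (PowerSeries.coeff 0 (tv ^ (i + 1)) * PowerSeries.coeff 1 (spec lam p) +
      PowerSeries.coeff 1 (tv ^ (i + 1)) * PowerSeries.coeff 0 (spec lam p)) = _
    rw [coeff_zero_tv_pow, coeff_one_tv_pow, hp, spec_split_zero]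
    simp only [map_mul, map_add, map_natCast, map_one, Nat.cast_add, Nat.cast_one]
    ring
  have h3 : PowerSeries.coeff 0 (spec lam (split (1 ⊗ₜ[ℂ] (X i * b)))) = 0 := by
    rw [h1]; simp
  rw [theta_apply, h2, h3, map_zero, pair_X_pow_mul, pair_C_mul, map_add, pair_C, spec_split_one]
  push_cast
  field_simp
  ring

/-- The product of `1 / (1 - X z)` with a series with constant coefficients. -/
def geomMul (c : PowerSeries ℂ) : PowerSeries (Polynomial ℂ) :=
  PowerSeries.geom Polynomial.X * c.map Polynomial.C

theorem coeff_zero_geomMul (c : PowerSeries ℂ) :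
    PowerSeries.coeff 0 (geomMul c) = Polynomial.C (PowerSeries.coeff 0 c) := by
  rw [geomMul, coeff_zero_mul, PowerSeries.coeff_map, PowerSeries.geom, PowerSeries.coeff_mk,
    pow_zero, one_mul]

theorem coeff_succ_geomMul (c : PowerSeries ℂ) (b : ℕ) : PowerSeries.coeff (b + 1) (geomMul c) =
    Polynomial.X * PowerSeries.coeff b (geomMul c) +
      Polynomial.C (PowerSeries.coeff (b + 1) c) := by
  have h1 := PowerSeries.geom_mul (Polynomial.X : Polynomial ℂ)
  have h2 : geomMul c = .C Polynomial.X * (geomMul c * .X) + c.map Polynomial.C := by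
    rw [geomMul]
    linear_combination (c.map Polynomial.C) * h1
  conv_lhs => rw [h2]
  rw [map_add, PowerSeries.coeff_C_mul, PowerSeries.coeff_succ_mul_X, PowerSeries.coeff_map]

theorem pair_geomMul (c : PowerSeries ℂ) (k : ℤ) (b : ℕ) :
    pair delta k (PowerSeries.coeff b (geomMul c)) = if 0 ≤ k then eig c (1 - b + k) else 0 := by
  induction b generalizing k with
  | zero =>
    rw [coeff_zero_geomMul, pair_C, delta]
    split_ifs with h1 h2 h2
    · rw [h1]; simp [eig]
    · omega
    · rw [eig_of_lt _ (by omega), zero_mul]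
    · rw [zero_mul]
  | succ b ih =>
    rw [coeff_succ_geomMul, map_add, pair_C, ← pow_one Polynomial.X, pair_X_pow_mul, ih, delta,
      ← eig_eq]
    rcases lt_trichotomy k 0 with hk | rfl | hk
    · rw [if_neg (by push_cast; omega), if_neg (by omega), if_neg (by omega)]; ring
    · simp
    · rw [if_pos (by push_cast; omega), if_neg (by omega), if_pos (by omega)]
      push_cast
      rw [show (1 : ℤ) - b + (k - 1) = 1 - (b + 1) + k by ring]
      ring

/-- The point is the symmetry of the answer in `m` and `n`. It can be computed because `spec` turns
all the series involved into simple rational functions of `z`. -/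
theorem theta_fvec {lam : ℂ} (hlam : lam ≠ 0) {xi : PowerSeries Fock} (hxi : xs lam * xi = 1)
    (c : PowerSeries ℂ) (m n : ℤ) : theta lam c m (fvec lam xi c n) =
      lam⁻¹ ^ 2 * (eig c m * eig c n +
        2 * eig c (m + n) * ((if 1 ≤ m then 1 else 0) + (if 1 ≤ n then 1 else 0) - 1)) := by
  rcases lt_or_ge 1 n with hn | hn
  · rw [fvec_of_lt _ _ _ hn, eig_of_lt _ hn, map_zero, if_pos hn.le]
    split_ifs with hm
    · rw [eig_of_lt c (n := m + n) (by omega)]; ring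
    · ring
  obtain ⟨b, rfl⟩ : ∃ b : ℕ, n = 1 - b := ⟨(1 - n).toNat, by omega⟩
  let v : PowerSeries Fock →+* PowerSeries Aux := PowerSeries.map (spec lam)
  set g : PowerSeries Aux := PowerSeries.geom rv with hg
  set g2 : PowerSeries Aux := PowerSeries.geom (rv * tv) with hg2
  have eg := PowerSeries.geom_mul rv
  have eg2 := PowerSeries.geom_mul (rv * tv)
  have dg2 := PowerSeries.X_mul_derivative_geom (rv * tv)
  rw [← hg] at eg
  rw [← hg2] at eg2 dg2
  rw [map_mul] at eg2
  -- With `t (1 - s) = 1`, the series `1 + s ∑_{k ≥ 1} (rtz)^k` sums to `(1 - rz)/(1 - rtz)`.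
  have hx : v (xs lam) = .C (cv lam) * ((1 - .C rv * .X) * g2) := by
    ext1 k
    rw [PowerSeries.coeff_map, xs, PowerSeries.coeff_mk, PowerSeries.coeff_C_mul, sub_mul, one_mul,
      map_sub, mul_assoc, PowerSeries.coeff_C_mul, mul_comm PowerSeries.X]
    rcases k with _ | k
    · rw [Nat.cast_zero, x_zero, spec_C, hg2]; simp [PowerSeries.geom]
    · rw [PowerSeries.coeff_succ_mul_X, hg2, PowerSeries.geom, PowerSeries.coeff_mk,
        PowerSeries.coeff_mk, Nat.cast_succ, spec_x]
      linear_combination (-cv lam * rv ^ (k + 1) * tv ^ k) * tv_eq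
  have hy : v ys = 2 * g := by
    ext1 k
    rw [PowerSeries.coeff_map, ys, PowerSeries.coeff_mk, spec_y,
      show (2 : PowerSeries Aux) = .C 2 from rfl, PowerSeries.coeff_C_mul, hg, PowerSeries.geom,
      PowerSeries.coeff_mk]
  have hl : (.C (cv lam) : PowerSeries Aux) * .C (cv lam⁻¹) = 1 := by
    rw [← map_mul, ← map_mul, mul_inv_cancel₀ hlam, map_one, map_one]
  have hxv : v (xs lam) * v xi = 1 := by rw [← map_mul, hxi, map_one]
  have hi : v xi = .C (cv lam⁻¹) * ((1 - .C rv * .C tv * .X) * g) := by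
    rw [hx] at hxv
    linear_combination (.C (cv lam⁻¹) * ((1 - .C rv * .C tv * .X) * g)) * hxv -
      v xi * (.C (cv lam) * .C (cv lam⁻¹)) * (1 - .C rv * .X) * g * eg2 -
      v xi * (.C (cv lam) * .C (cv lam⁻¹)) * eg - v xi * hl
  have hdx : .X * derivative _ (v (xs lam)) =
      .C (cv lam) * (-(.C rv * .X) * g2 + (1 - .C rv * .X) * (g2 ^ 2 - g2)) := by
    rw [hx, PowerSeries.derivative_mul, PowerSeries.derivative_C, PowerSeries.derivative_mul,
      PowerSeries.derivative_sub, PowerSeries.derivative_mul, PowerSeries.derivative_C,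
      PowerSeries.derivative_X, PowerSeries.derivative_one]
    linear_combination .C (cv lam) * (1 - .C rv * .X) * dg2
  have hu : v (us lam xi) = 2 * g2 := by
    rw [us, map_add, map_mul, map_mul, map_mul, ← PowerSeries.derivative_map, PowerSeries.map_X,
      map_ofNat, hdx, hi, hy]
    generalize g = G at *
    generalize g2 = G2 at *
    generalize (.C rv : PowerSeries Aux) = R at *
    generalize (.C tv : PowerSeries Aux) = T at *
    generalize (.X : PowerSeries Aux) = Z at *
    generalize (.C (cv lam) : PowerSeries Aux) = L at *
    generalize (.C (cv lam⁻¹) : PowerSeries Aux) = L' at *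
    linear_combination (2 * (-(R * Z) * G2 + (1 - R * Z) * (G2 ^ 2 - G2)) *
      ((1 - R * T * Z) * G)) * hl + (2 * G * (-R * Z + (1 - R * Z) * (G2 - 1))) * eg2 +
      (2 * G2) * eg
  have hc : v (c.map (algebraMap ℂ Fock)) = c.map cv := by
    ext1 k
    rw [PowerSeries.coeff_map, PowerSeries.coeff_map, PowerSeries.coeff_map]
    exact spec_C lam _
  have h4 : v (.C (C (1 / 4))) * 4 = 1 := by
    rw [← map_ofNat v, ← map_mul, ← map_ofNat PowerSeries.C, ← map_mul, ← map_ofNat C, ← map_mul]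
    norm_num
  have h2 : v (.C (C (1 / 2))) * 2 = 1 := by
    rw [← map_ofNat v, ← map_mul, ← map_ofNat PowerSeries.C, ← map_mul, ← map_ofNat C, ← map_mul]
    norm_num
  -- For `u = 2 g2` the identity `z g2' = g2² - g2` reduces `u²/4 + u/2 - zu'/2` to `2 g2`, and the
  -- factor `1 - rtz` from `1/x` cancels `g2`.
  have hf : v (fs lam xi (c.map (algebraMap ℂ Fock))) = .C (cv lam⁻¹) *
      (g * c.map cv - .C (rv * tv) * (.X * (g * c.map cv)) - 2 * (.X * g)) := by
    rw [fs, map_mul, map_sub, map_mul, map_sub, map_add, map_mul, map_mul, map_mul, map_mul,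
      map_pow, ← PowerSeries.derivative_map, hu, hc, PowerSeries.map_X,
      PowerSeries.derivative_two_mul, hi, map_mul]
    generalize v (.C (C (1 / 4))) = A at *
    generalize v (.C (C (1 / 2))) = B at *
    generalize derivative Aux g2 = D2 at *
    generalize g = G at *
    generalize g2 = G2 at *
    generalize (.C rv : PowerSeries Aux) = R at *
    generalize (.C tv : PowerSeries Aux) = T at *
    generalize (.X : PowerSeries Aux) = Z at *
    generalize (.C (cv lam⁻¹) : PowerSeries Aux) = L' at *
    linear_combination (-L' * (1 - R * T * Z) * G * Z * G2 ^ 2) * h4 -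
      (L' * (1 - R * T * Z) * G * Z * (G2 - Z * D2)) * h2 +
      (L' * (1 - R * T * Z) * G * Z) * dg2 - (2 * L' * G * Z) * eg2
  have hG : g * c.map cv = (geomMul c).map PowerSeries.C := by
    have h5 : g = (PowerSeries.geom (Polynomial.X : Polynomial ℂ)).map PowerSeries.C := by
      ext1 k
      rw [hg, PowerSeries.coeff_map, PowerSeries.geom, PowerSeries.geom, PowerSeries.coeff_mk,
        PowerSeries.coeff_mk, map_pow]
    rw [h5, geomMul, map_mul]
    congr 1
  have hs : spec lam (fvec lam xi c (1 - b)) = .C (Polynomial.C lam⁻¹) *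
      (.C (PowerSeries.coeff b (geomMul c)) -
        PowerSeries.coeff b (PowerSeries.X * (geomMul c).map PowerSeries.C) * (rv * tv) -
          2 * PowerSeries.coeff b (PowerSeries.X * g)) := by
    have h5 := congrArg (PowerSeries.coeff b) hf
    rw [PowerSeries.coeff_map, PowerSeries.coeff_C_mul, map_sub, map_sub,
      PowerSeries.coeff_C_mul, hG, PowerSeries.coeff_map,
      show (2 : PowerSeries Aux) = .C 2 from rfl, PowerSeries.coeff_C_mul] at h5
    rw [fvec_eq, h5, mul_comm (rv * tv)]
    rfl
  rw [theta_apply, hs]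
  rcases b with _ | b
  · have h0 : ∀ a : PowerSeries Aux, PowerSeries.coeff 0 (PowerSeries.X * a) = 0 := by simp
    rw [h0, h0, zero_mul, mul_zero, sub_zero, sub_zero, coeff_zero_geomMul, ← map_mul,
      PowerSeries.coeff_C, PowerSeries.coeff_C, if_pos rfl, if_neg (by omega), map_zero, ← map_mul,
      pair_C, eig_eq, if_pos (show (1 : ℤ) ≤ 1 - ((0 : ℕ) : ℤ) by simp)]
    split_ifs with hm
    · rw [eig_of_lt c (n := m + (1 - (0 : ℕ))) (by push_cast; omega)]; ring
    · ring
  · rw [mul_comm PowerSeries.X, mul_comm PowerSeries.X, PowerSeries.coeff_succ_mul_X,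
      PowerSeries.coeff_succ_mul_X, PowerSeries.coeff_map, PowerSeries.coeff_C_mul,
      PowerSeries.coeff_C_mul]
    have h5 : ∀ k, PowerSeries.coeff k (.C (PowerSeries.coeff (b + 1) (geomMul c)) -
        .C (PowerSeries.coeff b (geomMul c)) * (rv * tv) - 2 * PowerSeries.coeff b g) =
        (if k = 0 then PowerSeries.coeff (b + 1) (geomMul c) else 0) -
          Polynomial.X * PowerSeries.coeff b (geomMul c) -
            if k = 0 then Polynomial.C 2 * Polynomial.X ^ b else 0 := by
      intro k
      have h6 : (2 * PowerSeries.coeff b g : Aux) = .C (Polynomial.C 2 * Polynomial.X ^ b) := by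
        rw [hg, PowerSeries.geom, PowerSeries.coeff_mk, map_mul, map_pow]; rfl
      rw [h6, ← mul_assoc, ← map_mul, map_sub, map_sub, PowerSeries.coeff_C_mul, coeff_tv,
        PowerSeries.coeff_C, PowerSeries.coeff_C, mul_one, mul_comm Polynomial.X]
    rw [h5, h5, if_pos rfl, if_pos rfl, if_neg (by omega), if_neg (by omega), coeff_succ_geomMul,
      add_sub_cancel_left, pair_C_mul, pair_C_mul, map_sub, map_sub, map_sub, map_zero, pair_C,
      pair_C_mul, ← pow_one Polynomial.X, pair_X_pow_mul, pair_geomMul, ← pow_mul, one_mul,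
      ← mul_one (Polynomial.X ^ b), pair_X_pow_mul, ← Polynomial.C_1, pair_C, ← eig_eq]
    have h7 : m + (1 - ((b + 1 : ℕ) : ℤ)) = m - b := by push_cast; ring
    have h8 : (1 : ℤ) - b + (m - (1 : ℕ)) = m - b := by push_cast; ring
    rw [h7, h8, if_neg (show ¬ (1 : ℤ) ≤ 1 - ((b + 1 : ℕ) : ℤ) by push_cast; omega)]
    by_cases hm : 1 ≤ m
    · rw [if_pos hm, if_pos (by push_cast; omega)]; ring
    · rw [if_neg hm, if_neg (by push_cast; omega)]; ring

/-! ### The operators `f(n)` -/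

/-- The action of `e(m)` on pairs `((f(n) b)ₙ, b)`. -/
def pairE (lam : ℂ) (m : ℤ) : (ℤ → Fock) × Fock →ₗ[ℂ] (ℤ → Fock) × Fock where
  toFun v := (fun n => E lam m (v.1 n) - H lam (m + n) v.2 +
    (if m + n = 0 then 2 * (m : ℂ) else 0) • v.2, E lam m v.2)
  map_add' v w := by
    refine Prod.ext (funext fun n => ?_) (map_add _ _ _)
    simp only [Prod.fst_add, Prod.snd_add, Pi.add_apply, map_add]
    module
  map_smul' r v := by
    refine Prod.ext (funext fun n => ?_) (map_smul _ _ _)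
    simp only [Prod.smul_fst, Prod.smul_snd, Pi.smul_apply, map_smul, RingHom.id_apply]
    module

/-- The action of `h(m)` on pairs `((f(n) b)ₙ, b)`. -/
def pairH (lam : ℂ) (m : ℤ) : (ℤ → Fock) × Fock →ₗ[ℂ] (ℤ → Fock) × Fock where
  toFun v := (fun n => H lam m (v.1 n) + (2 : ℂ) • v.1 (m + n), H lam m v.2)
  map_add' v w := by
    refine Prod.ext (funext fun n => ?_) (map_add _ _ _)
    simp only [Prod.fst_add, Pi.add_apply, map_add]
    module
  map_smul' r v := by
    refine Prod.ext (funext fun n => ?_) (map_smul _ _ _)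
    simp only [Prod.smul_fst, Pi.smul_apply, map_smul, RingHom.id_apply]
    module

theorem pairE_apply (lam : ℂ) (m : ℤ) (v : (ℤ → Fock) × Fock) : pairE lam m v =
    (fun n => E lam m (v.1 n) - H lam (m + n) v.2 +
      (if m + n = 0 then 2 * (m : ℂ) else 0) • v.2, E lam m v.2) := rfl

theorem pairH_apply (lam : ℂ) (m : ℤ) (v : (ℤ → Fock) × Fock) : pairH lam m v =
    (fun n => H lam m (v.1 n) + (2 : ℂ) • v.1 (m + n), H lam m v.2) := rfl

/-- Pairs `((f(n) b)ₙ, b)` as a representation of the Borel part. -/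
def pairRep (lam : ℂ) : BorelRep ((ℤ → Fock) × Fock) where
  E := pairE lam
  H := pairH lam
  EE m n v := by
    refine Prod.ext (funext fun k => ?_) (E_E lam m n v.2)
    simp only [pairE_apply, map_add, map_sub, map_smul]
    rw [E_E lam m n, H_E lam (m + k) n, H_E lam (n + k) m, show m + k + n = n + k + m by ring]
    abel
  HE m n v := by
    refine Prod.ext (funext fun k => ?_) (H_E lam m n v.2)
    simp only [pairE_apply, pairH_apply, map_add, map_sub, map_smul, Prod.fst_add, Prod.smul_fst,
      Pi.add_apply, Pi.smul_apply]
    rw [H_E lam m n, H_H lam m (n + k), show n + (m + k) = m + n + k by ring,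
      show m + (n + k) = m + n + k by ring]
    by_cases h0 : m + n + k = 0
    · simp only [if_pos h0]; push_cast; module
    · simp only [if_neg h0]; module
  HH m n v := by
    refine Prod.ext (funext fun k => ?_) (H_H lam m n v.2)
    simp only [pairH_apply, map_add, map_smul, Prod.fst_add, Prod.smul_fst,
      Pi.add_apply, Pi.smul_apply]
    rw [H_H lam m n, show n + (m + k) = m + (n + k) by ring]
    module

/-- Operators on the Fock space satisfying the relations of `f(n)`, except for commutativity. -/
structure IsFOp (lam : ℂ) (c : PowerSeries ℂ) (F : ℤ → Fock →ₗ[ℂ] Fock) : Prop where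
  F_E : ∀ n m p, F n (E lam m p) = E lam m (F n p) - H lam (m + n) p +
    (if m + n = 0 then 2 * (m : ℂ) else 0) • p
  F_H : ∀ n m p, F n (H lam m p) = H lam m (F n p) + (2 : ℂ) • F (m + n) p
  F_one : ∃ xi, xs lam * xi = 1 ∧ ∀ n, F n 1 = fvec lam xi c n

/-- The pair representation encodes how `f(n)` must commute with the Borel part, without referring
to any action of `f`. The universal property then propagates the values at the vacuum to the whole
Fock space. -/
theorem exists_isFOp {lam : ℂ} (hlam : lam ≠ 0) (c : PowerSeries ℂ) : ∃ F, IsFOp lam c F := by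
  obtain ⟨xi, hxi⟩ := isUnit_xs hlam
  have hE : ∀ m, 0 ≤ m → (pairRep lam).E m (fvec lam xi c, 1) =
      (fun n => x lam (-m) * fvec lam xi c n, E lam m 1) := by
    intro m hm
    refine Prod.ext (funext fun n => ?_) rfl
    change (pairE lam m _).1 n = _
    rw [pairE_apply]
    dsimp only
    rw [E_fvec hxi c hm]
    abel
  have hq : (pairRep lam).IsWhittaker lam (fvec lam xi c, 1) := by
    refine ⟨fun n hn => ?_, ?_, fun m hm => ?_⟩
    · rw [hE n hn.le, x_neg lam (by omega)]
      simp only [zero_mul]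
      exact Prod.ext rfl ((rep_isWhittaker lam).E_pos n hn)
    · rw [hE 0 le_rfl]
      refine Prod.ext (funext fun n => ?_) (rep_isWhittaker lam).E_zero
      dsimp only
      rw [neg_zero, x_zero, ← MvPolynomial.smul_eq_C_mul]
      rfl
    · exact Prod.ext (funext fun n => H_fvec hxi c hm n) ((rep_isWhittaker lam).H_pos m hm)
  obtain ⟨Φ, h1, hΦE, hΦH⟩ := exists_lift (pairRep lam) lam _ hq
  -- Once the second component is known to be the identity, the first component reads off `F n p`,
  -- and the intertwining relations of `Φ` become those of `F`.
  have h2 : ∀ p, (Φ p).2 = p := by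
    let K : Submodule ℂ Fock := LinearMap.eqLocus (LinearMap.snd ℂ _ _ ∘ₗ Φ) LinearMap.id
    refine fun p => eq_top_of_stable lam (K := K) ?_ (fun i p hp => ?_) (fun j p hp => ?_) p
    · change (Φ 1).2 = 1
      rw [h1]
    · change (Φ p).2 = p at hp
      change (Φ (E lam _ p)).2 = E lam _ p
      rw [hΦE]
      change E lam _ (Φ p).2 = _
      rw [hp]
    · change (Φ p).2 = p at hp
      change (Φ (H lam _ p)).2 = H lam _ p
      rw [hΦH]
      change H lam _ (Φ p).2 = _
      rw [hp]
  let F : ℤ → Fock →ₗ[ℂ] Fock := fun n =>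
    (LinearMap.proj (R := ℂ) (φ := fun _ : ℤ => Fock) n ∘ₗ
      LinearMap.fst ℂ (ℤ → Fock) Fock) ∘ₗ Φ
  have hFΦ : ∀ n p, F n p = (Φ p).1 n := fun n p => rfl
  refine ⟨F, fun n m p => ?_, fun n m p => ?_, xi, hxi, fun n => ?_⟩
  · rw [hFΦ, hFΦ, hΦE]
    change (pairE lam m (Φ p)).1 n = _
    rw [pairE_apply]
    dsimp only
    rw [h2]
  · rw [hFΦ, hFΦ, hFΦ, hΦH]
    change (pairH lam m (Φ p)).1 n = _
    rw [pairH_apply]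
  · rw [hFΦ, h1]

/-- Images of creation operators have no vacuum component, so the relations of `F` with them
determine `vac ∘ F m` recursively; `theta` satisfies the same recursion. -/
theorem IsFOp.vac_F {lam : ℂ} (hlam : lam ≠ 0) {c : PowerSeries ℂ} {F : ℤ → Fock →ₗ[ℂ] Fock}
    (hF : IsFOp lam c F) (p : Fock) (m : ℤ) : vac (F m p) = theta lam c m p := by
  let K : Submodule ℂ Fock :=
    { carrier := {p | ∀ m, vac (F m p) = theta lam c m p}
      add_mem' := fun ha hb m => by rw [map_add, map_add, map_add, ha m, hb m]
      zero_mem' := fun m => by simp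
      smul_mem' := fun r a ha m => by
        rw [map_smul, map_smul, ha m, MvPolynomial.smul_eq_C_mul, theta_C_mul]; rfl }
  refine mem_of_split (K := K) (fun b => ?_) (fun j p hp m => ?_) p m
  · induction b using MvPolynomial.induction_on with
    | C r =>
      rw [tensorEquivSum_one_tmul_C, Algebra.algebraMap_self, RingHom.id_apply, ← mul_one (C r),
        ← MvPolynomial.smul_eq_C_mul]
      refine K.smul_mem _ fun m => ?_
      obtain ⟨xi, hxi, h1⟩ := hF.F_one
      rw [h1, vac_fvec hlam hxi, theta_apply, map_one, PowerSeries.coeff_one, PowerSeries.coeff_one,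
        if_pos rfl, if_neg (by omega), map_zero, ← Polynomial.C_1, pair_C]
      ring
    | add p q hp hq => rw [TensorProduct.tmul_add, map_add]; exact K.add_mem hp hq
    | mul_X p i hp =>
      intro m
      rw [mul_comm, theta_x_mul hlam, split_mul_x lam, ← neg_neg ((i : ℤ) + 1), ← E_neg_split,
        hF.F_E, map_add, map_sub, vac_E lam (by omega), map_smul, neg_neg,
        show -((i : ℤ) + 1) + m = m - (i + 1) by ring, delta]
      split_ifs
      · rw [smul_eq_mul]; push_cast; ring
      · rw [smul_eq_mul]; ring
  · rw [theta_y_mul, ← hp (m - j), ← H_nonpos lam, hF.F_H, map_add, vac_H, map_smul, smul_eq_mul,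
      zero_add, show -(j : ℤ) + m = m - j by ring]

/-- The commutators `Y m n` commute with every `e(k)`, and bracketing with `h(k)` only shifts their
indices. Hence the `Y m n 1` span a lowering subspace; by the symmetry of `theta_fvec` it has no
vacuum component and is zero. Vanishing at the vacuum spreads to the whole space. -/
theorem IsFOp.F_F {lam : ℂ} (hlam : lam ≠ 0) {c : PowerSeries ℂ} {F : ℤ → Fock →ₗ[ℂ] Fock}
    (hF : IsFOp lam c F) (m n : ℤ) (p : Fock) : F m (F n p) = F n (F m p) := by
  let Y : ℤ → ℤ → Fock →ₗ[ℂ] Fock := fun m n => F m ∘ₗ F n - F n ∘ₗ F m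
  have hYE : ∀ m n k p, Y m n (E lam k p) = E lam k (Y m n p) := by
    intro m n k p
    change F m (F n _) - F n (F m _) = E lam k (F m (F n p) - F n (F m p))
    simp only [hF.F_E, map_add, map_sub, map_smul, hF.F_H]
    rw [show k + n + m = k + m + n by ring]
    abel
  have hYH : ∀ m n k p, Y m n (H lam k p) =
      H lam k (Y m n p) + (2 : ℂ) • (Y (k + m) n p + Y m (k + n) p) := by
    intro m n k p
    change F m (F n _) - F n (F m _) = H lam k (F m (F n p) - F n (F m p)) +
      (2 : ℂ) • ((F (k + m) (F n p) - F n (F (k + m) p)) + (F m (F (k + n) p) - F (k + n) (F m p)))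
    simp only [hF.F_H, map_add, map_sub, map_smul]
    module
  have hY1 : ∀ m n, Y m n 1 = 0 := by
    let W : Submodule ℂ Fock := Submodule.span ℂ {p | ∃ m n, p = Y m n 1}
    have hW : IsLowering lam W := by
      constructor
      · intro k hk p hp
        induction hp using Submodule.span_induction with
        | mem p hp =>
          obtain ⟨m, n, rfl⟩ := hp
          rw [← hYE]
          rcases hk.eq_or_lt with rfl | hk
          · have : E lam 0 1 = lam • 1 := (rep_isWhittaker lam).E_zero
            rw [this, map_smul]
            exact W.smul_mem _ (Submodule.subset_span ⟨m, n, rfl⟩)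
          · have : E lam k 1 = 0 := (rep_isWhittaker lam).E_pos k hk
            rw [this, map_zero]
            exact W.zero_mem
        | zero => rw [map_zero]; exact W.zero_mem
        | add p q _ _ hp hq => rw [map_add]; exact W.add_mem hp hq
        | smul r p _ hp => rw [map_smul]; exact W.smul_mem _ hp
      · intro k hk p hp
        induction hp using Submodule.span_induction with
        | mem p hp =>
          obtain ⟨m, n, rfl⟩ := hp
          have h1 := hYH m n k 1
          have h2 : H lam k 1 = 0 := (rep_isWhittaker lam).H_pos k hk
          rw [h2, map_zero, eq_comm, add_eq_zero_iff_eq_neg] at h1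
          rw [h1]
          exact W.neg_mem (W.smul_mem _ (W.add_mem (Submodule.subset_span ⟨_, _, rfl⟩)
            (Submodule.subset_span ⟨_, _, rfl⟩)))
        | zero => rw [map_zero]; exact W.zero_mem
        | add p q _ _ hp hq => rw [map_add]; exact W.add_mem hp hq
        | smul r p _ hp => rw [map_smul]; exact W.smul_mem _ hp
    have hW0 : ∀ p ∈ W, vac p = 0 := by
      intro p hp
      induction hp using Submodule.span_induction with
      | mem p hp =>
        obtain ⟨m, n, rfl⟩ := hp
        obtain ⟨xi, hxi, h1⟩ := hF.F_one
        change vac (F m (F n 1) - F n (F m 1)) = 0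
        rw [map_sub, hF.vac_F hlam, hF.vac_F hlam, h1, h1, theta_fvec hlam hxi,
          theta_fvec hlam hxi, add_comm n m]
        ring
      | zero => exact map_zero _
      | add p q _ _ hp hq => rw [map_add, hp, hq, add_zero]
      | smul r p _ hp => rw [map_smul, hp, smul_zero]
    have hbot : W = ⊥ := by
      by_contra h0
      have := hW0 _ (hW.one_mem hlam h0)
      rw [map_one] at this
      exact one_ne_zero this
    intro m n
    have : Y m n 1 ∈ W := Submodule.subset_span ⟨m, n, rfl⟩
    rwa [hbot, Submodule.mem_bot] at this
  have hY : ∀ p m n, Y m n p = 0 := by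
    let K : Submodule ℂ Fock := ⨅ m, ⨅ n, LinearMap.ker (Y m n)
    have hK : ∀ p, p ∈ K ↔ ∀ m n, Y m n p = 0 := by
      intro p; simp only [K, Submodule.mem_iInf, LinearMap.mem_ker]
    refine fun p => (hK p).1 (eq_top_of_stable lam (K := K) ((hK _).2 hY1) (fun i p hp => ?_)
      (fun j p hp => ?_) p)
    · rw [hK] at hp ⊢
      intro m n
      rw [hYE, hp, map_zero]
    · rw [hK] at hp ⊢
      intro m n
      rw [hYH, hp, hp, hp, map_zero, add_zero, smul_zero, add_zero]
  exact sub_eq_zero.1 (hY p m n)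

end Fock
end

noncomputable section

set_option linter.unusedSimpArgs false
set_option linter.unusedSectionVars false
set_option linter.unnecessarySeqFocus false

open scoped TensorProduct

namespace AffineSl2

open LieAlgebra LieModule.Cohomology

attribute [local instance 100] LieRing.ofAssociativeRing

/-! ### Brackets of the standard generators -/

theorem lie_e_f : ⁅e, f⁆ = h := by
  apply Subtype.ext
  ext i j
  fin_cases i <;> fin_cases j <;>
    simp [e, f, h, SpecialLinear.sl_bracket, LieRing.of_associative_ring_bracket, Matrix.mul_apply, Fin.sum_univ_two]

theorem lie_h_e : ⁅h, e⁆ = (2 : ℂ) • e := by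
  apply Subtype.ext
  ext i j
  fin_cases i <;> fin_cases j <;>
    simp [e, h, SpecialLinear.sl_bracket, LieRing.of_associative_ring_bracket, Matrix.mul_apply, Fin.sum_univ_two] <;> norm_num

theorem lie_h_f : ⁅h, f⁆ = (-2 : ℂ) • f := by
  apply Subtype.ext
  ext i j
  fin_cases i <;> fin_cases j <;>
    simp [f, h, SpecialLinear.sl_bracket, LieRing.of_associative_ring_bracket, Matrix.mul_apply, Fin.sum_univ_two] <;> norm_num

theorem form_e_f : form e f = 1 := by
  simp [form_apply, e, f, Matrix.trace_fin_two, Matrix.mul_apply, Fin.sum_univ_two]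

theorem form_e_e : form e e = 0 := by
  simp [form_apply, e, Matrix.trace_fin_two, Matrix.mul_apply, Fin.sum_univ_two]

theorem form_f_f : form f f = 0 := by
  simp [form_apply, f, Matrix.trace_fin_two, Matrix.mul_apply, Fin.sum_univ_two]

theorem form_h_h : form h h = 2 := by
  simp [form_apply, h, Matrix.trace_fin_two, Matrix.mul_apply, Fin.sum_univ_two]; norm_num

theorem form_h_e : form h e = 0 := by
  simp [form_apply, e, h, Matrix.trace_fin_two, Matrix.mul_apply, Fin.sum_univ_two]

theorem form_h_f : form h f = 0 := by
  simp [form_apply, f, h, Matrix.trace_fin_two, Matrix.mul_apply, Fin.sum_univ_two]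

theorem mode_smul (a : ℂ) (x : Sl2) (n : ℤ) : mode (a • x) n = a • mode x n := by
  simp only [mode, ← of_smul, TensorProduct.tmul_smul, Prod.smul_mk, smul_zero]

theorem um_smul (a : ℂ) (x : Sl2) (n : ℤ) : um (a • x) n = a • um x n := by
  rw [um, mode_smul, map_smul, um]

theorem um_zero (n : ℤ) : um 0 n = 0 := by
  simpa using um_smul 0 0 n

theorem um_e_mul_um_f (m n : ℤ) :
    um e m * um f n = um f n * um e m + um h (m + n) + (if m + n = 0 then (m : ℂ) else 0) • uc := by
  rw [um_mul_um, lie_e_f, form_e_f, mul_one]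

theorem um_h_mul_um_e (m n : ℤ) :
    um h m * um e n = um e n * um h m + (2 : ℂ) • um e (m + n) := by
  rw [um_mul_um, lie_h_e, form_h_e, um_smul, mul_zero, ite_self, zero_smul, add_zero]

theorem um_h_mul_um_f (m n : ℤ) :
    um h m * um f n = um f n * um h m - (2 : ℂ) • um f (m + n) := by
  rw [um_mul_um, lie_h_f, form_h_f, um_smul, mul_zero, ite_self, zero_smul, add_zero, neg_smul,
    sub_eq_add_neg]

theorem um_e_mul_um_e (m n : ℤ) : um e m * um e n = um e n * um e m := by
  rw [um_mul_um, lie_self, form_e_e, um_zero, mul_zero, ite_self, zero_smul, add_zero, add_zero]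

theorem um_f_mul_um_f (m n : ℤ) : um f m * um f n = um f n * um f m := by
  rw [um_mul_um, lie_self, form_f_f, um_zero, mul_zero, ite_self, zero_smul, add_zero, add_zero]

theorem um_h_mul_um_h (m n : ℤ) :
    um h m * um h n = um h n * um h m + (if m + n = 0 then (2 * m : ℂ) else 0) • uc := by
  rw [um_mul_um, lie_self, form_h_h, um_zero, add_zero, mul_comm (m : ℂ)]

/-! ### Generators of the enveloping algebra -/

/-- A generating set of the enveloping algebra. -/
def generators : Set U := Set.range (um e) ∪ Set.range (um f) ∪ {uc}

theorem um_h_eq (n : ℤ) :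
    um h n = um e n * um f 0 - um f 0 * um e n - (if n + 0 = 0 then (n : ℂ) else 0) • uc := by
  rw [um_e_mul_um_f n 0, add_zero]
  abel

/-- The `h(n)` need not be listed: they are commutators of `e(n)` and `f(0)` up to a multiple of
`c`. -/
theorem subalgebra_eq_top (S : Subalgebra ℂ U) (he : ∀ n, um e n ∈ S) (hf : ∀ n, um f n ∈ S)
    (hc : uc ∈ S) (u : U) : u ∈ S := by
  have hh : ∀ n, um h n ∈ S := fun n => by
    rw [um_h_eq]
    exact S.sub_mem (S.sub_mem (S.mul_mem (he _) (hf _)) (S.mul_mem (hf _) (he _)))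
      (S.smul_mem hc _)
  obtain ⟨t, rfl⟩ : ∃ t, UniversalEnvelopingAlgebra.mkAlgHom ℂ Affine t = u :=
    RingCon.mkₐ_surjective _ u
  induction t using TensorAlgebra.induction with
  | algebraMap r => rw [AlgHom.commutes]; exact S.algebraMap_mem r
  | add a b ha hb => rw [map_add]; exact S.add_mem ha hb
  | mul a b ha hb => rw [map_mul]; exact S.mul_mem ha hb
  | ι z =>
    change UniversalEnvelopingAlgebra.ι ℂ z ∈ S
    induction mem_span_modes z using Submodule.span_induction with
    | zero => rw [map_zero]; exact S.zero_mem
    | add a b _ _ hxa hxb => rw [map_add]; exact S.add_mem hxa hxb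
    | smul r a _ hxa => rw [map_smul]; exact S.smul_mem hxa r
    | mem a hmem =>
      rcases hmem with rfl | ⟨y, m, rfl⟩
      · exact hc
      · change um y m ∈ S
        rw [um_eq]
        exact S.add_mem (S.add_mem (S.smul_mem (he _) _) (S.smul_mem (hf _) _))
          (S.smul_mem (hh _) _)

theorem adjoin_generators : Algebra.adjoin ℂ generators = ⊤ := by
  rw [eq_top_iff]
  rintro u -
  exact subalgebra_eq_top _
    (fun n => Algebra.subset_adjoin (Or.inl (Or.inl ⟨n, rfl⟩)))
    (fun n => Algebra.subset_adjoin (Or.inl (Or.inr ⟨n, rfl⟩)))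
    (Algebra.subset_adjoin (Or.inr rfl)) u

/-- Words in countably many generators form a countable set; countable dimension is what Schur's
lemma over `ℂ` needs here. -/
theorem exists_countable_span_eq_top : ∃ S : Set U, S.Countable ∧ Submodule.span ℂ S = ⊤ := by
  have hc : generators.Countable :=
    ((Set.countable_range _).union (Set.countable_range _)).union (Set.countable_singleton _)
  refine ⟨Submonoid.closure generators, ?_, ?_⟩
  · have : Countable generators := hc
    rw [Submonoid.closure_eq_mrange, MonoidHom.coe_mrange]
    exact Set.countable_range _
  · rw [← Algebra.adjoin_eq_span, adjoin_generators, Algebra.top_toSubmodule]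

section Module

variable {M : Type*} [AddCommGroup M] [Module ℂ M] [Module U M] [IsScalarTower ℂ U M]

theorem smul_mem_of_stable {K : Submodule ℂ M} (he : ∀ n, ∀ v ∈ K, um e n • v ∈ K)
    (hf : ∀ n, ∀ v ∈ K, um f n • v ∈ K) (hc : ∀ v ∈ K, uc • v ∈ K) (u : U) {v : M} (hv : v ∈ K) :
    u • v ∈ K := by
  let S : Subalgebra ℂ U :=
    { carrier := {u | ∀ v ∈ K, u • v ∈ K}
      mul_mem' := fun {a b} ha hb v hv => by
        rw [mul_smul]; exact ha _ (hb _ hv)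
      add_mem' := fun {a b} ha hb v hv => by
        rw [add_smul]; exact K.add_mem (ha _ hv) (hb _ hv)
      algebraMap_mem' := fun r v hv => by
        rw [algebraMap_smul]; exact K.smul_mem _ hv }
  exact subalgebra_eq_top S he hf hc u v hv

/-! ### Centrality of `T(n)` -/

/-- Operators with the commutation relations of `e(n), f(n), h(n)` at level `-2` (without the
relations among the `b n` and among the `c n`), acting locally nilpotently for large `n`. -/
structure CriticalTriple (a b c : ℤ → M →ₗ[ℂ] M) : Prop where
  AB : ∀ m n v, a m (b n v) = b n (a m v) + c (m + n) v + (if m + n = 0 then (-2 * m : ℂ) else 0) • v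
  CA : ∀ m n v, c m (a n v) = a n (c m v) + (2 : ℂ) • a (m + n) v
  AA : ∀ m n v, a m (a n v) = a n (a m v)
  bdd : ∀ v, ∃ N : ℤ, ∀ n, N ≤ n → a n v = 0 ∧ b n v = 0 ∧ c n v = 0

/-- The `k`-th summand of `2 T(n)` for the operators `a`, `b`, `c`. -/
def sugawaraTerm (a b c : ℤ → M →ₗ[ℂ] M) (n k : ℤ) (v : M) : M :=
  (if k < 0 then a k (b (n - k) v) else b (n - k) (a k v)) +
  (if k < 0 then b k (a (n - k) v) else a (n - k) (b k v)) +
  (1 / 2 : ℂ) • (if k < 0 then c k (c (n - k) v) else c (n - k) (c k v))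

/-- The products `a j * c (s - j)`, in this order if `j < p` and in the other one otherwise. -/
def orderedTerm (a c : ℤ → M →ₗ[ℂ] M) (s p j : ℤ) (v : M) : M :=
  if j < p then a j (c (s - j) v) else c (s - j) (a j v)

namespace CriticalTriple

variable {a b c : ℤ → M →ₗ[ℂ] M} (H : CriticalTriple a b c)
include H

theorem finite_support_orderedTerm (s p : ℤ) (v : M) :
    (Function.support fun j => orderedTerm a c s p j v).Finite := by
  obtain ⟨N, hN⟩ := H.bdd v
  refine (Set.finite_Icc (min (s - N) p) (max N p)).subset fun j hj => ?_
  by_contra hj'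
  apply hj
  rw [Set.mem_Icc] at hj'
  change orderedTerm a c s p j v = 0
  rw [orderedTerm]
  split_ifs with hjp
  · rw [(hN (s - j) (by omega)).2.2, map_zero]
  · rw [(hN j (by omega)).1, map_zero]

/-- Moving the cut by one reverses the single product with `j = p`, at the cost of `[c (s-p), a p] =
2 a s`. -/
theorem finsum_orderedTerm_succ (s p : ℤ) (v : M) :
    ∑ᶠ j, orderedTerm a c s (p + 1) j v = ∑ᶠ j, orderedTerm a c s p j v - (2 : ℂ) • a s v := by
  have h1 : ∀ j, orderedTerm a c s (p + 1) j v =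
      orderedTerm a c s p j v - if j = p then (2 : ℂ) • a s v else 0 := by
    intro j
    rw [orderedTerm, orderedTerm]
    rcases lt_trichotomy j p with hj | rfl | hj
    · rw [if_pos (by omega), if_pos hj, if_neg (by omega), sub_zero]
    · rw [if_pos (by omega), if_neg (by omega), if_pos rfl, H.CA, sub_add_cancel]
      abel
    · rw [if_neg (by omega), if_neg (by omega), if_neg (by omega), sub_zero]
  simp_rw [h1]
  rw [finsum_sub_distrib (H.finite_support_orderedTerm s p v)
    ((Set.finite_singleton p).subset fun j hj => by
      by_contra hj'
      exact hj (if_neg hj'))]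
  congr 1
  rw [finsum_eq_single _ p fun j hj => if_neg hj, if_pos rfl]

theorem finsum_orderedTerm (s p : ℤ) (v : M) :
    ∑ᶠ j, orderedTerm a c s p j v = ∑ᶠ j, orderedTerm a c s 0 j v - (2 * p : ℂ) • a s v := by
  induction p using Int.induction_on with
  | zero => simp
  | succ i ih =>
    rw [H.finsum_orderedTerm_succ, ih]
    push_cast
    module
  | pred i ih =>
    have h1 := H.finsum_orderedTerm_succ s (-(i : ℤ) - 1) v
    rw [sub_add_cancel, ih] at h1
    rw [eq_comm, sub_eq_iff_eq_add] at h1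
    rw [h1]
    push_cast
    module

theorem finite_support_sugawaraTerm (n : ℤ) (v : M) :
    (Function.support fun k => sugawaraTerm a b c n k v).Finite := by
  obtain ⟨N, hN⟩ := H.bdd v
  refine (Set.finite_Icc (min (n - N) 0) (max N 0)).subset fun k hk => ?_
  by_contra hk'
  apply hk
  rw [Set.mem_Icc] at hk'
  change sugawaraTerm a b c n k v = 0
  rw [sugawaraTerm]
  split_ifs with h0
  · obtain ⟨h1, h2, h3⟩ := hN (n - k) (by omega)
    simp [h1, h2, h3]
  · obtain ⟨h1, h2, h3⟩ := hN k (by omega)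
    simp [h1, h2, h3]

/-- Bracketing with `a m` turns `b` into `c` and `c` into `-2 a`, so only products of one `a` with
one `c` remain. They are four reindexings of the same doubly infinite sum with different cuts,
besides two central terms. -/
theorem sugawaraTerm_comm (m n k : ℤ) (v : M) :
    a m (sugawaraTerm a b c n k v) - sugawaraTerm a b c n k (a m v) =
      orderedTerm a c (m + n) 0 k v + orderedTerm a c (m + n) (n + 1) (n - k) v -
      orderedTerm a c (m + n) m (m + k) v - orderedTerm a c (m + n) (m + n + 1) (m + n - k) v -
      (if k = m + n then (2 * m : ℂ) • a (m + n) v else 0) -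
      (if k = -m then (2 * m : ℂ) • a (m + n) v else 0) := by
  have hAC : ∀ i j (w : M), a i (c j w) = c j (a i w) - (2 : ℂ) • a (i + j) w := fun i j w => by
    rw [H.CA, add_comm j i]; abel
  have hc1 : (if m + (n - k) = 0 then (-2 * m : ℂ) else 0) =
      if k = m + n then (-2 * m : ℂ) else 0 := by
    congr 1; rw [eq_iff_iff]; constructor <;> intro <;> omega
  have hc2 : (if m + k = 0 then (-2 * m : ℂ) else 0) =
      if k = -m then (-2 * m : ℂ) else 0 := by
    congr 1; rw [eq_iff_iff]; constructor <;> intro <;> omega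
  have e1 : m + n - (n - k) = m + k := by ring
  have e2 : m + n - (m + k) = n - k := by ring
  have e3 : m + n - (m + n - k) = k := by ring
  have e4 : m + (n - k) = m + n - k := by ring
  simp only [sugawaraTerm, orderedTerm, e1, e2, e3]
  have z1 : (if k = m + n then (-2 * m : ℂ) else 0) • a k v =
      -if k = m + n then (2 * m : ℂ) • a (m + n) v else 0 := by
    split_ifs with hk
    · rw [hk]; module
    · simp
  have z2 : (if k = -m then (-2 * m : ℂ) else 0) • a (n - k) v =
      -if k = -m then (2 * m : ℂ) • a (m + n) v else 0 := by
    split_ifs with hk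
    · rw [hk, show n - -m = m + n by ring]; module
    · simp
  by_cases h0 : k < 0
  · rw [if_pos h0, if_pos h0, if_pos h0, if_pos h0, if_pos h0, if_pos h0, if_pos h0,
      if_neg (by omega), if_pos (by omega), if_neg (by omega)]
    simp only [map_add, map_smul]
    rw [H.AA m k, H.AB m (n - k) v, hc1, H.AB m k, hc2, H.AA m (n - k) v, hAC m k, hAC m (n - k) v]
    simp only [map_add, map_sub, map_smul, e4, z1, z2]
    rw [hAC (m + k) (n - k) v, show m + k + (n - k) = m + n by ring,
      H.CA k (m + n - k) v, show k + (m + n - k) = m + n by ring]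
    module
  · rw [if_neg h0, if_neg h0, if_neg h0, if_neg h0, if_neg h0, if_neg h0, if_neg h0,
      if_pos (by omega), if_neg (by omega), if_pos (by omega)]
    simp only [map_add, map_smul]
    rw [H.AB m (n - k), hc1, H.AA m k v, H.AA m (n - k), H.AB m k v, hc2, hAC m (n - k), hAC m k v]
    simp only [map_add, map_sub, map_smul, e4, z1, z2]
    rw [hAC (m + n - k) k v, show m + n - k + k = m + n by ring,
      H.CA (n - k) (m + k) v, show n - k + (m + k) = m + n by ring]
    module

/-- The operator `∑ sugawaraTerm` commutes with `a m`. -/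
theorem finsum_sugawaraTerm_comm (m n : ℤ) (v : M) :
    a m (∑ᶠ k, sugawaraTerm a b c n k v) = ∑ᶠ k, sugawaraTerm a b c n k (a m v) := by
  let P : (ℤ → M) → M → Prop := fun g x => g.support.Finite ∧ ∑ᶠ k, g k = x
  have hsub : ∀ {g₁ g₂ : ℤ → M} {x₁ x₂ : M}, P g₁ x₁ → P g₂ x₂ →
      P (fun k => g₁ k - g₂ k) (x₁ - x₂) := by
    rintro g₁ g₂ _ _ ⟨h1, rfl⟩ ⟨h2, rfl⟩
    exact ⟨(h1.union h2).subset (Function.support_sub g₁ g₂), finsum_sub_distrib h1 h2⟩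
  have hadd : ∀ {g₁ g₂ : ℤ → M} {x₁ x₂ : M}, P g₁ x₁ → P g₂ x₂ →
      P (fun k => g₁ k + g₂ k) (x₁ + x₂) := by
    rintro g₁ g₂ _ _ ⟨h1, rfl⟩ ⟨h2, rfl⟩
    exact ⟨(h1.union h2).subset (Function.support_add g₁ g₂), finsum_add_distrib h1 h2⟩
  have hone : ∀ (k₀ : ℤ) (x : M), P (fun k => if k = k₀ then x else 0) x := fun k₀ x =>
    ⟨(Set.finite_singleton k₀).subset fun j hj => by
      by_contra hj'
      exact hj (if_neg hj'), by rw [finsum_eq_single _ k₀ fun j hj => if_neg hj, if_pos rfl]⟩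
  have hord : ∀ (p : ℤ) (σ : ℤ ≃ ℤ), P (fun k => orderedTerm a c (m + n) p (σ k) v)
      (∑ᶠ j, orderedTerm a c (m + n) 0 j v - (2 * p : ℂ) • a (m + n) v) := fun p σ =>
    ⟨(H.finite_support_orderedTerm (m + n) p v).preimage σ.injective.injOn,
      (finsum_comp_equiv σ (f := fun j => orderedTerm a c (m + n) p j v)).trans
        (H.finsum_orderedTerm _ _ _)⟩
  have hL : P (fun k => a m (sugawaraTerm a b c n k v)) (a m (∑ᶠ k, sugawaraTerm a b c n k v)) :=
    ⟨(H.finite_support_sugawaraTerm n v).subset fun k hk hk' => hk (by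
      change a m _ = 0
      rw [show sugawaraTerm a b c n k v = 0 from hk', map_zero]), (map_finsum (a m) (H.finite_support_sugawaraTerm n v)).symm⟩
  have hR : P (fun k => sugawaraTerm a b c n k (a m v)) (∑ᶠ k, sugawaraTerm a b c n k (a m v)) :=
    ⟨H.finite_support_sugawaraTerm n (a m v), rfl⟩
  have h1 := (hsub hL hR).2
  have h2 := (hsub (hsub (hsub (hsub (hadd (hord 0 (Equiv.refl ℤ)) (hord (n + 1) (Equiv.subLeft n)))
    (hord m (Equiv.addLeft m))) (hord (m + n + 1) (Equiv.subLeft (m + n))))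
    (hone (m + n) ((2 * m : ℂ) • a (m + n) v))) (hone (-m) ((2 * m : ℂ) • a (m + n) v))).2
  have h3 := h1.symm.trans ((finsum_congr fun k => H.sugawaraTerm_comm m n k v).trans h2)
  -- Relative to the cut at `0`, the cuts `n+1`, `m`, `m+n+1` leave `-2(n+1) + 2m + 2(m+n+1) = 4m`
  -- times `a (m+n)`. The two central terms contribute `-4m`, so the total vanishes at level `-2`.
  rw [← sub_eq_zero, h3]
  push_cast
  module

end CriticalTriple

/-! ### The operators `T(n)` on a restricted module of critical level -/

theorem criticalTriple_efh (hM : IsRestricted M) (hc : ∀ v : M, uc • v = (-2 : ℂ) • v) :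
    CriticalTriple (fun n => Algebra.lsmul ℂ ℂ M (um e n)) (fun n => Algebra.lsmul ℂ ℂ M (um f n))
      (fun n => Algebra.lsmul ℂ ℂ M (um h n)) where
  AB m n v := by
    simp only [Algebra.lsmul_coe, ← mul_smul]
    rw [um_e_mul_um_f, add_smul, add_smul, smul_assoc, hc, smul_smul]
    congr 2
    split_ifs <;> ring
  CA m n v := by
    simp only [Algebra.lsmul_coe, ← mul_smul]
    rw [um_h_mul_um_e, add_smul, smul_assoc]
  AA m n v := by
    simp only [Algebra.lsmul_coe, ← mul_smul]
    rw [um_e_mul_um_e]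
  bdd v := by
    obtain ⟨A, hA⟩ := hM v e
    obtain ⟨B, hB⟩ := hM v f
    obtain ⟨C, hC⟩ := hM v h
    exact ⟨max A (max B C), fun n hn => ⟨hA n (by omega), hB n (by omega), hC n (by omega)⟩⟩

theorem criticalTriple_feh (hM : IsRestricted M) (hc : ∀ v : M, uc • v = (-2 : ℂ) • v) :
    CriticalTriple (fun n => Algebra.lsmul ℂ ℂ M (um f n)) (fun n => Algebra.lsmul ℂ ℂ M (um e n))
      (fun n => -Algebra.lsmul ℂ ℂ M (um h n)) where
  AB m n v := by
    have h1 := (criticalTriple_efh hM hc).AB n m v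
    simp only [LinearMap.neg_apply] at h1 ⊢
    rw [h1, add_comm n m]
    split_ifs with hmn
    · obtain rfl : n = -m := by omega
      push_cast
      module
    · module
  CA m n v := by
    simp only [Algebra.lsmul_coe, ← mul_smul, LinearMap.neg_apply, smul_neg]
    rw [um_h_mul_um_f, sub_smul, smul_assoc, neg_sub, sub_eq_neg_add]
  AA m n v := by
    simp only [Algebra.lsmul_coe, ← mul_smul]
    rw [um_f_mul_um_f]
  bdd v := by
    obtain ⟨N, hN⟩ := (criticalTriple_efh hM hc).bdd v
    refine ⟨N, fun n hn => ⟨(hN n hn).2.1, (hN n hn).1, ?_⟩⟩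
    rw [LinearMap.neg_apply, (hN n hn).2.2, neg_zero]

theorem tTerm_smul (n k : ℤ) (v : M) :
    tTerm n k • v = (1 / 2 : ℂ) • sugawaraTerm (fun n => Algebra.lsmul ℂ ℂ M (um e n))
      (fun n => Algebra.lsmul ℂ ℂ M (um f n)) (fun n => Algebra.lsmul ℂ ℂ M (um h n)) n k v := by
  simp only [tTerm, sugawaraTerm, normalOrdered, Algebra.lsmul_coe]
  split_ifs <;> simp only [smul_assoc, add_smul, mul_smul]

/-- The summand is symmetric under exchanging `e` and `f` and changing the sign of `h`; this
transfers commutation with `e(m)` to commutation with `f(m)`. -/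
theorem tTerm_smul' (n k : ℤ) (v : M) :
    tTerm n k • v = (1 / 2 : ℂ) • sugawaraTerm (fun n => Algebra.lsmul ℂ ℂ M (um f n))
      (fun n => Algebra.lsmul ℂ ℂ M (um e n)) (fun n => -Algebra.lsmul ℂ ℂ M (um h n)) n k v := by
  simp only [tTerm_smul, sugawaraTerm, LinearMap.neg_apply, map_neg, neg_neg]
  split_ifs <;> module

/-- `T(n)` as a linear operator. -/
def tLin (hM : IsRestricted M) (n : ℤ) : M →ₗ[ℂ] M where
  toFun v := tMode n v
  map_add' v w := by
    simp only [tMode, smul_add]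
    exact finsum_add_distrib (finite_support_tTerm hM n v) (finite_support_tTerm hM n w)
  map_smul' r v := by
    simp only [tMode, RingHom.id_apply, smul_finsum' r (finite_support_tTerm hM n v)]
    exact finsum_congr fun k => smul_comm _ _ _

theorem smul_tMode_of_eq {a b c : ℤ → M →ₗ[ℂ] M} (H : CriticalTriple a b c)
    (ht : ∀ n k v, tTerm n k • v = (1 / 2 : ℂ) • sugawaraTerm a b c n k v) (m n : ℤ) (v : M) :
    a m (tMode n v) = tMode n (a m v) := by
  simp only [tMode, ht]
  rw [← smul_finsum' _ (H.finite_support_sugawaraTerm n v), map_smul,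
    H.finsum_sugawaraTerm_comm, ← smul_finsum' _ (H.finite_support_sugawaraTerm n (a m v))]

theorem smul_tMode (hM : IsRestricted M) (hc : ∀ v : M, uc • v = (-2 : ℂ) • v) (n : ℤ) (u : U)
    (v : M) : u • tMode n v = tMode n (u • v) := by
  let S : Subalgebra ℂ U :=
    (Subalgebra.centralizer ℂ {tLin hM n}).comap (Algebra.lsmul ℂ ℂ M)
  have hS : ∀ x : U, x ∈ S ↔ ∀ v : M, x • tMode n v = tMode n (x • v) := fun x => by
    rw [Subalgebra.mem_comap, Subalgebra.mem_centralizer_iff]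
    simp only [Set.mem_singleton_iff, forall_eq]
    rw [LinearMap.ext_iff]
    exact forall_congr' fun v => eq_comm
  refine (hS u).1 (subalgebra_eq_top S (fun m => (hS _).2 fun v => ?_)
    (fun m => (hS _).2 fun v => ?_) ((hS _).2 fun v => ?_) u) v
  · exact smul_tMode_of_eq (criticalTriple_efh hM hc) tTerm_smul m n v
  · exact smul_tMode_of_eq (criticalTriple_feh hM hc) tTerm_smul' m n v
  · rw [hc, hc]
    exact ((tLin hM n).map_smul _ _).symm

/-- `T(n)` as an endomorphism of a restricted module of critical level. -/
def tEnd (hM : IsRestricted M) (hc : ∀ v : M, uc • v = (-2 : ℂ) • v) (n : ℤ) : M →ₗ[U] M where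
  toFun v := tMode n v
  map_add' v w := (tLin hM n).map_add v w
  map_smul' u v := (smul_tMode hM hc n u v).symm

end Module
end AffineSl2
end

noncomputable section

set_option linter.unusedSectionVars false

namespace AffineSl2

/-! ### Whittaker vectors: the leading term of `T(n) w`, and local nilpotency. -/

section Whittaker

variable {M : Type*} [AddCommGroup M] [Module ℂ M] [Module U M] [IsScalarTower ℂ U M]

/-- A vector killed by `e(n)`, `h(n)`, `f(n+1)` for `n > 0` on which `e(0)`, `f(1)` act by the
scalars `lam`, `mu`. -/
structure IsWhittakerVector (lam mu : ℂ) (w : M) : Prop where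
  e_pos : ∀ n, 0 < n → um e n • w = 0
  e_zero : um e 0 • w = lam • w
  h_pos : ∀ n, 0 < n → um h n • w = 0
  f_pos : ∀ n, 1 < n → um f n • w = 0
  f_one : um f 1 • w = mu • w

/-- The eigenvalue of `e(0)` produces `lam f(n) w` twice, at `k = 0` from `:ef:` and at `k = n` from
`:fe:`, each halved by the prefactor of `T(n)`. The subspace `K` is left free, to serve both for
generation and for vacuum coefficients. -/
theorem IsWhittakerVector.tTerm_sub_mem {lam mu : ℂ} {w : M} (hw : IsWhittakerVector lam mu w)
    {n : ℤ} (hn : n ≤ 0) (K : Submodule ℂ M)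
    (hef : ∀ k j, k < 0 → n < j → um e k • um f j • w ∈ K)
    (hhh : ∀ k j, k ≤ 0 → j ≤ 0 → um h k • um h j • w ∈ K) (hh : ∀ k ≤ 0, um h k • w ∈ K)
    (k : ℤ) :
    tTerm n k • w - ((if k = 0 then (lam / 2) • um f n • w else 0) +
      if k = n then (lam / 2) • um f n • w else 0) ∈ K := by
  have h1 : (if k < 0 then um e k • um f (n - k) • w else um f (n - k) • um e k • w) -
      (if k = 0 then lam • um f n • w else 0) ∈ K := by
    rcases lt_trichotomy k 0 with hk | rfl | hk
    · rw [if_pos hk, if_neg hk.ne, sub_zero]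
      exact hef _ _ hk (by omega)
    · rw [if_neg (by omega), if_pos rfl, hw.e_zero, sub_zero, smul_comm, sub_self]
      exact K.zero_mem
    · rw [if_neg (by omega), if_neg hk.ne', hw.e_pos k hk, smul_zero, sub_zero]
      exact K.zero_mem
  have h2 : (if k < 0 then um f k • um e (n - k) • w else um e (n - k) • um f k • w) -
      (if k = n then lam • um f n • w else 0) ∈ K := by
    split_ifs with hk hkn hkn
    · rw [hkn, sub_self, hw.e_zero, smul_comm, sub_self]
      exact K.zero_mem
    · rcases lt_or_gt_of_ne hkn with hkn | hkn
      · rw [hw.e_pos _ (by omega), smul_zero, sub_zero]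
        exact K.zero_mem
      · have h3 : um f k • um e (n - k) • w = um e (n - k) • um f k • w - um h n • w := by
          rw [← mul_smul, ← mul_smul, um_e_mul_um_f, if_neg (by omega), zero_smul, add_zero,
            add_smul, sub_add_cancel, add_sub_cancel_right]
        rw [sub_zero, h3]
        exact K.sub_mem (hef _ _ (by omega) hkn) (hh _ hn)
    · obtain rfl : n = 0 := by omega
      subst hkn
      rw [← mul_smul, sub_self, um_e_mul_um_f]
      simp only [Int.cast_zero, ite_self, zero_smul, add_zero]
      rw [add_smul, mul_smul, hw.e_zero, smul_comm, add_sub_cancel_left]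
      exact hh _ le_rfl
    · rw [sub_zero]
      exact hef _ _ (by omega) (by omega)
  have h3 : (if k < 0 then um h k • um h (n - k) • w else um h (n - k) • um h k • w) ∈ K := by
    split_ifs with hk
    · rcases lt_or_ge 0 (n - k) with hnk | hnk
      · rw [hw.h_pos _ hnk, smul_zero]
        exact K.zero_mem
      · exact hhh _ _ hk.le hnk
    · rcases lt_or_ge 0 k with hk0 | hk0
      · rw [hw.h_pos _ hk0, smul_zero]
        exact K.zero_mem
      · exact hhh _ _ (by omega) hk0
  have h4 := K.smul_mem (1 / 2 : ℂ) (K.add_mem (K.add_mem h1 h2) (K.smul_mem (1 / 2 : ℂ) h3))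
  rw [tTerm_smul]
  simp only [sugawaraTerm, Algebra.lsmul_coe]
  convert h4 using 1
  generalize (if k < 0 then um e k • um f (n - k) • w else um f (n - k) • um e k • w) = A
  generalize (if k < 0 then um f k • um e (n - k) • w else um e (n - k) • um f k • w) = B
  generalize (if k < 0 then um h k • um h (n - k) • w else um h (n - k) • um h k • w) = C
  generalize um f n • w = D
  split_ifs <;> module

theorem IsWhittakerVector.tMode_sub_mem {lam mu : ℂ} {w : M} (hw : IsWhittakerVector lam mu w)
    (hM : IsRestricted M) {n : ℤ} (hn : n ≤ 0) (K : Submodule ℂ M)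
    (hef : ∀ k j, k < 0 → n < j → um e k • um f j • w ∈ K)
    (hhh : ∀ k j, k ≤ 0 → j ≤ 0 → um h k • um h j • w ∈ K) (hh : ∀ k ≤ 0, um h k • w ∈ K) :
    tMode n w - lam • um f n • w ∈ K := by
  have hs : ∀ (k₀ : ℤ) (x : M), (Function.support fun k => if k = k₀ then x else 0).Finite :=
    fun k₀ x => (Set.finite_singleton k₀).subset fun j hj => by
      by_contra hj'
      exact hj (if_neg hj')
  have hsum : ∀ (k₀ : ℤ) (x : M), ∑ᶠ k, (if k = k₀ then x else 0) = x := fun k₀ x => by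
    rw [finsum_eq_single _ k₀ fun j hj => if_neg hj, if_pos rfl]
  have h1 : tMode n w - lam • um f n • w = ∑ᶠ k, (tTerm n k • w -
      ((if k = 0 then (lam / 2) • um f n • w else 0) +
        if k = n then (lam / 2) • um f n • w else 0)) := by
    rw [finsum_sub_distrib (finite_support_tTerm hM n w)
      (((hs _ _).union (hs _ _)).subset (Function.support_add _ _)),
      finsum_add_distrib (hs _ _) (hs _ _), hsum, hsum, tMode]
    generalize um f n • w = D
    module
  rw [h1]
  exact finsum_induction (· ∈ K) K.zero_mem (fun _ _ => K.add_mem)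
    (hw.tTerm_sub_mem hn K hef hhh hh)

/-! ### Local nilpotency of `e(0) - lam` and `f(1) - mu` -/

/-- Induction on the exponent from `(X - a) D v = D (X - a) v + [X, D] v`, since membership may be
tested after one application of `X - a`. -/
theorem map_mem_maxGenEigenspace (X D : Module.End ℂ M) (a : ℂ)
    (hXD : ∀ v ∈ X.maxGenEigenspace a, X (D v) - D (X v) ∈ X.maxGenEigenspace a) :
    ∀ v ∈ X.maxGenEigenspace a, D v ∈ X.maxGenEigenspace a := by
  have hmem : ∀ v, (X - algebraMap ℂ _ a) v ∈ X.maxGenEigenspace a → v ∈ X.maxGenEigenspace a := by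
    intro v hv
    rw [Module.End.mem_maxGenEigenspace] at hv ⊢
    obtain ⟨k, hk⟩ := hv
    exact ⟨k + 1, by rw [pow_succ]; exact hk⟩
  have key : ∀ (k : ℕ) (v : M), ((X - algebraMap ℂ (Module.End ℂ M) a) ^ k) v = 0 →
      D v ∈ X.maxGenEigenspace a := by
    intro k
    induction k with
    | zero =>
      intro v hv
      rw [pow_zero, Module.End.one_apply] at hv
      rw [hv, map_zero]
      exact Submodule.zero_mem _
    | succ k ih =>
      intro v hv
      have hv' : v ∈ X.maxGenEigenspace a :=
        (Module.End.mem_maxGenEigenspace _ _ _).2 ⟨k + 1, hv⟩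
      rw [pow_succ, Module.End.mul_apply] at hv
      have h1 := Submodule.add_mem _ (hXD v hv') (ih _ hv)
      apply hmem
      convert h1 using 1
      simp only [LinearMap.sub_apply, Module.algebraMap_end_apply, map_sub, map_smul]
      abel
  intro v hv
  obtain ⟨k, hk⟩ := (Module.End.mem_maxGenEigenspace _ _ _).1 hv
  exact key k v hk

theorem mem_maxGenEigenspace_of_eq {X : Module.End ℂ M} {a : ℂ} {v : M} (h1 : X v = a • v) :
    v ∈ X.maxGenEigenspace a :=
  (Module.End.mem_maxGenEigenspace _ _ _).2 ⟨1, by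
    simp [h1]⟩

theorem eq_of_mem_maxGenEigenspace {X : Module.End ℂ M} {a b : ℂ} {v : M} (h0 : v ≠ 0)
    (h1 : X v = b • v) (h2 : v ∈ X.maxGenEigenspace a) : b = a := by
  obtain ⟨k, hk⟩ := (Module.End.mem_maxGenEigenspace _ _ _).1 h2
  have h3 : ∀ k : ℕ, ((X - algebraMap ℂ (Module.End ℂ M) a) ^ k) v = (b - a) ^ k • v := by
    intro k
    induction k with
    | zero => simp
    | succ k ih =>
      rw [pow_succ', Module.End.mul_apply, ih, map_smul, LinearMap.sub_apply, h1,
        Module.algebraMap_end_apply, ← sub_smul, smul_smul, pow_succ]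
  rw [show ((X - a • (1 : Module.End ℂ M)) ^ k) v = _ from h3 k] at hk
  rcases smul_eq_zero.1 hk with hk | hk
  · by_contra hba
    exact pow_ne_zero k (sub_ne_zero.2 hba) hk
  · exact absurd hk h0

/-- Bracketing with `e(0)` kills the modes of `e`, takes those of `h` to `e` and those of `f` to
`h`. So the generalized eigenspace is stable under `e`, then `h`, then `f`, and it contains the
generator. -/
theorem maxGenEigenspace_e (hc : ∀ v : M, uc • v = (-2 : ℂ) • v) {a : ℂ} {w : M}
    (hgen : ∀ v : M, ∃ u : U, v = u • w) (hw : um e 0 • w = a • w) (v : M) :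
    v ∈ (Algebra.lsmul ℂ ℂ M (um e 0)).maxGenEigenspace a := by
  set S := (Algebra.lsmul ℂ ℂ M (um e 0)).maxGenEigenspace a with hS
  have he : ∀ n, ∀ v ∈ S, um e n • v ∈ S := fun n =>
    map_mem_maxGenEigenspace _ (Algebra.lsmul ℂ ℂ M (um e n)) a fun v _ => by
      simp only [Algebra.lsmul_coe, ← mul_smul]
      rw [um_e_mul_um_e, sub_self]
      exact Submodule.zero_mem _
  have hh : ∀ n, ∀ v ∈ S, um h n • v ∈ S := fun n =>
    map_mem_maxGenEigenspace _ (Algebra.lsmul ℂ ℂ M (um h n)) a fun v hv => by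
      simp only [Algebra.lsmul_coe, ← mul_smul]
      rw [um_h_mul_um_e, add_smul, smul_assoc, ← sub_sub, sub_self, zero_sub]
      exact Submodule.neg_mem _ (Submodule.smul_mem _ _ (he _ _ hv))
  have hf : ∀ n, ∀ v ∈ S, um f n • v ∈ S := fun n =>
    map_mem_maxGenEigenspace _ (Algebra.lsmul ℂ ℂ M (um f n)) a fun v hv => by
      simp only [Algebra.lsmul_coe, ← mul_smul]
      rw [um_e_mul_um_f]
      simp only [Int.cast_zero, ite_self, zero_smul, add_zero]
      rw [add_smul, add_sub_cancel_left]
      exact hh _ _ hv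
  obtain ⟨u, rfl⟩ := hgen v
  exact smul_mem_of_stable he hf (fun v hv => by rw [hc]; exact Submodule.smul_mem _ _ hv) u
    (mem_maxGenEigenspace_of_eq hw)

theorem maxGenEigenspace_f (hc : ∀ v : M, uc • v = (-2 : ℂ) • v) {a : ℂ} {w : M}
    (hgen : ∀ v : M, ∃ u : U, v = u • w) (hw : um f 1 • w = a • w) (v : M) :
    v ∈ (Algebra.lsmul ℂ ℂ M (um f 1)).maxGenEigenspace a := by
  set S := (Algebra.lsmul ℂ ℂ M (um f 1)).maxGenEigenspace a with hS
  have hf : ∀ n, ∀ v ∈ S, um f n • v ∈ S := fun n =>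
    map_mem_maxGenEigenspace _ (Algebra.lsmul ℂ ℂ M (um f n)) a fun v _ => by
      simp only [Algebra.lsmul_coe, ← mul_smul]
      rw [um_f_mul_um_f, sub_self]
      exact Submodule.zero_mem _
  have hh : ∀ n, ∀ v ∈ S, um h n • v ∈ S := fun n =>
    map_mem_maxGenEigenspace _ (Algebra.lsmul ℂ ℂ M (um h n)) a fun v hv => by
      simp only [Algebra.lsmul_coe, ← mul_smul]
      rw [um_h_mul_um_f, sub_smul, smul_assoc, sub_sub_cancel]
      exact Submodule.smul_mem _ _ (hf _ _ hv)
  have he : ∀ n, ∀ v ∈ S, um e n • v ∈ S := fun n =>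
    map_mem_maxGenEigenspace _ (Algebra.lsmul ℂ ℂ M (um e n)) a fun v hv => by
      simp only [Algebra.lsmul_coe, ← mul_smul]
      rw [um_e_mul_um_f, add_smul, add_smul, smul_assoc, hc, add_assoc, ← sub_sub, sub_self,
        zero_sub]
      exact Submodule.neg_mem _ (Submodule.add_mem _ (hh _ _ hv)
        (Submodule.smul_mem _ _ (Submodule.smul_mem _ _ hv)))
  obtain ⟨u, rfl⟩ := hgen v
  exact smul_mem_of_stable he hf (fun v hv => by rw [hc]; exact Submodule.smul_mem _ _ hv) u
    (mem_maxGenEigenspace_of_eq hw)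

end Whittaker

end AffineSl2

/-! ### Schur's lemma in countable dimension -/

section Schur

open Polynomial Cardinal

variable {V : Type*} [AddCommGroup V] [Module ℂ V]

theorem aeval_injective_of_forall {θ : Module.End ℂ V}
    (hinj : ∀ a : ℂ, Function.Injective (θ - algebraMap ℂ (Module.End ℂ V) a)) {q : ℂ[X]}
    (hq : q ≠ 0) : Function.Injective (aeval θ q) := by
  have h1 := (IsAlgClosed.splits q).eq_prod_roots
  have h2 : ∀ s : Multiset ℂ, Function.Injective (aeval θ (s.map fun a => X - C a).prod) := by
    intro s
    induction s using Multiset.induction_on with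
    | empty =>
      rw [Multiset.map_zero, Multiset.prod_zero, map_one]
      exact Function.injective_id
    | cons a s ih =>
      rw [Multiset.map_cons, Multiset.prod_cons, map_mul]
      have h3 : aeval θ (X - C a) = θ - algebraMap ℂ (Module.End ℂ V) a := by simp
      rw [h3]
      exact (hinj a).comp ih
  rw [h1, map_mul, aeval_C]
  refine Function.Injective.comp (g := algebraMap ℂ (Module.End ℂ V) q.leadingCoeff) ?_ (h2 _)
  intro v w hvw
  exact smul_right_injective V (leadingCoeff_ne_zero.2 hq) hvw

/-- Clearing denominators in a relation among the vectors `(θ - b)⁻¹ w` gives `q(θ) w = 0`. A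
nonzero coefficient at `a` forces `q(a) ≠ 0`, contradicting the injectivity of `q(θ)` for `q ≠ 0`.
-/
theorem linearIndependent_of_resolvent {θ : Module.End ℂ V}
    (hinj : ∀ a : ℂ, Function.Injective (θ - algebraMap ℂ (Module.End ℂ V) a)) {w : V}
    (hw : w ≠ 0) (r : ℂ → V) (hr : ∀ a, (θ - algebraMap ℂ (Module.End ℂ V) a) (r a) = w) :
    LinearIndependent ℂ r := by
  classical
  rw [linearIndependent_iff']
  intro s g hg a ha
  have h1 : ∀ b ∈ s, aeval θ (∏ x ∈ s.erase b, (X - C x)) w =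
      aeval θ (∏ x ∈ s, (X - C x)) (r b) := by
    intro b hb
    rw [← Finset.prod_erase_mul s _ hb, map_mul, Module.End.mul_apply]
    congr 1
    rw [← hr b]
    simp
  have h2 : aeval θ (∑ b ∈ s, C (g b) * ∏ x ∈ s.erase b, (X - C x)) w = 0 := by
    rw [map_sum, LinearMap.sum_apply]
    have h3 : ∀ b ∈ s, aeval θ (C (g b) * ∏ x ∈ s.erase b, (X - C x)) w =
        aeval θ (∏ x ∈ s, (X - C x)) (g b • r b) := by
      intro b hb
      rw [map_mul, aeval_C, Module.End.mul_apply, h1 b hb, Module.algebraMap_end_apply, map_smul]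
    rw [Finset.sum_congr rfl h3, ← map_sum, hg, map_zero]
  by_contra hga
  refine hw (aeval_injective_of_forall hinj
    (q := ∑ b ∈ s, C (g b) * ∏ x ∈ s.erase b, (X - C x)) ?_ (h2.trans (map_zero _).symm))
  intro h0
  have h4 := congrArg (eval a) h0
  rw [eval_finsetSum, eval_zero, Finset.sum_eq_single a] at h4
  · rw [eval_mul, eval_C, eval_prod] at h4
    refine (mul_ne_zero hga (Finset.prod_ne_zero_iff.2 fun x hx => ?_)) h4
    rw [eval_sub, eval_X, eval_C]
    exact sub_ne_zero.2 (Finset.ne_of_mem_erase hx).symm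
  · intro b _ hba
    rw [eval_mul, eval_prod, Finset.prod_eq_zero (Finset.mem_erase.2 ⟨hba.symm, ha⟩), mul_zero]
    simp
  · exact fun h => absurd ha h

/-- Schur's lemma for simple modules of countable dimension. -/
theorem exists_eq_smul_of_isSimpleModule {A : Type*} [Ring A] [Algebra ℂ A] [Module A V]
    [IsScalarTower ℂ A V] [IsSimpleModule A V] {S : Set V} (hS : S.Countable)
    (hspan : Submodule.span ℂ S = ⊤) (θ : V →ₗ[A] V) : ∃ a : ℂ, ∀ v, θ v = a • v := by
  by_contra! hne
  let D : ℂ → (V →ₗ[A] V) := fun a => θ - a • LinearMap.id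
  have hD : ∀ a, Function.Bijective (D a) := fun a =>
    (LinearMap.bijective_or_eq_zero (D a)).resolve_right fun h0 => by
      obtain ⟨v, hv⟩ := hne a
      exact hv (sub_eq_zero.1 (LinearMap.congr_fun h0 v))
  have : Nontrivial V := IsSimpleModule.nontrivial A V
  obtain ⟨w, hw⟩ := exists_ne (0 : V)
  -- If `θ` is no scalar, every `θ - a` is invertible, and the resolvent vectors form a family of
  -- the size of the continuum in a space of countable dimension.
  choose r hr using fun a => (hD a).2 w
  have h1 := linearIndependent_of_resolvent (θ := θ.restrictScalars ℂ)
    (fun a => (hD a).1) hw r hr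
  have h2 := h1.cardinal_lift_le_rank
  have h3 : Module.rank ℂ V ≤ ℵ₀ := by
    rw [← rank_top, ← hspan]
    exact (rank_span_le S).trans (le_aleph0_iff_set_countable.2 hS)
  have h4 := h2.trans (lift_le_aleph0.2 h3)
  rw [lift_le_aleph0, Cardinal.mk_complex] at h4
  exact absurd aleph0_lt_continuum (not_lt.2 h4)

end Schur
end

noncomputable section

open scoped TensorProduct

namespace AffineSl2

open LieAlgebra LieModule.Cohomology

attribute [local instance 100] LieRing.ofAssociativeRing

/-! ### Representations of level `-2` from operators -/

/-- Operators satisfying the relations of `e(n), f(n), h(n)` at level `-2`. -/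
structure CriticalOperators {P : Type*} [AddCommGroup P] [Module ℂ P]
    (E F H : ℤ → P →ₗ[ℂ] P) : Prop where
  EE : ∀ m n v, E m (E n v) = E n (E m v)
  FF : ∀ m n v, F m (F n v) = F n (F m v)
  EF : ∀ m n v, E m (F n v) = F n (E m v) + H (m + n) v +
    (if m + n = 0 then (-2 * m : ℂ) else 0) • v
  HE : ∀ m n v, H m (E n v) = E n (H m v) + (2 : ℂ) • E (m + n) v
  HF : ∀ m n v, H m (F n v) = F n (H m v) - (2 : ℂ) • F (m + n) v
  HH : ∀ m n v, H m (H n v) = H n (H m v) + (if m + n = 0 then (-4 * m : ℂ) else 0) • v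

section

variable {P : Type*} [AddCommGroup P] [Module ℂ P] (E F H : ℤ → P →ₗ[ℂ] P)

/-- The linear map `x ↦ x(n)` given by operators. -/
def modeMap (n : ℤ) : Sl2 →ₗ[ℂ] Module.End ℂ P where
  toFun x := x.1 0 1 • E n + x.1 1 0 • F n + x.1 0 0 • H n
  map_add' x y := by
    change (x.1 0 1 + y.1 0 1) • E n + (x.1 1 0 + y.1 1 0) • F n + (x.1 0 0 + y.1 0 0) • H n = _
    module
  map_smul' r x := by
    change (r * x.1 0 1) • E n + (r * x.1 1 0) • F n + (r * x.1 0 0) • H n = r • _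
    module

/-- The linear map on the affine Lie algebra given by operators. -/
def affineMap : Affine →ₗ[ℂ] Module.End ℂ P where
  toFun z := Finsupp.lsum ℂ (modeMap E F H) (LoopAlgebra.toFinsupp ℂ ℤ Sl2 ((ofProd cocycle).symm z).1) +
    (TrivialLieModule.equiv ℂ Loop ℂ ((ofProd cocycle).symm z).2) • ((-2 : ℂ) • (1 : Module.End ℂ P))
  map_add' x y := by
    simp only [of_symm_add, Prod.fst_add, Prod.snd_add, map_add, add_smul]
    abel
  map_smul' r x := by
    simp only [of_symm_smul, Prod.smul_fst, Prod.smul_snd, map_smul, RingHom.id_apply, smul_add,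
      smul_eq_mul, mul_smul]

theorem affineMap_mode (x : Sl2) (n : ℤ) :
    affineMap E F H (mode x n) = x.1 0 1 • E n + x.1 1 0 • F n + x.1 0 0 • H n := by
  change Finsupp.lsum ℂ (modeMap E F H)
    (LoopAlgebra.toFinsupp ℂ ℤ Sl2 (AddMonoidAlgebra.single n 1 ⊗ₜ[ℂ] x)) +
    (TrivialLieModule.equiv ℂ Loop ℂ 0) • ((-2 : ℂ) • (1 : Module.End ℂ P)) = _
  rw [LoopAlgebra.toFinsupp_single_tmul, Finsupp.lsum_single, map_zero, zero_smul, add_zero]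
  rfl

theorem affineMap_central : affineMap E F H central = (-2 : ℂ) • (1 : Module.End ℂ P) := by
  change Finsupp.lsum ℂ (modeMap E F H) (LoopAlgebra.toFinsupp ℂ ℤ Sl2 0) +
    (TrivialLieModule.equiv ℂ Loop ℂ ((TrivialLieModule.equiv ℂ Loop ℂ).symm 1)) •
      ((-2 : ℂ) • (1 : Module.End ℂ P)) = _
  rw [map_zero, map_zero, zero_add, LinearEquiv.apply_symm_apply, one_smul]

variable {E F H} (R : CriticalOperators E F H)
include R

theorem CriticalOperators.affineMap_lie_mode (x y : Sl2) (n m : ℤ) :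
    affineMap E F H ⁅mode x n, mode y m⁆ =
      affineMap E F H (mode x n) * affineMap E F H (mode y m) -
        affineMap E F H (mode y m) * affineMap E F H (mode x n) := by
  have tr : ∀ z : Sl2, z.1 1 1 = -z.1 0 0 := fun z => by
    have h1 : Matrix.trace z.1 = 0 := z.2
    rw [Matrix.trace_fin_two] at h1
    linear_combination h1
  have b01 : (⁅x, y⁆ : Sl2).1 0 1 = 2 * (x.1 0 0 * y.1 0 1 - x.1 0 1 * y.1 0 0) := by
    simp only [SpecialLinear.sl_bracket, Matrix.sub_apply, Matrix.mul_apply, Fin.sum_univ_two, tr]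
    ring
  have b10 : (⁅x, y⁆ : Sl2).1 1 0 = 2 * (x.1 1 0 * y.1 0 0 - x.1 0 0 * y.1 1 0) := by
    simp only [SpecialLinear.sl_bracket, Matrix.sub_apply, Matrix.mul_apply, Fin.sum_univ_two, tr]
    ring
  have b00 : (⁅x, y⁆ : Sl2).1 0 0 = x.1 0 1 * y.1 1 0 - x.1 1 0 * y.1 0 1 := by
    simp only [SpecialLinear.sl_bracket, Matrix.sub_apply, Matrix.mul_apply, Fin.sum_univ_two]
    ring
  have bf : form x y = 2 * x.1 0 0 * y.1 0 0 + x.1 0 1 * y.1 1 0 + x.1 1 0 * y.1 0 1 := by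
    simp only [form_apply, Matrix.trace_fin_two, Matrix.mul_apply, Fin.sum_univ_two, tr]
    ring
  rw [mode_bracket, map_add, map_smul, affineMap_central, affineMap_mode, affineMap_mode,
    affineMap_mode, b01, b10, b00, bf]
  generalize x.1 0 1 = x1, x.1 1 0 = x2, x.1 0 0 = x3, y.1 0 1 = y1, y.1 1 0 = y2, y.1 0 0 = y3
  refine LinearMap.ext fun v => ?_
  simp only [LinearMap.add_apply, LinearMap.sub_apply, LinearMap.smul_apply, Module.End.mul_apply,
    Module.End.one_apply, map_add, map_smul]
  rw [R.EE n m v, R.EF n m v, R.FF n m v, R.HE n m v, R.HF n m v, R.HH n m v, R.EF m n v,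
    R.HE m n v, R.HF m n v, add_comm m n]
  split_ifs with hnm
  · obtain rfl : m = -n := by omega
    push_cast
    module
  · module

/-- The representation of the affine Lie algebra given by operators. -/
def CriticalOperators.lieHom : Affine →ₗ⁅ℂ⁆ Module.End ℂ P :=
  { affineMap E F H with
    map_lie' := by
      intro z z'
      change affineMap E F H ⁅z, z'⁆ = ⁅affineMap E F H z, affineMap E F H z'⁆
      rw [LieRing.of_associative_ring_bracket]
      induction mem_span_modes z using Submodule.span_induction with
      | zero => simp
      | add a b _ _ ha hb => rw [add_lie, map_add, ha, hb, map_add, add_mul, mul_add]; abel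
      | smul r a _ ha => 
        rw [smul_lie, map_smul, ha, map_smul, smul_mul_assoc, mul_smul_comm, smul_sub]
      | mem a hmem =>
        rcases hmem with rfl | ⟨x, n, rfl⟩
        · rw [central_bracket, map_zero, affineMap_central, smul_mul_assoc, mul_smul_comm, one_mul,
            mul_one, sub_self]
        · induction mem_span_modes z' using Submodule.span_induction with
          | zero => simp
          | add a b _ _ ha hb => rw [lie_add, map_add, ha, hb, map_add, add_mul, mul_add]; abel
          | smul r a _ ha => 
            rw [lie_smul, map_smul, ha, map_smul, smul_mul_assoc, mul_smul_comm, smul_sub]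
          | mem a hmem =>
            rcases hmem with rfl | ⟨y, m, rfl⟩
            · rw [← lie_skew, central_bracket, neg_zero, map_zero, affineMap_central,
                smul_mul_assoc, mul_smul_comm, one_mul, mul_one, sub_self]
            · exact R.affineMap_lie_mode x y n m }

theorem CriticalOperators.exists_algHom : ∃ π : U →ₐ[ℂ] Module.End ℂ P,
    (∀ n, π (um e n) = E n) ∧ (∀ n, π (um f n) = F n) ∧ (∀ n, π (um h n) = H n) ∧
      π uc = (-2 : ℂ) • 1 := by
  have key : ∀ z, UniversalEnvelopingAlgebra.lift ℂ R.lieHom (UniversalEnvelopingAlgebra.ι ℂ z) =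
      affineMap E F H z := fun z => UniversalEnvelopingAlgebra.lift_ι_apply ℂ _ z
  refine ⟨UniversalEnvelopingAlgebra.lift ℂ R.lieHom, fun n => ?_, fun n => ?_, fun n => ?_, ?_⟩
  · rw [um, key, affineMap_mode]
    simp [e]
  · rw [um, key, affineMap_mode]
    simp [f]
  · rw [um, key, affineMap_mode]
    simp [h]
  · rw [uc, key, affineMap_central]

end

theorem criticalOperators_of_isFOp {lam : ℂ} (hlam : lam ≠ 0) {c : PowerSeries ℂ}
    {F : ℤ → Fock →ₗ[ℂ] Fock} (hF : Fock.IsFOp lam c F) :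
    CriticalOperators (Fock.E lam) F (Fock.H lam) where
  EE := (Fock.rep lam).EE
  HE := (Fock.rep lam).HE
  HH := (Fock.rep lam).HH
  FF := hF.F_F hlam
  EF m n v := by
    rw [hF.F_E n m v]
    split_ifs <;> module
  HF m n v := by
    rw [hF.F_H n m v]
    abel

end AffineSl2
end

noncomputable section

set_option linter.unusedSectionVars false

-- The constant coefficient of `c` plays the role of the eigenvalue of `T(1)`, which is `lam * mu`
-- on any Whittaker vector; this makes `f(1)` act on the vacuum by `mu`.
open MvPolynomial in
theorem Fock.fvec_one {lam mu : ℂ} {xi : PowerSeries Fock}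
    (hxi : Fock.xs lam * xi = 1) {c : PowerSeries ℂ} (hc : PowerSeries.coeff 0 c = lam * mu) :
    Fock.fvec lam xi c 1 = mu • 1 := by
  have h1 := congrArg (PowerSeries.constantCoeff (R := Fock)) hxi
  have h2 : PowerSeries.constantCoeff (Fock.xs lam) = C lam := by
    rw [← PowerSeries.coeff_zero_eq_constantCoeff_apply, Fock.xs, PowerSeries.coeff_mk,
      Nat.cast_zero, Fock.x_zero]
  rw [map_mul, map_one, h2] at h1
  have h3 : Fock.fvec lam xi c 1 = PowerSeries.constantCoeff xi * C (lam * mu) := by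
    have h4 := Fock.fvec_eq lam xi c 0
    rw [Nat.cast_zero, sub_zero] at h4
    rw [h4, PowerSeries.coeff_zero_eq_constantCoeff_apply, Fock.fs, map_mul, map_sub, map_mul,
      PowerSeries.constantCoeff_X, zero_mul, sub_zero,
      ← PowerSeries.coeff_zero_eq_constantCoeff_apply (c.map _), PowerSeries.coeff_map, hc]
    rfl
  rw [h3, C_mul, ← mul_assoc, mul_comm _ (C lam), h1, one_mul, ← algebraMap_eq,
    Algebra.algebraMap_eq_smul_one]

namespace AffineSl2

/-! ### The universal property of the universal Whittaker module -/

theorem smul_whittakerVector_eq_zero {lam mu kappa : ℂ} {u : U}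
    (hu : u ∈ whittakerIdeal lam mu kappa) : u • whittakerVector lam mu kappa = 0 := by
  rw [whittakerVector, ← Submodule.Quotient.mk_smul, smul_eq_mul, mul_one]
  exact (Submodule.Quotient.mk_eq_zero _).2 hu

theorem exists_eq_smul_whittakerVector (lam mu kappa : ℂ) (v : Whittaker lam mu kappa) :
    ∃ u : U, v = u • whittakerVector lam mu kappa := by
  obtain ⟨u, rfl⟩ := Submodule.Quotient.mk_surjective _ v
  exact ⟨u, by rw [whittakerVector, ← Submodule.Quotient.mk_smul, smul_eq_mul, mul_one]⟩

theorem uc_smul_of_generator {M : Type*} [AddCommGroup M] [Module ℂ M] [Module U M]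
    [IsScalarTower ℂ U M] {w : M} {kappa : ℂ} (hgen : ∀ v : M, ∃ u : U, v = u • w)
    (hw : uc • w = kappa • w) (v : M) : uc • v = kappa • v := by
  obtain ⟨u, rfl⟩ := hgen v
  rw [← mul_smul, uc_commute, mul_smul, hw, smul_comm]

theorem uc_smul_whittakerVector (lam mu kappa : ℂ) :
    uc • whittakerVector lam mu kappa = kappa • whittakerVector lam mu kappa := by
  have h1 := smul_whittakerVector_eq_zero (lam := lam) (mu := mu) (kappa := kappa)
    (u := uc - algebraMap ℂ U kappa) (Ideal.subset_span (by simp))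
  rwa [sub_smul, algebraMap_smul, sub_eq_zero] at h1

theorem isWhittakerVector_whittakerVector (lam mu kappa : ℂ) :
    IsWhittakerVector lam mu (whittakerVector lam mu kappa) where
  e_pos n hn := smul_whittakerVector_eq_zero
    (Ideal.subset_span (Or.inl ⟨n, hn, Or.inr (Or.inl rfl)⟩))
  e_zero := by
    have h1 := smul_whittakerVector_eq_zero (lam := lam) (mu := mu) (kappa := kappa)
      (u := um e 0 - algebraMap ℂ U lam) (Ideal.subset_span (by simp))
    rwa [sub_smul, algebraMap_smul, sub_eq_zero] at h1
  h_pos n hn := smul_whittakerVector_eq_zero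
    (Ideal.subset_span (Or.inl ⟨n, hn, Or.inr (Or.inr rfl)⟩))
  f_pos n hn := smul_whittakerVector_eq_zero
    (Ideal.subset_span (Or.inl ⟨n - 1, by omega, Or.inl (by rw [sub_add_cancel])⟩))
  f_one := by
    have h1 := smul_whittakerVector_eq_zero (lam := lam) (mu := mu) (kappa := kappa)
      (u := um f 1 - algebraMap ℂ U mu) (Ideal.subset_span (by simp))
    rwa [sub_smul, algebraMap_smul, sub_eq_zero] at h1

section

variable {M M' : Type*} [AddCommGroup M] [Module ℂ M] [Module U M] [IsScalarTower ℂ U M]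
  [AddCommGroup M'] [Module ℂ M'] [Module U M'] [IsScalarTower ℂ U M']

theorem IsWhittakerVector.exists_hom {lam mu kappa : ℂ} {w : M} (hw : IsWhittakerVector lam mu w)
    (hc : uc • w = kappa • w) :
    ∃ ρ : Whittaker lam mu kappa →ₗ[U] M, ρ (whittakerVector lam mu kappa) = w := by
  refine ⟨Submodule.liftQ _ (LinearMap.toSpanSingleton U M w) ?_, ?_⟩
  · rw [whittakerIdeal, Ideal.span, Submodule.span_le]
    rintro u (⟨i, hi, rfl | rfl | rfl⟩ | rfl | rfl | rfl) <;>
      rw [SetLike.mem_coe, LinearMap.mem_ker, LinearMap.toSpanSingleton_apply]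
    · exact hw.f_pos _ (by omega)
    · exact hw.e_pos _ hi
    · exact hw.h_pos _ hi
    · rw [sub_smul, algebraMap_smul, hw.f_one, sub_self]
    · rw [sub_smul, algebraMap_smul, hw.e_zero, sub_self]
    · rw [sub_smul, algebraMap_smul, hc, sub_self]
  · rw [whittakerVector, Submodule.liftQ_apply, LinearMap.toSpanSingleton_apply, one_smul]

theorem map_tMode (φ : M →ₗ[U] M') (hM : IsRestricted M) (n : ℤ) (v : M) :
    φ (tMode n v) = tMode n (φ v) := by
  rw [tMode, map_finsum φ (finite_support_tTerm hM n v), tMode]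
  exact finsum_congr fun k => φ.map_smul _ _

theorem IsWhittakerVector.map {lam mu : ℂ} {w : M} (hw : IsWhittakerVector lam mu w)
    (φ : M →ₗ[U] M') : IsWhittakerVector lam mu (φ w) where
  e_pos n hn := by rw [← map_smul, hw.e_pos n hn, map_zero]
  e_zero := by rw [← map_smul, hw.e_zero, LinearMap.map_smul_of_tower]
  h_pos n hn := by rw [← map_smul, hw.h_pos n hn, map_zero]
  f_pos n hn := by rw [← map_smul, hw.f_pos n hn, map_zero]
  f_one := by rw [← map_smul, hw.f_one, LinearMap.map_smul_of_tower]

theorem IsRestricted.of_surjective (hM : IsRestricted M) {φ : M →ₗ[U] M'}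
    (hφ : Function.Surjective φ) : IsRestricted M' := by
  intro v x
  obtain ⟨v, rfl⟩ := hφ v
  obtain ⟨N, hN⟩ := hM v x
  exact ⟨N, fun n hn => by rw [← map_smul, hN n hn, map_zero]⟩

/-! ### Cyclic modules on which the `T(n)` act by scalars on the generator -/

/-- A restricted module of level `-2` generated by a Whittaker vector on which each `T(n)` with
`n ≤ 0` acts by the scalar `d n`. -/
structure IsCriticalCyclic (lam mu : ℂ) (d : ℤ → ℂ) (w : M) : Prop where
  restricted : IsRestricted M
  level : ∀ v : M, uc • v = (-2 : ℂ) • v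
  vector : IsWhittakerVector lam mu w
  generator : ∀ v : M, ∃ u : U, v = u • w
  scalar : ∀ n ≤ 0, tMode n w = d n • w

/-- The operators `e(n)`, `h(n)` on a module of level `-2`. -/
def borelRep (hc : ∀ v : M, uc • v = (-2 : ℂ) • v) : BorelRep M where
  E n := Algebra.lsmul ℂ ℂ M (um e n)
  H n := Algebra.lsmul ℂ ℂ M (um h n)
  EE m n v := by
    simp only [Algebra.lsmul_coe, ← mul_smul]
    rw [um_e_mul_um_e]
  HE m n v := by
    simp only [Algebra.lsmul_coe, ← mul_smul]
    rw [um_h_mul_um_e, add_smul, smul_assoc]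
  HH m n v := by
    simp only [Algebra.lsmul_coe, ← mul_smul]
    rw [um_h_mul_um_h, add_smul, smul_assoc, hc, smul_smul]
    congr 2
    split_ifs <;> ring

/-- The modes `e`, `h` preserve the range by the universal property. Stability under `f` is obtained
first on `w`, by descending `n` and solving `T(n) w = d n w` for `f(n) w`, then everywhere by
commuting `f(n)` with the creation operators. -/
theorem IsCriticalCyclic.exists_fock {lam mu : ℂ} {d : ℤ → ℂ} {w : M}
    (hM : IsCriticalCyclic lam mu d w) (hlam : lam ≠ 0) :
    ∃ Φ : Fock →ₗ[ℂ] M, Φ 1 = w ∧ (∀ n p, Φ (Fock.E lam n p) = um e n • Φ p) ∧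
      (∀ n p, Φ (Fock.H lam n p) = um h n • Φ p) ∧ Function.Surjective Φ := by
  obtain ⟨Φ, h1, hE, hH⟩ := Fock.exists_lift (borelRep hM.level) lam w
    ⟨hM.vector.e_pos, hM.vector.e_zero, hM.vector.h_pos⟩
  change ∀ n p, Φ (Fock.E lam n p) = um e n • Φ p at hE
  change ∀ n p, Φ (Fock.H lam n p) = um h n • Φ p at hH
  refine ⟨Φ, h1, hE, hH, ?_⟩
  set K := LinearMap.range Φ with hK
  have hw : w ∈ K := ⟨1, h1⟩
  have he : ∀ n, ∀ v ∈ K, um e n • v ∈ K := by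
    rintro n _ ⟨p, rfl⟩
    exact ⟨_, hE n p⟩
  have hh : ∀ n, ∀ v ∈ K, um h n • v ∈ K := by
    rintro n _ ⟨p, rfl⟩
    exact ⟨_, hH n p⟩
  have hfw : ∀ b : ℕ, ∀ n : ℤ, 1 - b ≤ n → um f n • w ∈ K := by
    intro b
    induction b with
    | zero =>
      intro n hn
      rcases eq_or_lt_of_le (show 1 ≤ n by simpa using hn) with rfl | hn
      · rw [hM.vector.f_one]
        exact K.smul_mem _ hw
      · rw [hM.vector.f_pos n hn]
        exact K.zero_mem
    | succ b ih =>
      intro n hn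
      by_cases hbn : 1 - (b : ℤ) ≤ n
      · exact ih n hbn
      -- Only the vectors `f(j) w` with `j > n` enter the remainder, and these are covered by the
      -- induction hypothesis.
      · have h2 := hM.vector.tMode_sub_mem hM.restricted (n := n) (by omega) K
          (fun k j _ hj => he _ _ (ih j (by omega))) (fun k j _ _ => hh _ _ (hh _ _ hw))
          (fun k _ => hh _ _ hw)
        rw [hM.scalar n (by omega)] at h2
        have h3 := K.smul_mem lam⁻¹ (K.sub_mem (K.smul_mem (d n) hw) h2)
        rwa [sub_sub_cancel, smul_smul, inv_mul_cancel₀ hlam, one_smul] at h3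
  have hf : ∀ n, ∀ v ∈ K, um f n • v ∈ K := by
    let L : Submodule ℂ Fock :=
      { carrier := {p | ∀ n, um f n • Φ p ∈ K}
        add_mem' := fun {p q} hp hq n => by
          rw [map_add, smul_add]; exact K.add_mem (hp n) (hq n)
        zero_mem' := fun n => by rw [map_zero, smul_zero]; exact K.zero_mem
        smul_mem' := fun r p hp n => by
          rw [map_smul, smul_comm]; exact K.smul_mem _ (hp n) }
    have hL : ∀ p, p ∈ L := Fock.eq_top_of_stable lam
      (fun n => by rw [h1]; exact hfw (1 - n).toNat n (by omega))
      (fun i p hp n => by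
        have h2 := um_e_mul_um_f (-(i + 1)) n
        rw [add_assoc, ← sub_eq_iff_eq_add] at h2
        rw [hE, ← mul_smul, ← h2, sub_smul, mul_smul, add_smul, smul_assoc, hM.level]
        exact K.sub_mem (he _ _ (hp n)) (K.add_mem (hh _ _ ⟨p, rfl⟩)
          (K.smul_mem _ (K.smul_mem _ ⟨p, rfl⟩))))
      (fun j p hp n => by
        have h2 := um_h_mul_um_f (-j) n
        rw [eq_sub_iff_add_eq] at h2
        rw [hH, ← mul_smul, ← h2, add_smul, mul_smul, smul_assoc]
        exact K.add_mem (hh _ _ (hp n)) (K.smul_mem _ (hp _)))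
    rintro n _ ⟨p, rfl⟩
    exact hL p n
  intro v
  obtain ⟨u, rfl⟩ := hM.generator v
  exact smul_mem_of_stable he hf (fun v hv => by rw [hM.level]; exact K.smul_mem _ hv) u hw

/-- The preimage in the Fock space of a nonzero submodule is a nonzero lowering subspace; it
contains the vacuum, so the submodule contains the generator. -/
theorem IsCriticalCyclic.isSimpleModule {lam mu : ℂ} {d : ℤ → ℂ} {w : M}
    (hM : IsCriticalCyclic lam mu d w) (hlam : lam ≠ 0) [Nontrivial M] : IsSimpleModule U M := by
  obtain ⟨Φ, h1, hE, hH, hsurj⟩ := hM.exists_fock hlam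
  rw [isSimpleModule_iff]
  refine ⟨fun N => or_iff_not_imp_left.2 fun hN => ?_⟩
  have hlow : Fock.IsLowering lam ((N.restrictScalars ℂ).comap Φ) :=
    ⟨fun n _ p hp => by
      rw [Submodule.mem_comap, hE]
      exact N.smul_mem _ hp, fun n _ p hp => by
      rw [Submodule.mem_comap, hH]
      exact N.smul_mem _ hp⟩
  have hne : (N.restrictScalars ℂ).comap Φ ≠ ⊥ := by
    obtain ⟨v, hv, hv0⟩ := (Submodule.ne_bot_iff N).1 hN
    obtain ⟨p, rfl⟩ := hsurj v
    refine (Submodule.ne_bot_iff _).2 ⟨p, hv, ?_⟩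
    rintro rfl
    exact hv0 (map_zero _)
  have hw : w ∈ N := h1 ▸ (hlow.one_mem hlam hne : Φ 1 ∈ N)
  rw [eq_top_iff]
  rintro v -
  obtain ⟨u, rfl⟩ := hM.generator v
  exact N.smul_mem _ hw

end

/-! ### The critical quotient -/

theorem isCriticalCyclic_quotient {lam mu : ℂ} {d : ℤ → ℂ}
    (N : Submodule U (Whittaker lam mu (-2)))
    (hd : ∀ n ≤ 0, tMode n (N.mkQ (whittakerVector lam mu (-2))) =
      d n • N.mkQ (whittakerVector lam mu (-2))) :
    IsCriticalCyclic lam mu d (N.mkQ (whittakerVector lam mu (-2))) where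
  restricted := (whittaker_isRestricted lam mu (-2)).of_surjective N.mkQ_surjective
  level v := by
    obtain ⟨v, rfl⟩ := N.mkQ_surjective v
    rw [← map_smul, uc_smul_of_generator (exists_eq_smul_whittakerVector lam mu (-2))
      (uc_smul_whittakerVector lam mu (-2)), LinearMap.map_smul_of_tower]
  vector := (isWhittakerVector_whittakerVector lam mu (-2)).map N.mkQ
  generator v := by
    obtain ⟨v, rfl⟩ := N.mkQ_surjective v
    obtain ⟨u, rfl⟩ := exists_eq_smul_whittakerVector lam mu (-2) v
    exact ⟨u, map_smul _ _ _⟩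
  scalar := hd

theorem criticalSubmodule_le_iff {lam mu : ℂ} {c : LaurentSeries ℂ}
    (N : Submodule U (Whittaker lam mu (-2))) :
    criticalSubmodule lam mu c ≤ N ↔ ∀ n ≤ 0, tMode n (N.mkQ (whittakerVector lam mu (-2))) =
      c.coeff (-n - 2) • N.mkQ (whittakerVector lam mu (-2)) := by
  have key : ∀ n : ℤ, tMode n (whittakerVector lam mu (-2)) -
      algebraMap ℂ U (c.coeff (-n - 2)) • whittakerVector lam mu (-2) ∈ N ↔
      tMode n (N.mkQ (whittakerVector lam mu (-2))) =
        c.coeff (-n - 2) • N.mkQ (whittakerVector lam mu (-2)) := fun n => by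
    rw [← Submodule.Quotient.mk_eq_zero, ← Submodule.mkQ_apply, map_sub, sub_eq_zero, map_smul,
      algebraMap_smul, map_tMode _ (whittaker_isRestricted lam mu (-2))]
  rw [criticalSubmodule, Submodule.span_le]
  constructor
  · intro h1 n hn
    exact (key n).1 (h1 ⟨n, hn, rfl⟩)
  · rintro h1 _ ⟨n, hn, rfl⟩
    exact (key n).2 (h1 n hn)

theorem isCriticalCyclic_criticalWhittaker (lam mu : ℂ) (c : LaurentSeries ℂ) :
    IsCriticalCyclic lam mu (fun n => c.coeff (-n - 2))
      ((criticalSubmodule lam mu c).mkQ (whittakerVector lam mu (-2))) :=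
  isCriticalCyclic_quotient _ ((criticalSubmodule_le_iff _).1 le_rfl)

/-- The operators `F n` make the Fock space a module in which the vacuum is a nonzero Whittaker
vector; the resulting map `ρ` from the universal module kills all `(T(n) - c_n) w` but not `w`. -/
theorem criticalSubmodule_ne_top {lam : ℂ} (hlam : lam ≠ 0) (mu : ℂ) (c : LaurentSeries ℂ) :
    criticalSubmodule lam mu c ≠ ⊤ := by
  -- The coefficient of index `k` is `c_(1-k)`, which stands at exponent `k - 3` in the Laurent
  -- series; index `0`, the mode `T(1)`, is not prescribed by `c` and must be `lam * mu`.
  set cs : PowerSeries ℂ :=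
    PowerSeries.mk fun k => if k = 0 then lam * mu else c.coeff ((k : ℤ) - 3) with hcs
  obtain ⟨F, hF⟩ := Fock.exists_isFOp hlam cs
  obtain ⟨π, hπe, hπf, hπh, hπc⟩ := (criticalOperators_of_isFOp hlam hF).exists_algHom
  obtain ⟨xi, hxi, hF1⟩ := hF.F_one
  let _ : Module U Fock := Module.compHom Fock (π : U →+* Module.End ℂ Fock)
  have hsm : ∀ (u : U) (p : Fock), u • p = π u p := fun _ _ => rfl
  have : IsScalarTower ℂ U Fock := ⟨fun r u p => by rw [hsm, hsm, map_smul]; rfl⟩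
  have hone := Fock.rep_isWhittaker lam
  have hvec : IsWhittakerVector lam mu (1 : Fock) :=
    { e_pos := fun n hn => by rw [hsm, hπe]; exact hone.E_pos n hn
      e_zero := by rw [hsm, hπe]; exact hone.E_zero
      h_pos := fun n hn => by rw [hsm, hπh]; exact hone.H_pos n hn
      f_pos := fun n hn => by rw [hsm, hπf, hF1, Fock.fvec_of_lt _ _ _ hn]
      f_one := by
        rw [hsm, hπf, hF1, Fock.fvec_one hxi (mu := mu)
          (by rw [hcs, PowerSeries.coeff_mk, if_pos rfl])] }
  obtain ⟨ρ, hρ⟩ := hvec.exists_hom (kappa := -2) (by rw [hsm, hπc]; rfl)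
  have hM := whittaker_isRestricted lam mu (-2)
  have hc : ∀ v : Whittaker lam mu (-2), uc • v = (-2 : ℂ) • v :=
    uc_smul_of_generator (exists_eq_smul_whittakerVector lam mu (-2))
      (uc_smul_whittakerVector lam mu (-2))
  set w := whittakerVector lam mu (-2) with hw
  have hwv : IsWhittakerVector lam mu w := isWhittakerVector_whittakerVector lam mu (-2)
  -- Modulo images of creation operators, which the vacuum projection kills, `T(n) w` is `lam f(n)
  -- w`.
  have hvac : ∀ n ≤ 0, Fock.vac (ρ (tMode n w)) = c.coeff (-n - 2) := by
    intro n hn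
    have h1 := hwv.tMode_sub_mem hM hn
      (LinearMap.ker (Fock.vac.toLinearMap ∘ₗ ρ.restrictScalars ℂ))
      (fun k j hk _ => by
        change Fock.vac (ρ _) = 0
        rw [map_smul, hsm, hπe, Fock.vac_E _ hk])
      (fun k j hk _ => by
        change Fock.vac (ρ _) = 0
        obtain ⟨k, rfl⟩ : ∃ i : ℕ, k = -i := ⟨(-k).toNat, by omega⟩
        rw [map_smul, hsm, hπh, Fock.vac_H])
      (fun k hk => by
        change Fock.vac (ρ _) = 0
        obtain ⟨k, rfl⟩ : ∃ i : ℕ, k = -i := ⟨(-k).toNat, by omega⟩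
        rw [map_smul, hsm, hπh, Fock.vac_H])
    change Fock.vac (ρ _) = 0 at h1
    rw [map_sub, map_sub, sub_eq_zero, LinearMap.map_smul_of_tower, map_smul ρ, hρ, map_smul, hsm,
      hπf, hF1, Fock.vac_fvec hlam hxi, smul_eq_mul, mul_inv_cancel_left₀ hlam] at h1
    obtain ⟨b, rfl⟩ : ∃ b : ℕ, n = 1 - (b + 1 : ℕ) := ⟨(-n).toNat, by omega⟩
    rw [h1, Fock.eig_eq, hcs, PowerSeries.coeff_mk, if_neg (by omega)]
    congr 1
    push_cast
    ring
  -- Because `T(n)` is central, these vectors are eigenvectors of the nonnegative modes with the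
  -- same eigenvalues as `w`. Their span is a lowering subspace without vacuum component, hence
  -- zero.
  set W : Submodule ℂ Fock := Submodule.span ℂ
    {p | ∃ n : ℤ, n ≤ 0 ∧ p = ρ (tMode n w - c.coeff (-n - 2) • w)} with hW
  have hcomm : ∀ (u : U) (r : ℂ), u • w = r • w → ∀ p ∈ W, π u p ∈ W := by
    intro u r hu p hp
    induction hp using Submodule.span_induction with
    | zero => rw [map_zero]; exact W.zero_mem
    | add p q _ _ hp hq => rw [map_add]; exact W.add_mem hp hq
    | smul s p _ hp => rw [map_smul]; exact W.smul_mem _ hp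
    | mem p hp =>
      obtain ⟨n, hn, rfl⟩ := hp
      have h1 : u • (tMode n w - c.coeff (-n - 2) • w) = r • (tMode n w - c.coeff (-n - 2) • w) := by
        rw [smul_sub, smul_tMode hM hc, hu, smul_sub, smul_comm, hu, smul_comm r]
        congr 1
        exact (tLin hM n).map_smul r w
      rw [← hsm, ← map_smul, h1, LinearMap.map_smul_of_tower]
      exact W.smul_mem _ (Submodule.subset_span ⟨n, hn, rfl⟩)
  have hlow : Fock.IsLowering lam W :=
    ⟨fun n hn p hp => by
      rw [← hπe]
      rcases eq_or_lt_of_le hn with rfl | hn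
      · exact hcomm _ lam hwv.e_zero p hp
      · exact hcomm _ 0 (by rw [hwv.e_pos n hn, zero_smul]) p hp, fun n hn p hp => by
      rw [← hπh]
      exact hcomm _ 0 (by rw [hwv.h_pos n hn, zero_smul]) p hp⟩
  have hWvac : W ≤ LinearMap.ker Fock.vac.toLinearMap := by
    rw [hW, Submodule.span_le]
    rintro _ ⟨n, hn, rfl⟩
    change Fock.vac _ = 0
    rw [map_sub, map_sub, hvac n hn, LinearMap.map_smul_of_tower, hρ, map_smul, map_one,
      smul_eq_mul, mul_one, sub_self]
  have hWbot : W = ⊥ := by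
    by_contra h0
    have h1 := hWvac (hlow.one_mem hlam h0)
    change Fock.vac 1 = 0 at h1
    rw [map_one] at h1
    exact one_ne_zero h1
  have hle : criticalSubmodule lam mu c ≤ LinearMap.ker ρ := by
    rw [criticalSubmodule, Submodule.span_le]
    rintro _ ⟨n, hn, rfl⟩
    have h1 : ρ (tMode n w - c.coeff (-n - 2) • w) ∈ W := Submodule.subset_span ⟨n, hn, rfl⟩
    rw [hWbot, Submodule.mem_bot] at h1
    rw [algebraMap_smul]
    exact h1
  intro htop
  rw [htop, top_le_iff] at hle
  have h1 : w ∈ LinearMap.ker ρ := hle ▸ Submodule.mem_top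
  rw [LinearMap.mem_ker, hρ] at h1
  exact one_ne_zero h1

theorem isSimpleModule_criticalWhittaker {lam : ℂ} (hlam : lam ≠ 0) (mu : ℂ) (c : LaurentSeries ℂ) :
    IsSimpleModule U (CriticalWhittaker lam mu c) := by
  have : Nontrivial (CriticalWhittaker lam mu c) :=
    Submodule.Quotient.nontrivial_iff.2 (criticalSubmodule_ne_top hlam mu c)
  exact (isCriticalCyclic_criticalWhittaker lam mu c).isSimpleModule hlam

/-- Schur's lemma supplies the scalars by which the central `T(n)` act on the quotient. The critical
submodule they define lies in `N` and is itself maximal by part (a), so it equals the proper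
submodule `N`. -/
theorem exists_eq_criticalSubmodule {lam : ℂ} (hlam : lam ≠ 0) (mu : ℂ)
    (N : Submodule U (Whittaker lam mu (-2)))
    (hN : IsSimpleModule U (Whittaker lam mu (-2) ⧸ N)) :
    ∃ c : LaurentSeries ℂ, (∀ k : ℤ, k < -2 → c.coeff k = 0) ∧ N = criticalSubmodule lam mu c := by
  set w := N.mkQ (whittakerVector lam mu (-2)) with hw
  have hM : IsRestricted (Whittaker lam mu (-2) ⧸ N) :=
    (whittaker_isRestricted lam mu (-2)).of_surjective N.mkQ_surjective
  have hgen : ∀ v, ∃ u : U, v = u • w := by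
    intro v
    obtain ⟨v, rfl⟩ := N.mkQ_surjective v
    obtain ⟨u, rfl⟩ := exists_eq_smul_whittakerVector lam mu (-2) v
    exact ⟨u, map_smul _ _ _⟩
  have hc : ∀ v : Whittaker lam mu (-2) ⧸ N, uc • v = (-2 : ℂ) • v :=
    uc_smul_of_generator hgen (by
      rw [hw, ← map_smul, uc_smul_whittakerVector, LinearMap.map_smul_of_tower])
  obtain ⟨S, hS, hspan⟩ := exists_countable_span_eq_top
  let π : U →ₗ[ℂ] (Whittaker lam mu (-2) ⧸ N) :=
    (LinearMap.toSpanSingleton U _ w).restrictScalars ℂ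
  have hspan' : Submodule.span ℂ (π '' S) = ⊤ := by
    rw [← Submodule.map_span, hspan, Submodule.map_top, LinearMap.range_eq_top]
    intro v
    obtain ⟨u, rfl⟩ := hgen v
    exact ⟨u, rfl⟩
  choose d hd using fun n => exists_eq_smul_of_isSimpleModule (hS.image π) hspan' (tEnd hM hc n)
  -- The eigenvalue `d n` belongs at exponent `k = -n - 2`; exponents below `-2` would correspond to
  -- `n > 0`.
  let c : LaurentSeries ℂ := HahnSeries.ofSuppBddBelow (fun k => if k < -2 then 0 else d (-k - 2))
    ⟨-2, fun k hk => by
      by_contra hk'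
      exact hk (if_pos (by omega))⟩
  have hcc : ∀ k, c.coeff k = if k < -2 then 0 else d (-k - 2) := fun _ => rfl
  refine ⟨c, fun k hk => by rw [hcc, if_pos hk], ?_⟩
  have hle : criticalSubmodule lam mu c ≤ N := by
    rw [criticalSubmodule_le_iff]
    intro n hn
    rw [hcc, if_neg (by omega), show -(-n - 2) - 2 = n by ring]
    exact hd n w
  have h1 := isSimpleModule_iff_isCoatom.1 (isSimpleModule_criticalWhittaker hlam mu c)
  exact ((h1.le_iff.1 hle).resolve_left (isSimpleModule_iff_isCoatom.1 hN).1)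

/-- The image of `w` generates the target, so there `e(0) - lam` and `f(1) - mu` are locally
nilpotent and each `T(n)` with `n ≤ 0` is the scalar `c_n`. Comparing with the eigenvalues on the
nonzero vector `w'` identifies all parameters. -/
theorem eq_of_criticalWhittaker_equiv {lam mu lam' mu' : ℂ} {c c' : LaurentSeries ℂ}
    (hlam' : lam' ≠ 0)
    (hc : ∀ k : ℤ, k < -2 → c.coeff k = 0) (hc' : ∀ k : ℤ, k < -2 → c'.coeff k = 0)
    (φ : CriticalWhittaker lam mu c ≃ₗ[U] CriticalWhittaker lam' mu' c') :
    lam = lam' ∧ mu = mu' ∧ c = c' := by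
  have hA := isCriticalCyclic_criticalWhittaker lam mu c
  have hB := isCriticalCyclic_criticalWhittaker lam' mu' c'
  have : Nontrivial (CriticalWhittaker lam' mu' c') :=
    Submodule.Quotient.nontrivial_iff.2 (criticalSubmodule_ne_top hlam' mu' c')
  set w := (criticalSubmodule lam mu c).mkQ (whittakerVector lam mu (-2)) with hw
  set w' := (criticalSubmodule lam' mu' c').mkQ (whittakerVector lam' mu' (-2)) with hw'
  have hφw : IsWhittakerVector lam mu (φ w) := hA.vector.map φ.toLinearMap
  have hφg : ∀ v, ∃ u : U, v = u • φ w := by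
    intro v
    obtain ⟨u, hu⟩ := hA.generator (φ.symm v)
    exact ⟨u, by rw [← map_smul, ← hu, LinearEquiv.apply_symm_apply]⟩
  have h0 : w' ≠ 0 := by
    intro h0
    obtain ⟨v, hv⟩ := exists_ne (0 : CriticalWhittaker lam' mu' c')
    obtain ⟨u, rfl⟩ := hB.generator v
    exact hv (by rw [h0, smul_zero])
  refine ⟨?_, ?_, ?_⟩
  · exact (eq_of_mem_maxGenEigenspace h0 hB.vector.e_zero
      (maxGenEigenspace_e hB.level hφg hφw.e_zero w')).symm
  · exact (eq_of_mem_maxGenEigenspace h0 hB.vector.f_one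
      (maxGenEigenspace_f hB.level hφg hφw.f_one w')).symm
  · have h1 : ∀ n ≤ 0, c.coeff (-n - 2) = c'.coeff (-n - 2) := by
      intro n hn
      obtain ⟨u, hu⟩ := hφg w'
      have h2 : tMode n (φ w) = c.coeff (-n - 2) • φ w := by
        have h3 := map_tMode φ.toLinearMap hA.restricted n w
        rw [hA.scalar n hn, LinearMap.map_smul_of_tower] at h3
        exact h3.symm
      have h4 : tMode n w' = c.coeff (-n - 2) • w' := by
        rw [hu, ← smul_tMode hB.restricted hB.level, h2, smul_comm]
      rw [hB.scalar n hn] at h4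
      exact (smul_left_injective ℂ h0 h4).symm
    ext k
    by_cases hk : k < -2
    · rw [hc k hk, hc' k hk]
    · have h2 := h1 (-k - 2) (by omega)
      rwa [show -(-k - 2) - 2 = k by ring] at h2

end AffineSl2

end

/-! ### The theorem. -/

theorem theorem3p10 :
    (∀ (lam mu : ℂ) (c : LaurentSeries ℂ), lam ≠ 0 → (∀ k : ℤ, k < -2 → c.coeff k = 0) →
      IsSimpleModule AffineSl2.U (AffineSl2.CriticalWhittaker lam mu c)) ∧
    (∀ lam mu : ℂ, lam ≠ 0 →
      ∀ N : Submodule AffineSl2.U (AffineSl2.Whittaker lam mu (-2)),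
        IsSimpleModule AffineSl2.U (AffineSl2.Whittaker lam mu (-2) ⧸ N) →
        ∃ c : LaurentSeries ℂ, (∀ k : ℤ, k < -2 → c.coeff k = 0) ∧
          N = AffineSl2.criticalSubmodule lam mu c) ∧
    (∀ (lam mu lam' mu' : ℂ) (c c' : LaurentSeries ℂ), lam ≠ 0 → lam' ≠ 0 →
      (∀ k : ℤ, k < -2 → c.coeff k = 0) → (∀ k : ℤ, k < -2 → c'.coeff k = 0) →
      (Nonempty (AffineSl2.CriticalWhittaker lam mu c ≃ₗ[AffineSl2.U]
          AffineSl2.CriticalWhittaker lam' mu' c') ↔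
        lam = lam' ∧ mu = mu' ∧ c = c')) := by
  refine ⟨fun lam mu c hlam _ => AffineSl2.isSimpleModule_criticalWhittaker hlam mu c,
    fun lam mu hlam N hN => AffineSl2.exists_eq_criticalSubmodule hlam mu N hN,
    fun lam mu lam' mu' c c' _ hlam' hc hc' => ⟨?_, ?_⟩⟩
  · rintro ⟨φ⟩
    exact AffineSl2.eq_of_criticalWhittaker_equiv hlam' hc hc' φ
  · rintro ⟨rfl, rfl, rfl⟩
    exact ⟨LinearEquiv.refl _ _⟩
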